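/- Let $d,p\ge 1$, let $n_1,\dots,n_d\ge 1$, and let $X_{ij}$ ($1\le i\le n_j$, $1\le j\le d$) be independent random variables with unit variance and with $\mathbb{E}X_{ij}^k=\mathbb{E}Z^k$ for $k=1,\dots,p$, where $Z\sim N(0,1)$. Let $W_j=n_j^{-1/2}\sum_{i=1}^{n_j}X_{ij}$, $\mathbf{W}=(W_1,\dots,W_d)$, let $\mathbf{Z}$ be a standard normal vector in $\mathbb{R}^d$, and let $P(\mathbf{w})=A+B\sum_{i=1}^d|w_i|^{r_i}$ with constants $A,B,r_1,\dots,r_d\ge 0$. Suppose that $\mathbb{E}|X_{ij}|^{r_l+p+1}<\infty$ for all $i,j,l$. Suppose that $g\in C_P^p(\mathbb{R}^d)$, that is, all partial derivatives of $g:\mathbb{R}^d\to\mathbb{R}$ up to order $p$ exist and those of order $k$ satisfy $\big|\partial^k g(\mathbf{w})/\partial w_{i_1}\cdots\partial w_{i_k}\big|^{p/k}\le P(\mathbf{w})$ for all $\mathbf{w}\in\mathbb{R}^d$ and $1\le k\le p$. Suppose that $h\in C_b^p(\mathbb{R})$, that is, $h^{(p-1)}$ exists and is absolutely continuous on compact intervals,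 and the derivatives $h^{(1)},\dots,h^{(p)}$ are bounded (the last one where it exists); put $h_p=\sum_{k=1}^p S(p,k)\,\|h^{(k)}\|_\infty$ with $S(p,k)$ the Stirling numbers of the second kind. Then $h(g(\mathbf{W}))$ and $h(g(\mathbf{Z}))$ are integrable and $$|\mathbb{E}h(g(\mathbf{W}))-\mathbb{E}h(g(\mathbf{Z}))|\le\frac{p+1}{p!}\,h_p\,S,$$ where $$S=\sum_{j=1}^d\sum_{i=1}^{n_j}\frac{1}{n_j^{(p+1)/2}}\bigg[A\,\mathbb{E}|X_{ij}|^{p+1}+B\sum_{k=1}^d2^{r_k}\bigg(2^{r_k}\mathbb{E}|X_{ij}|^{p+1}\,\mathbb{E}|W_k|^{r_k}+\frac{2^{r_k}}{n_j^{r_k/2}}\mathbb{E}|X_{ij}|^{r_k+p+1}+\mathbb{E}|Z|^{r_k+1}\,\mathbb{E}|X_{ij}|^{p+1}\bigg)\bigg].$$ Moreover $S$ is of order $n^{-(p-1)/2}$, where $n=\min_j n_j$: for every $M$ there is a constant $C$, depending only on $d,p,A,B,r_1,\dots,r_d$ and $M$, such that $S\le C\,n^{-(p-1)/2}$ for all such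 arrays with $\mathbb{E}|X_{ij}|^{r_l+p+1}\le M$ for all $i,j,l$. -/

import Mathlib

open MeasureTheory ProbabilityTheory

noncomputable section

/-- Iterated partial derivatives on `ℝ^d`: `iterPartial g [i₁, …, iₖ]` is
`∂^k g / ∂w_{i₁} ⋯ ∂w_{iₖ}` (the last listed variable is differentiated first). -/
def iterPartial {d : ℕ} (g : (Fin d → ℝ) → ℝ) : List (Fin d) → (Fin d → ℝ) → ℝ
  | [] => g
  | i :: l => fun w => lineDeriv ℝ (iterPartial g l) w (Pi.single i 1)

/-- The class `C_P^n(ℝ^d)`: all partial derivatives of `g` of order at most `n` exist, `P` is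
non-negative, and every partial derivative of order `k`, `1 ≤ k ≤ n`, satisfies
`|∂^k g(w)|^{n/k} ≤ P(w)` for all `w`. -/
structure MemCP {d : ℕ} (n : ℕ) (P : (Fin d → ℝ) → ℝ) (g : (Fin d → ℝ) → ℝ) : Prop where
  exists_partial : ∀ l : List (Fin d), l.length < n → ∀ (i : Fin d) (w : Fin d → ℝ),
    LineDifferentiableAt ℝ (iterPartial g l) w (Pi.single i 1)
  dominating_nonneg : ∀ w, 0 ≤ P w
  dominated : ∀ l : List (Fin d), 1 ≤ l.length → l.length ≤ n → ∀ w,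
    |iterPartial g l w| ^ ((n : ℝ) / (l.length : ℝ)) ≤ P w

/-- The class `C_b^n(ℝ)`, for `n ≥ 1`: the derivative of order `n - 1` exists everywhere and is
absolutely continuous (on every compact interval), and the derivatives of orders `1, …, n` are
bounded. The `n`-th derivative need only exist almost everywhere; `iteratedDeriv n h` takes the
value `0` at the points where it does not exist, which affects neither boundedness nor the
supremum norm. The function `h` itself need not be bounded. -/
structure MemCb (n : ℕ) (h : ℝ → ℝ) : Prop where
  differentiable : ∀ k, k < n - 1 → Differentiable ℝ (iteratedDeriv k h)
  absolutelyContinuous : ∀ a b : ℝ, AbsolutelyContinuousOnInterval (iteratedDeriv (n - 1) h) a b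
  bounded : ∀ k, 1 ≤ k → k ≤ n → ∃ M : ℝ, ∀ x, |iteratedDeriv k h x| ≤ M

/-- `h_n = ∑_{k=1}^n S(n,k) ‖h^{(k)}‖_∞`, with `S(n,k)` the Stirling numbers of the second kind. -/
def hConst (n : ℕ) (h : ℝ → ℝ) : ℝ :=
  ∑ k ∈ Finset.Icc 1 n, (Nat.stirlingSecond n k : ℝ) * ⨆ x : ℝ, |iteratedDeriv k h x|

/-- The polynomial dominating function `P(w) = A + B ∑_i |w_i|^{r_i}`. -/
def polyDom {d : ℕ} (A B : ℝ) (r : Fin d → ℝ) (w : Fin d → ℝ) : ℝ :=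
  A + B * ∑ i, |w i| ^ r i

/-- The law of a standard normal vector `Z` in `ℝ^d`. -/
def stdNormal (d : ℕ) : Measure (Fin d → ℝ) := Measure.pi fun _ => gaussianReal 0 1

/-- `E|Z|^s` for `Z ∼ N(0,1)`. -/
def absMomentZ (s : ℝ) : ℝ := ∫ z, |z| ^ s ∂(gaussianReal 0 1)

/-- `W_j = n_j^{-1/2} ∑_{i=1}^{n_j} X_{ij}`; the variable `X_{ij}` is `X j i`. -/
def normSum {Ω : Type*} {d : ℕ} {n : Fin d → ℕ} (X : (j : Fin d) → Fin (n j) → Ω → ℝ)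
    (ω : Ω) (j : Fin d) : ℝ :=
  (∑ i, X j i ω) / √(n j : ℝ)

/-- An array of independent random variables of unit variance whose first `p` moments are those of
`N(0,1)` (for `p ≥ 2` the condition on the variance is contained in that on the moments). -/
structure IsMatchedArray {Ω : Type*} [MeasurableSpace Ω] (μ : Measure Ω) (p : ℕ) {d : ℕ}
    {n : Fin d → ℕ} (X : (j : Fin d) → Fin (n j) → Ω → ℝ) : Prop where
  measurable : ∀ j i, Measurable (X j i)
  indep : iIndepFun (fun q : (Σ j : Fin d, Fin (n j)) => X q.1 q.2) μ
  moments : ∀ j i, ∀ k : ℕ, 1 ≤ k → k ≤ p →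
    ∫ ω, X j i ω ^ k ∂μ = ∫ z, z ^ k ∂(gaussianReal 0 1)
  variance : ∀ j i, ∫ ω, X j i ω ^ 2 ∂μ = 1

/-- The sum in the bound:
`∑_j ∑_i n_j^{-(p+1)/2} [A E|X_ij|^{p+1} + B ∑_k 2^{r_k} (2^{r_k} E|X_ij|^{p+1} E|W_k|^{r_k}
  + 2^{r_k} n_j^{-r_k/2} E|X_ij|^{r_k+p+1} + E|Z|^{r_k+1} E|X_ij|^{p+1})]`. -/
def boundSum {Ω : Type*} [MeasurableSpace Ω] (μ : Measure Ω) (p : ℕ) {d : ℕ} {n : Fin d → ℕ}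
    (X : (j : Fin d) → Fin (n j) → Ω → ℝ) (A B : ℝ) (r : Fin d → ℝ) : ℝ :=
  ∑ j : Fin d, ∑ i : Fin (n j), 1 / (n j : ℝ) ^ (((p : ℝ) + 1) / 2) *
    (A * ∫ ω, |X j i ω| ^ (p + 1) ∂μ +
      B * ∑ k : Fin d, (2 : ℝ) ^ r k *
        ((2 : ℝ) ^ r k * (∫ ω, |X j i ω| ^ (p + 1) ∂μ) * (∫ ω, |normSum X ω k| ^ r k ∂μ) +
          (2 : ℝ) ^ r k / (n j : ℝ) ^ (r k / 2) * (∫ ω, |X j i ω| ^ (r k + p + 1) ∂μ) +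
          absMomentZ (r k + 1) * ∫ ω, |X j i ω| ^ (p + 1) ∂μ))

end

section

open scoped Topology ContDiff
open Filter Set

/-! ### Finite differences -/

/-! Put `φ = h ∘ g` and join `W` to an independent `Z` by `cos a • W + sin a • Z`, `0 ≤ a ≤ π/2`.
Differentiating in `a` gives the sum over `j` of `E ∂_jφ · (-sin a W_j + cos a Z_j)`. Split `W_j`
into the `X_ij / √n_j` and give each of them the share `Z_j / n_j`. For one `X = X_ij` put `b =
n_j^{-1/2}`, freeze the other variables, and let `F(x)` be the Gaussian average of `∂_jφ` at the
path point in which `bX` is replaced by `x`. Gaussian integration by parts turns the term into `-b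
sin a · E[X F(bX) - b F'(bX)]`. This Stein expression vanishes on polynomials of degree below `p`,
because `X` has the first `p` Gaussian moments, so only Taylor remainders survive. They are
controlled by `F^{(p)}` and produce `b^{p+1}` and `1/p! + 1/(p-1)! = (p+1)/p!`
(`abs_integral_stein_le`). `F^{(p)}` contains `p + 1` derivatives of `φ`; a second integration by
parts trades one of them for the weight `Z_j / sin a`, and `sin a` cancels
(`SmoothGrowth.abs_integral_term_le`). What remains is `cos^p a ≤ cos a`, whose integral is 1.

The weighted moments `E |Z_j| |path_k|^{r_k}` are compared with those of `W_k` by Jensen's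
inequality when `r_k ≥ 1`. For `r_k < 1` convexity fails, and a quadratic majorant, which needs only
second moments, replaces it (`integral_abs_mul_rpow_le`, `integral_weightV_le`).

All this needs `φ` smooth, whereas `h^{(p)}` exists only almost everywhere and the partial
derivatives of `g` need not be continuous. The formula of Faà di Bruno, whose coefficients sum up to
Stirling numbers, is therefore proved for finite differences (`abs_fwdDiff_comp_le`). Finite
differences commute with convolution, so mollifying `φ` gives smooth functions with nearly the same
bound on the pure derivatives of order `p` (`eventually_abs_partialD_smear_le`), and the
mollification is then removed by a limit.

The order of the sum follows from moment bounds for `W_k` uniform in the sample sizes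
(`integral_sum_pow_le`): each `j` contributes `n_j` terms of size `n_j^{-(p+1)/2}`. -/

theorem deriv_fwdDiff_iter {f : ℝ → ℝ} (hf : Differentiable ℝ f) (s : ℝ) (n : ℕ) :
    Differentiable ℝ ((fwdDiff s)^[n] f) ∧ deriv ((fwdDiff s)^[n] f) = (fwdDiff s)^[n] (deriv f) := by
  induction n generalizing f with
  | zero => exact ⟨hf, rfl⟩
  | succ n ih =>
    have hd : Differentiable ℝ ((fwdDiff s) f) := by
      unfold fwdDiff
      fun_prop
    have he : deriv ((fwdDiff s) f) = (fwdDiff s) (deriv f) := by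
      funext x
      have h1 : HasDerivAt (fun x => f (x + s)) (deriv f (x + s)) x :=
        HasDerivAt.comp_add_const x s (hf _).hasDerivAt
      exact (h1.sub (hf x).hasDerivAt).deriv
    simp only [Function.iterate_succ, Function.comp]
    rw [← he]
    exact ih hd

/-- The mean value theorem is applied once per order, since differencing commutes with
differentiation. The derivative of order `n` has only to exist; its continuity is not needed, which
suits the derivatives of `g`. -/
theorem exists_fwdDiff_iter_eq {n : ℕ} {f : ℝ → ℝ}
    (hf : ∀ i < n, Differentiable ℝ (iteratedDeriv i f)) {s : ℝ} (hs : 0 < s) (y : ℝ) :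
    ∃ ξ ∈ Icc y (y + n * s), (fwdDiff s)^[n] f y = s ^ n * iteratedDeriv n f ξ := by
  induction n generalizing f y with
  | zero => exact ⟨y, by simp, by simp⟩
  | succ n ih =>
    have h0 : Differentiable ℝ f := by simpa using hf 0 (by simp)
    obtain ⟨hd, he⟩ := deriv_fwdDiff_iter h0 s n
    obtain ⟨x, hx, hx'⟩ := exists_deriv_eq_slope ((fwdDiff s)^[n] f) (show y < y + s by linarith)
      hd.continuous.continuousOn hd.differentiableOn
    obtain ⟨ξ, hξ, h⟩ := ih (f := deriv f)
      (fun i hi => by simpa [← iteratedDeriv_succ'] using hf (i + 1) (by omega)) x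
    refine ⟨ξ, ⟨by linarith [hξ.1, hx.1], ?_⟩, ?_⟩
    · push_cast
      linarith [hξ.2, hx.2]
    · rw [Function.iterate_succ_apply', fwdDiff, iteratedDeriv_succ', pow_succ', mul_assoc, ← h,
        ← he, hx', add_sub_cancel_left]
      field_simp

/-- Serves the top order of `h`, where only a Lipschitz bound on the derivative one order lower is
available: the last difference uses that bound instead of a derivative. -/
theorem abs_fwdDiff_iter_le_of_lipschitz {n : ℕ} {f : ℝ → ℝ}
    (hf : ∀ i < n, Differentiable ℝ (iteratedDeriv i f)) {C : ℝ}
    (hC : ∀ x y, |iteratedDeriv n f x - iteratedDeriv n f y| ≤ C * |x - y|)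
    {s : ℝ} (hs : 0 < s) (y : ℝ) : |(fwdDiff s)^[n + 1] f y| ≤ s ^ (n + 1) * C := by
  induction n generalizing f y with
  | zero =>
    have := hC (y + s) y
    simp only [add_sub_cancel_left, abs_of_pos hs, iteratedDeriv_zero] at this
    simpa [fwdDiff, mul_comm] using this
  | succ n ih =>
    have h0 : Differentiable ℝ f := by simpa using hf 0 (by simp)
    obtain ⟨hd, he⟩ := deriv_fwdDiff_iter h0 s (n + 1)
    obtain ⟨x, hx, hx'⟩ := exists_deriv_eq_slope ((fwdDiff s)^[n + 1] f) (show y < y + s by linarith)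
      hd.continuous.continuousOn hd.differentiableOn
    have h := ih (f := deriv f)
      (fun i hi => by simpa [← iteratedDeriv_succ'] using hf (i + 1) (by omega))
      (fun a b => by simpa [← iteratedDeriv_succ'] using hC a b) x
    rw [Function.iterate_succ_apply', fwdDiff, pow_succ', mul_assoc]
    rw [← he, hx', abs_div, add_sub_cancel_left, abs_of_pos hs, div_le_iff₀ hs] at h
    linarith

theorem fwdDiff_iter_line {E : Type*} [AddCommGroup E] [Module ℝ E] (f : E → ℝ) (x e : E)
    (s : ℝ) (n : ℕ) : (fwdDiff s)^[n] (fun t : ℝ => f (x + t • e)) 0 = (fwdDiff (s • e))^[n] f x := by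
  simp only [fwdDiff_iter_eq_sum_shift]
  refine Finset.sum_congr rfl fun k _ => ?_
  congr 2
  simp [mul_smul, Nat.cast_smul_eq_nsmul]

/-- A bound on finite differences of a smooth function passes to the derivative. -/
theorem abs_iteratedDeriv_le_of_fwdDiff {n : ℕ} {f : ℝ → ℝ} (hf : ContDiff ℝ ∞ f) {R s₀ : ℝ}
    (hs₀ : 0 < s₀) (y : ℝ) (h : ∀ s, 0 < s → s < s₀ → |(fwdDiff s)^[n] f y| ≤ s ^ n * R) :
    |iteratedDeriv n f y| ≤ R := by
  have hd : ∀ i, Differentiable ℝ (iteratedDeriv i f) := fun i =>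
    hf.differentiable_iteratedDeriv i (by exact_mod_cast WithTop.coe_lt_coe.2 (ENat.natCast_lt_top i))
  refine le_of_forall_pos_lt_add fun ε hε => ?_
  obtain ⟨δ, hδ, hδ'⟩ := Metric.continuous_iff.1 (hd n).continuous y ε hε
  -- With this step the whole interval `[y, y + n s]`, hence the mean value point, lies within `δ`
  -- of `y`.
  set s := min (s₀ / 2) (δ / (n + 1) / 2) with hs
  have hspos : 0 < s := by positivity
  obtain ⟨ξ, hξ, he⟩ := exists_fwdDiff_iter_eq (fun i _ => hd i) hspos y
  have h1 := h s hspos (by have := min_le_left (s₀ / 2) (δ / (n + 1) / 2); linarith)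
  rw [he, abs_mul, abs_of_pos (by positivity)] at h1
  have h2 : |iteratedDeriv n f ξ| ≤ R := le_of_mul_le_mul_left h1 (by positivity)
  have h3 : n * s < δ := by
    have : s ≤ δ / (n + 1) / 2 := min_le_right _ _
    calc n * s ≤ (n + 1) * (δ / (n + 1) / 2) := by gcongr; linarith
      _ = δ / 2 := by field_simp
      _ < δ := by linarith
  have h4 := hδ' ξ (by
    rw [Real.dist_eq, abs_of_nonneg (by linarith [hξ.1])]
    linarith [hξ.2])
  rw [Real.dist_eq, abs_sub_comm] at h4
  have := abs_sub_abs_le_abs_sub (iteratedDeriv n f y) (iteratedDeriv n f ξ)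
  linarith

/-! ### The chain rule for higher derivatives -/

/-- Remove from a partition the block of a distinguished element and let `l` be the number of
elements left. The binomial weights are those of the Leibniz rule, which is how the recurrence
enters the chain rule below. -/
theorem stirlingSecond_succ_succ_eq_sum (n k : ℕ) :
    Nat.stirlingSecond (n + 1) (k + 1) =
      ∑ l ∈ Finset.range (n + 1), n.choose l * Nat.stirlingSecond l k := by
  induction n generalizing k with
  | zero => 
    cases k <;> simp [Nat.stirlingSecond]
  | succ n ih =>
    rw [Nat.stirlingSecond_succ_succ, ih k, Finset.sum_range_succ' _ (n + 1)]
    simp only [Nat.choose_succ_succ, add_mul, Finset.sum_add_distrib]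
    have h1 : ∑ l ∈ Finset.range (n + 1), n.choose (l + 1) * Nat.stirlingSecond (l + 1) k +
        (n + 1).choose 0 * Nat.stirlingSecond 0 k =
        ∑ l ∈ Finset.range (n + 1), n.choose l * Nat.stirlingSecond l k := by
      rw [Finset.sum_range_succ, Finset.sum_range_succ' (fun l => n.choose l * _)]
      simp
    have h2 : ∑ l ∈ Finset.range (n + 1), n.choose l * Nat.stirlingSecond (l + 1) k =
        k * (∑ l ∈ Finset.range (n + 1), n.choose l * Nat.stirlingSecond l k) +
          Nat.stirlingSecond (n + 1) k := by
      cases k with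
      | zero => simp [Nat.stirlingSecond]
      | succ k =>
        rw [ih k, Finset.mul_sum, ← Finset.sum_add_distrib]
        refine Finset.sum_congr rfl fun l _ => ?_
        rw [Nat.stirlingSecond_succ_succ]
        ring
    simp only [Nat.succ_eq_add_one]
    linarith

/-- A bound for the derivatives of a composition, as in the formula of Faà di Bruno. -/
theorem abs_iteratedDeriv_comp_le {h f : ℝ → ℝ} (hh : ContDiff ℝ ∞ h) (hf : ContDiff ℝ ∞ f)
    {H : ℕ → ℝ} {c t : ℝ} (n : ℕ) (hH : ∀ k, k ≤ n → |iteratedDeriv k h (f t)| ≤ H k)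
    (hc : ∀ k, 1 ≤ k → k ≤ n → |iteratedDeriv k f t| ≤ c ^ k) :
    |iteratedDeriv n (h ∘ f) t| ≤
      (∑ k ∈ Finset.range (n + 1), (Nat.stirlingSecond n k : ℝ) * H k) * c ^ n := by
  induction n using Nat.strong_induction_on generalizing h H with
  | _ n ih =>
    cases n with
    | zero => simpa using hH 0 le_rfl
    | succ n =>
      have hdh : ContDiff ℝ ∞ (deriv h) := (contDiff_infty_iff_deriv.1 hh).2
      have hdf : ContDiff ℝ ∞ (deriv f) := (contDiff_infty_iff_deriv.1 hf).2
      have hder : deriv (h ∘ f) = (deriv h ∘ f) * deriv f := by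
        funext x
        exact deriv_comp x (hh.differentiable (by simp) _) (hf.differentiable (by simp) _)
      rw [iteratedDeriv_succ', hder, iteratedDeriv_mul
        ((hdh.comp hf).contDiffAt.of_le (by exact_mod_cast le_top))
        (hdf.contDiffAt.of_le (by exact_mod_cast le_top))]
      calc |∑ i ∈ Finset.range (n + 1), (n.choose i : ℝ) * iteratedDeriv i (deriv h ∘ f) t *
              iteratedDeriv (n - i) (deriv f) t|
          ≤ ∑ i ∈ Finset.range (n + 1), (n.choose i : ℝ) *
              ((∑ k ∈ Finset.range (n + 1), (Nat.stirlingSecond i k : ℝ) * H (k + 1)) * c ^ i) *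
              c ^ (n - i + 1) := by
            refine (Finset.abs_sum_le_sum_abs _ _).trans (Finset.sum_le_sum fun i hi => ?_)
            have hi' : i ≤ n := by simpa [Nat.lt_succ_iff] using hi
            rw [abs_mul, abs_mul, Nat.abs_cast]
            -- The outer function is now `deriv h`, so its bounds are those of `h` shifted by one.
            have h1 := ih i (by omega) hdh (H := fun k => H (k + 1))
              (fun k hk => by
                simpa [← iteratedDeriv_succ'] using hH (k + 1) (by omega))
              (fun k hk hk' => hc k hk (by omega))
            have h2 := hc (n - i + 1) (by omega) (by omega)
            rw [iteratedDeriv_succ'] at h2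
            -- Stirling numbers vanish above the diagonal; the padded range no longer depends on
            -- `i`, so the two sums can be exchanged later.
            have h3 : ∑ k ∈ Finset.range (i + 1), (Nat.stirlingSecond i k : ℝ) * H (k + 1) =
                ∑ k ∈ Finset.range (n + 1), (Nat.stirlingSecond i k : ℝ) * H (k + 1) := by
              refine Finset.sum_subset (fun k hk => ?_) (fun k _ hk => ?_)
              · simp at hk ⊢; omega
              · rw [Nat.stirlingSecond_eq_zero_of_lt (by simp at hk; omega)]
                simp
            rw [h3] at h1
            exact mul_le_mul (mul_le_mul_of_nonneg_left h1 (Nat.cast_nonneg _)) h2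
              (abs_nonneg _) (mul_nonneg (Nat.cast_nonneg _) ((abs_nonneg _).trans h1))
        _ = (∑ k ∈ Finset.range (n + 1 + 1), (Nat.stirlingSecond (n + 1) k : ℝ) * H k) *
              c ^ (n + 1) := by
            rw [Finset.sum_range_succ' _ (n + 1)]
            simp only [stirlingSecond_succ_succ_eq_sum]
            simp only [Nat.stirlingSecond, Nat.cast_zero, zero_mul, add_zero, Nat.cast_sum,
              Nat.cast_mul, Finset.sum_mul, Finset.mul_sum]
            rw [Finset.sum_comm]
            refine Finset.sum_congr rfl fun k _ => Finset.sum_congr rfl fun i hi => ?_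
            have hi' : i ≤ n := by simpa [Nat.lt_succ_iff] using hi
            have : c ^ (n + 1) = c ^ i * c ^ (n - i + 1) := by
              rw [← pow_add]; congr 1; omega
            rw [this]
            ring

theorem abs_iteratedDeriv_comp_le_of_pos {h f : ℝ → ℝ} (hh : ContDiff ℝ ∞ h)
    (hf : ContDiff ℝ ∞ f) {H : ℕ → ℝ} {c t : ℝ} {n : ℕ} (hn : 1 ≤ n)
    (hH : ∀ k, 1 ≤ k → k ≤ n → |iteratedDeriv k h (f t)| ≤ H k)
    (hc : ∀ k, 1 ≤ k → k ≤ n → |iteratedDeriv k f t| ≤ c ^ k) :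
    |iteratedDeriv n (h ∘ f) t| ≤
      (∑ k ∈ Finset.Icc 1 n, (Nat.stirlingSecond n k : ℝ) * H k) * c ^ n := by
  -- `h` itself may be unbounded; its value is used as the bound of order 0, and it disappears
  -- because `S(n, 0) = 0` for `n ≥ 1`.
  refine (abs_iteratedDeriv_comp_le hh hf (H := Function.update H 0 |h (f t)|) n
    (fun k hk => ?_) hc).trans_eq ?_
  · rcases Nat.eq_zero_or_pos k with rfl | hk0
    · simp
    · rw [Function.update_of_ne hk0.ne']
      exact hH k hk0 hk
  · congr 1
    symm
    refine Finset.sum_subset_zero_on_sdiff (fun k hk => ?_) (fun k hk => ?_) (fun k hk => ?_)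
    · simp at hk ⊢; omega
    · have : k = 0 := by simp at hk; omega
      obtain ⟨n, rfl⟩ : ∃ n', n = n' + 1 := ⟨n - 1, by omega⟩
      subst this
      simp [Nat.stirlingSecond]
    · rw [Function.update_of_ne (by simp at hk; omega)]

end

section

open scoped Topology ContDiff
open Filter Set

/-! ### Mollification -/

section Mollifier

set_option linter.unusedSectionVars false

variable {E : Type*} [NormedAddCommGroup E] [NormedSpace ℝ E] [FiniteDimensional ℝ E]
  [MeasurableSpace E] [BorelSpace E]

/-- A smooth probability density supported in the ball of radius `ε`. -/
structure IsMollifier (μ : Measure E) (ε : ℝ) (κ : E → ℝ) : Prop where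
  contDiff : ContDiff ℝ ∞ κ
  compact : HasCompactSupport κ
  nonneg : ∀ x, 0 ≤ κ x
  integral : ∫ x, κ x ∂μ = 1
  support : Function.support κ ⊆ Metric.ball 0 ε

theorem exists_isMollifier (μ : Measure E) [μ.IsAddHaarMeasure] {ε : ℝ} (hε : 0 < ε) :
    ∃ κ, IsMollifier μ ε κ := by
  let b : ContDiffBump (0 : E) := ⟨ε / 2, ε, by positivity, by linarith⟩
  exact ⟨b.normed μ, b.contDiff_normed, b.hasCompactSupport_normed, b.nonneg_normed,
    b.integral_normed, b.support_normed_eq.subset⟩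

/-- The convolution of two real functions. -/
noncomputable def smear (μ : Measure E) (κ f : E → ℝ) : E → ℝ :=
  convolution κ f (ContinuousLinearMap.lsmul ℝ ℝ) μ

theorem smear_apply (μ : Measure E) (κ f : E → ℝ) (x : E) :
    smear μ κ f x = ∫ t, κ t * f (x - t) ∂μ := rfl

variable {μ : Measure E} [μ.IsAddHaarMeasure]

theorem integrable_smear {κ f : E → ℝ} (hκ : Continuous κ) (hκ' : HasCompactSupport κ)
    (hf : Continuous f) (x : E) : Integrable (fun t => κ t * f (x - t)) μ :=
  (hκ.mul (hf.comp (continuous_const.sub continuous_id))).integrable_of_hasCompactSupport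
    hκ'.mul_right

theorem contDiff_smear {κ f : E → ℝ} (hκ : ContDiff ℝ ∞ κ) (hκ' : HasCompactSupport κ)
    (hf : Continuous f) : ContDiff ℝ ∞ (smear μ κ f) :=
  hκ'.contDiff_convolution_left _ hκ hf.locallyIntegrable

theorem fderiv_smear {κ f : E → ℝ} (hκ : ContDiff ℝ ∞ κ) (hκ' : HasCompactSupport κ)
    (hf : Continuous f) (x e : E) :
    fderiv ℝ (smear μ κ f) x e = smear μ (fun y => fderiv ℝ κ y e) f x := by
  have h := (hκ'.hasFDerivAt_convolution_left (ContinuousLinearMap.lsmul ℝ ℝ)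
    (hκ.of_le (by exact_mod_cast le_top)) (hf.locallyIntegrable (μ := μ)) x)
  rw [smear, h.fderiv, convolution_def, smear_apply, ContinuousLinearMap.integral_apply]
  · rfl
  · exact (hκ'.fderiv ℝ).convolutionExists_left_of_continuous_right _
      ((hκ.continuous_fderiv (by simp)).locallyIntegrable) hf x

namespace IsMollifier

variable {ε : ℝ} {κ : E → ℝ}

theorem abs_smear_sub_le (hκ : IsMollifier μ ε κ) {f : E → ℝ} (hf : Continuous f) {x : E}
    {z δ : ℝ} (hδ : 0 ≤ δ) (h : ∀ y ∈ Metric.ball x ε, |f y - z| ≤ δ) :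
    |smear μ κ f x - z| ≤ δ :=
  dist_convolution_le hδ hκ.support hκ.nonneg hκ.integral hf.aestronglyMeasurable h

theorem smear_contDiff (hκ : IsMollifier μ ε κ) {f : E → ℝ} (hf : Continuous f) :
    ContDiff ℝ ∞ (smear μ κ f) :=
  contDiff_smear hκ.contDiff hκ.compact hf

theorem continuous_fwdDiff_iter {f : E → ℝ} (hf : Continuous f) (s : E) (n : ℕ) :
    Continuous ((fwdDiff s)^[n] f) := by
  induction n generalizing f with
  | zero => exact hf
  | succ n ih => exact ih (f := fwdDiff s f) (by unfold fwdDiff; fun_prop)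

/-- Convolution commutes with translations. Hence an average of functions with small differences has
small differences, with no loss in the constant. -/
theorem fwdDiff_iter_smear (hκ : IsMollifier μ ε κ) {f : E → ℝ} (hf : Continuous f) (s : E)
    (n : ℕ) : (fwdDiff s)^[n] (smear μ κ f) = smear μ κ ((fwdDiff s)^[n] f) := by
  induction n generalizing f with
  | zero => rfl
  | succ n ih =>
    have h1 : fwdDiff s (smear μ κ f) = smear μ κ (fwdDiff s f) := by
      funext x
      simp only [fwdDiff, smear_apply]
      rw [← integral_sub (integrable_smear hκ.contDiff.continuous hκ.compact hf _)
        (integrable_smear hκ.contDiff.continuous hκ.compact hf _)]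
      refine integral_congr_ae (Eventually.of_forall fun t => ?_)
      simp only [← mul_sub, add_sub_right_comm]
    simp only [Function.iterate_succ, Function.comp]
    rw [h1, ih (f := fwdDiff s f) (by unfold fwdDiff; fun_prop)]

/-- Bounds on finite differences become bounds on the derivatives of the mollified function. -/
theorem abs_iteratedDeriv_smear_le (hκ : IsMollifier μ ε κ) {f : E → ℝ} (hf : Continuous f)
    (x e : E) (n : ℕ) {R s₀ : ℝ} (hR : 0 ≤ R) (hs₀ : 0 < s₀)
    (h : ∀ y ∈ Metric.ball x ε, ∀ s, 0 < s → s < s₀ →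
      |(fwdDiff (s • e))^[n] f y| ≤ s ^ n * R) :
    |iteratedDeriv n (fun t : ℝ => smear μ κ f (x + t • e)) 0| ≤ R := by
  refine abs_iteratedDeriv_le_of_fwdDiff ?_ hs₀ 0 fun s hs hs' => ?_
  · exact (hκ.smear_contDiff hf).comp (by fun_prop)
  · rw [fwdDiff_iter_line, hκ.fwdDiff_iter_smear hf]
    have := hκ.abs_smear_sub_le (continuous_fwdDiff_iter hf (s • e) n) (x := x) (z := 0)
      (δ := s ^ n * R) (by positivity) (fun y hy => by simpa using h y hy s hs hs')
    simpa using this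

end IsMollifier

end Mollifier

/-! ### Finite differences of compositions -/

/-- If the derivatives of `h` are bounded by `H k` and those of `f` by `c ^ k` on an interval, in
the weak sense of finite differences, then those of `h ∘ f` are bounded as in the formula of
Faà di Bruno. -/
theorem abs_fwdDiff_comp_le {h f : ℝ → ℝ} (hh : Continuous h) (hf : Continuous f) {n : ℕ}
    (hn : 1 ≤ n) {H : ℕ → ℝ} (hH0 : ∀ k, 0 ≤ H k) {c s η : ℝ} (hc0 : 0 ≤ c) (hs : 0 < s)
    (hη : 0 < η)
    (hH : ∀ k, 1 ≤ k → k ≤ n → ∀ x, ∀ τ, 0 < τ → |(fwdDiff τ)^[k] h x| ≤ τ ^ k * H k)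
    (hc : ∀ k, 1 ≤ k → k ≤ n → ∀ x ∈ Icc (-η) (n * s + η), ∀ τ, 0 < τ → τ < η →
      |(fwdDiff τ)^[k] f x| ≤ τ ^ k * c ^ k) :
    |(fwdDiff s)^[n] (h ∘ f) 0| ≤
      s ^ n * ((∑ k ∈ Finset.Icc 1 n, (Nat.stirlingSecond n k : ℝ) * H k) * c ^ n) := by
  have hLip : ∀ x y, |h x - h y| ≤ H 1 * |x - y| := by
    have key : ∀ x y, x < y → |h y - h x| ≤ H 1 * |y - x| := fun x y hxy => by
      have := hH 1 le_rfl hn x (y - x) (by linarith)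
      simpa [fwdDiff, abs_of_pos (sub_pos.2 hxy), mul_comm] using this
    intro x y
    rcases lt_trichotomy x y with hxy | rfl | hxy
    · rw [abs_sub_comm, abs_sub_comm x]; exact key x y hxy
    · simp
    · exact key y x hxy
  -- The radii tend to 0 and stay strictly below `η`, so averaging around points of `[0, n s]` only
  -- sees `f` on the interval where its differences are controlled.
  choose κ hκ using fun m : ℕ => exists_isMollifier (volume : Measure ℝ)
    (ε := η / ((m : ℝ) + 2)) (by positivity)
  have hε : Tendsto (fun m : ℕ => η / ((m : ℝ) + 2)) atTop (𝓝 0) :=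
    tendsto_const_nhds.div_atTop (tendsto_natCast_atTop_atTop.atTop_add tendsto_const_nhds)
  have hεη : ∀ m : ℕ, η / ((m : ℝ) + 2) < η := fun m =>
    div_lt_self hη (by have : (0 : ℝ) ≤ m := Nat.cast_nonneg m; linarith)
  have hbound : ∀ m, |(fwdDiff s)^[n] (smear volume (κ m) h ∘ smear volume (κ m) f) 0| ≤
      s ^ n * ((∑ k ∈ Finset.Icc 1 n, (Nat.stirlingSecond n k : ℝ) * H k) * c ^ n) := by
    intro m
    have hsh := (hκ m).smear_contDiff hh
    have hsf := (hκ m).smear_contDiff hf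
    have hcomp := hsh.comp hsf
    have line : ∀ (F : ℝ → ℝ) (k : ℕ) (x : ℝ),
        iteratedDeriv k (fun t : ℝ => F (x + t • (1 : ℝ))) 0 = iteratedDeriv k F x := by
      intro F k x
      have := iteratedDeriv_comp_const_add k F x
      simp only [smul_eq_mul, mul_one]
      rw [this]; simp
    obtain ⟨ξ, hξ, he⟩ := exists_fwdDiff_iter_eq (n := n)
      (f := smear volume (κ m) h ∘ smear volume (κ m) f)
      (fun i _ => hcomp.differentiable_iteratedDeriv i
        (by exact_mod_cast WithTop.coe_lt_coe.2 (ENat.natCast_lt_top i))) hs 0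
    rw [he, abs_mul, abs_of_pos (by positivity : 0 < s ^ n)]
    refine mul_le_mul_of_nonneg_left ?_ (by positivity)
    have hb1 : ∀ k, 1 ≤ k → k ≤ n → ∀ x, |iteratedDeriv k (smear volume (κ m) h) x| ≤ H k := by
      intro k hk hk' x
      rw [← line]
      exact (hκ m).abs_iteratedDeriv_smear_le hh x 1 k (hH0 k) one_pos
        (fun y _ τ hτ _ => by simpa using hH k hk hk' y τ hτ)
    have hb2 : ∀ k, 1 ≤ k → k ≤ n → |iteratedDeriv k (smear volume (κ m) f) ξ| ≤ c ^ k := by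
      intro k hk hk'
      rw [← line]
      refine (hκ m).abs_iteratedDeriv_smear_le hf ξ 1 k (by positivity) hη
        (fun y hy τ hτ hτ' => ?_)
      rw [Metric.mem_ball, Real.dist_eq, abs_lt] at hy
      have := hεη m
      simp only [zero_add] at hξ
      simpa using hc k hk hk' y ⟨by linarith [hξ.1, hy.1], by linarith [hξ.2, hy.2]⟩ τ hτ hτ'
    exact abs_iteratedDeriv_comp_le_of_pos hsh hsf hn (fun k hk hk' => hb1 k hk hk' _) hb2
  -- A finite difference is a finite combination of values, so pointwise convergence is enough. The
  -- Lipschitz bound makes the mollified `h` uniformly close to `h`, which decouples the two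
  -- mollifications.
  have hlim : Tendsto (fun m => (fwdDiff s)^[n] (smear volume (κ m) h ∘ smear volume (κ m) f) 0)
      atTop (𝓝 ((fwdDiff s)^[n] (h ∘ f) 0)) := by
    simp only [fwdDiff_iter_eq_sum_shift]
    refine tendsto_finsetSum _ fun k _ => Tendsto.const_smul ?_ _
    set y : ℝ := 0 + k • s
    have hf' : Tendsto (fun m => |smear volume (κ m) f y - f y|) atTop (𝓝 0) := by
      refine Metric.tendsto_nhds.2 fun δ hδ => ?_
      obtain ⟨ε, hε0, hε'⟩ := Metric.continuous_iff.1 hf y (δ / 2) (by positivity)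
      filter_upwards [hε.eventually (gt_mem_nhds hε0)] with m hm
      have := (hκ m).abs_smear_sub_le hf (x := y) (z := f y) (δ := δ / 2) (by positivity)
        (fun z hz => (hε' z (hz.trans hm)).le)
      simp only [Real.dist_eq, sub_zero, abs_abs]
      linarith
    have hb : ∀ m, |(smear volume (κ m) h ∘ smear volume (κ m) f) y - (h ∘ f) y| ≤
        H 1 * (η / ((m : ℝ) + 2)) + H 1 * |smear volume (κ m) f y - f y| := by
      intro m
      have h1 := (hκ m).abs_smear_sub_le hh (x := smear volume (κ m) f y)
        (z := h (smear volume (κ m) f y)) (δ := H 1 * (η / ((m : ℝ) + 2)))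
        (mul_nonneg (hH0 1) (by positivity)) (fun z hz => (hLip _ _).trans
          (mul_le_mul_of_nonneg_left (le_of_lt hz) (hH0 1)))
      exact (abs_sub_le _ (h (smear volume (κ m) f y)) _).trans (add_le_add h1 (hLip _ _))
    refine tendsto_iff_norm_sub_tendsto_zero.2 (squeeze_zero (fun _ => norm_nonneg _) hb ?_)
    simpa using (hε.const_mul (H 1)).add (hf'.const_mul (H 1))
  exact le_of_tendsto hlim.abs (Eventually.of_forall hbound)

end

section

open scoped Topology ContDiff
open Filter Set

/-! ### The classes of test functions -/

namespace MemCb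

variable {p : ℕ} {h : ℝ → ℝ}

theorem le_iSup (hh : MemCb p h) {k : ℕ} (hk : 1 ≤ k) (hk' : k ≤ p) (x : ℝ) :
    |iteratedDeriv k h x| ≤ ⨆ x : ℝ, |iteratedDeriv k h x| := by
  obtain ⟨M, hM⟩ := hh.bounded k hk hk'
  exact le_ciSup (f := fun x => |iteratedDeriv k h x|) ⟨M, by rintro _ ⟨y, rfl⟩; exact hM y⟩ x

/-- Below the top order this is the mean value theorem. At order `p` the derivative exists only
almost everywhere, but absolute continuity makes `h^{(p-1)}` the integral of it, hence Lipschitz. -/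
theorem abs_fwdDiff_le (hh : MemCb p h) {k : ℕ} (hk : 1 ≤ k) (hk' : k ≤ p) (x : ℝ) {τ : ℝ}
    (hτ : 0 < τ) :
    |(fwdDiff τ)^[k] h x| ≤ τ ^ k * ⨆ x : ℝ, |iteratedDeriv k h x| := by
  rcases hk'.lt_or_eq with hlt | rfl
  · obtain ⟨ξ, -, he⟩ := exists_fwdDiff_iter_eq (n := k) (f := h)
      (fun i hi => hh.differentiable i (by omega)) hτ x
    rw [he, abs_mul, abs_of_pos (by positivity : 0 < τ ^ k)]
    exact mul_le_mul_of_nonneg_left (hh.le_iSup hk hk' ξ) (by positivity)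
  · obtain ⟨n, rfl⟩ : ∃ n', k = n' + 1 := ⟨k - 1, by omega⟩
    refine abs_fwdDiff_iter_le_of_lipschitz (fun i hi => hh.differentiable i (by omega))
      (fun a b => ?_) hτ x
    have hac := hh.absolutelyContinuous b a
    rw [Nat.add_sub_cancel] at hac
    rw [← hac.integral_deriv_eq_sub, ← iteratedDeriv_succ]
    exact intervalIntegral.norm_integral_le_of_norm_le_const (f := iteratedDeriv (n + 1) h)
      (C := ⨆ x : ℝ, |iteratedDeriv (n + 1) h x|) (fun x _ => hh.le_iSup hk hk' x)

theorem lipschitz (hh : MemCb p h) (hp : 1 ≤ p) (x y : ℝ) :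
    |h x - h y| ≤ (⨆ x : ℝ, |iteratedDeriv 1 h x|) * |x - y| := by
  have key : ∀ x y, x < y →
      |h y - h x| ≤ (⨆ x : ℝ, |iteratedDeriv 1 h x|) * |y - x| := fun x y hxy => by
    have := hh.abs_fwdDiff_le le_rfl hp x (τ := y - x) (by linarith)
    simpa [fwdDiff, abs_of_pos (sub_pos.2 hxy), mul_comm] using this
  rcases lt_trichotomy x y with hxy | rfl | hxy
  · rw [abs_sub_comm, abs_sub_comm x]; exact key x y hxy
  · simp
  · exact key y x hxy

theorem iSup_nonneg (k : ℕ) : 0 ≤ ⨆ x : ℝ, |iteratedDeriv k h x| :=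
  Real.iSup_nonneg fun _ => abs_nonneg _

theorem hConst_nonneg (p : ℕ) (h : ℝ → ℝ) : 0 ≤ hConst p h :=
  Finset.sum_nonneg fun k _ => mul_nonneg (Nat.cast_nonneg _) (iSup_nonneg k)

theorem continuous (hh : MemCb p h) (hp : 1 ≤ p) : Continuous h := by
  refine (LipschitzWith.of_dist_le_mul (K := ⟨_, iSup_nonneg (h := h) 1⟩) fun x y => ?_).continuous
  exact hh.lipschitz hp x y

end MemCb

variable {d : ℕ}

/-- Only pure partial derivatives, repeated along one axis, enter the proof; this reduces them to
derivatives of functions of one variable. -/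
theorem iteratedDeriv_line_eq_iterPartial (g : (Fin d → ℝ) → ℝ) (x : Fin d → ℝ) (j : Fin d)
    (k : ℕ) : iteratedDeriv k (fun t : ℝ => g (x + t • Pi.single j 1)) =
      fun t => iterPartial g (List.replicate k j) (x + t • Pi.single j 1) := by
  induction k with
  | zero => simp [iterPartial]
  | succ k ih =>
    funext t
    rw [iteratedDeriv_succ, ih, List.replicate_succ]
    simp only [iterPartial, lineDeriv]
    have := deriv_comp_const_add
      (fun t : ℝ => iterPartial g (List.replicate k j) (x + t • Pi.single j 1)) t 0
    simp only [add_zero] at this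
    rw [← this]
    simp only [add_smul, add_assoc]

/-- A function on `ℝ^d` with polynomially growing local Lipschitz constants. -/
def LipGrowth (K R : ℝ) (φ : (Fin d → ℝ) → ℝ) : Prop :=
  ∀ w v, |φ (w + v) - φ w| ≤ K * (1 + ‖w‖ + ‖v‖) ^ R * ‖v‖

namespace LipGrowth

variable {K R : ℝ} {φ : (Fin d → ℝ) → ℝ}

theorem continuous (hφ : LipGrowth K R φ) : Continuous φ := by
  refine continuous_iff_continuousAt.2 fun w => ?_
  have h1 : Tendsto (fun w' => K * (1 + ‖w‖ + ‖w' - w‖) ^ R * ‖w' - w‖) (𝓝 w) (𝓝 0) := by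
    have : ContinuousAt (fun w' => K * (1 + ‖w‖ + ‖w' - w‖) ^ R * ‖w' - w‖) w := by
      refine (continuousAt_const.mul (ContinuousAt.rpow_const (by fun_prop) (Or.inl ?_))).mul
        (by fun_prop)
      positivity
    simpa [ContinuousAt] using this
  refine tendsto_iff_norm_sub_tendsto_zero.2
    (squeeze_zero (fun _ => norm_nonneg _) (fun w' => ?_) h1)
  simpa using hφ w (w' - w)

theorem abs_le (hφ : LipGrowth K R φ) (hK : 0 ≤ K) (hR : 0 ≤ R) (w : Fin d → ℝ) :
    |φ w| ≤ (|φ 0| + K) * (1 + ‖w‖) ^ (R + 1) := by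
  have h := hφ 0 w
  simp only [zero_add, norm_zero, add_zero] at h
  have h1 : (1 : ℝ) ≤ (1 + ‖w‖) ^ (R + 1) :=
    Real.one_le_rpow (by linarith [norm_nonneg w]) (by linarith)
  have h2 : K * (1 + ‖w‖) ^ R * ‖w‖ ≤ K * (1 + ‖w‖) ^ (R + 1) := by
    rw [Real.rpow_add (by positivity), Real.rpow_one, ← mul_assoc]
    gcongr
    linarith
  have h3 : |φ 0| ≤ |φ 0| * (1 + ‖w‖) ^ (R + 1) := le_mul_of_one_le_right (abs_nonneg _) h1
  have := abs_sub_abs_le_abs_sub (φ w) (φ 0)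
  linarith

theorem comp (hφ : LipGrowth K R φ) {h : ℝ → ℝ} {H : ℝ} (hH : 0 ≤ H)
    (hh : ∀ x y, |h x - h y| ≤ H * |x - y|) : LipGrowth (H * K) R (fun w => h (φ w)) := by
  intro w v
  refine (hh _ _).trans ((mul_le_mul_of_nonneg_left (hφ w v) hH).trans_eq ?_)
  ring

end LipGrowth

theorem polyDom_le {A B : ℝ} (hA : 0 ≤ A) (hB : 0 ≤ B) {r : Fin d → ℝ} (hr : ∀ l, 0 ≤ r l) {R : ℝ}
    (hR : ∀ l, r l ≤ R) (hR0 : 0 ≤ R) (w : Fin d → ℝ) :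
    polyDom A B r w ≤ (A + B * d) * (1 + ‖w‖) ^ R := by
  have h1 : (1 : ℝ) ≤ (1 + ‖w‖) ^ R := Real.one_le_rpow (by linarith [norm_nonneg w]) hR0
  have h2 : ∑ i, |w i| ^ r i ≤ ∑ _i : Fin d, (1 + ‖w‖) ^ R := by
    refine Finset.sum_le_sum fun i _ => ?_
    have h3 : |w i| ≤ 1 + ‖w‖ := (norm_le_pi_norm w i).trans (by linarith)
    calc |w i| ^ r i ≤ (1 + ‖w‖) ^ r i := Real.rpow_le_rpow (abs_nonneg _) h3 (hr i)
      _ ≤ (1 + ‖w‖) ^ R :=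
        Real.rpow_le_rpow_of_exponent_le (by linarith [norm_nonneg w]) (hR i)
  rw [Finset.sum_const, Finset.card_fin, nsmul_eq_mul] at h2
  unfold polyDom
  nlinarith [mul_le_mul_of_nonneg_left h2 hB, mul_le_mul_of_nonneg_left h1 hA]

theorem abs_apply_add_smul_sub_le {g : (Fin d → ℝ) → ℝ} {x e : Fin d → ℝ} {L t : ℝ}
    (hd : Differentiable ℝ (fun s : ℝ => g (x + s • e)))
    (hL : ∀ s, |s| ≤ |t| → |deriv (fun s : ℝ => g (x + s • e)) s| ≤ L) :
    |g (x + t • e) - g x| ≤ L * |t| := by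
  have := (convex_uIcc (0 : ℝ) t).norm_image_sub_le_of_norm_deriv_le
    (f := fun s : ℝ => g (x + s • e)) (C := L) (fun s _ => hd s) (fun s hs => hL s (by
      rcases le_total 0 t with h | h
      · rw [uIcc_of_le h] at hs
        rw [abs_of_nonneg h, abs_of_nonneg hs.1]; exact hs.2
      · rw [uIcc_of_ge h] at hs
        rw [abs_of_nonpos h, abs_of_nonpos hs.2]; linarith [hs.1])) left_mem_uIcc right_mem_uIcc
  simpa using this

namespace MemCP

variable {p : ℕ} {P g : (Fin d → ℝ) → ℝ}

theorem differentiable_line (hg : MemCP p P g) (x : Fin d → ℝ) (j : Fin d) {k : ℕ} (hk : k < p) :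
    Differentiable ℝ (iteratedDeriv k (fun t : ℝ => g (x + t • Pi.single j 1))) := by
  rw [iteratedDeriv_line_eq_iterPartial]
  intro t
  have h := hg.exists_partial (List.replicate k j) (by simpa using hk) j (x + t • Pi.single j 1)
  rw [LineDifferentiableAt] at h
  have h2 : DifferentiableAt ℝ (fun s : ℝ => (fun s : ℝ => iterPartial g (List.replicate k j)
      (x + t • Pi.single j 1 + s • Pi.single j 1)) (s - t)) t :=
    DifferentiableAt.comp (g := fun s : ℝ => iterPartial g (List.replicate k j)
      (x + t • Pi.single j 1 + s • Pi.single j 1)) (f := fun s => s - t) t (by simpa using h)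
      (by fun_prop)
  refine h2.congr_of_eventuallyEq (Eventually.of_forall fun s => ?_)
  simp only [add_assoc, ← add_smul]
  congr 3
  ring

/-- The exponent `p / k` in the class is made for this: it puts the bound on the `k`-th derivative
in the form `c ^ k` with `c = R ^ (1 / p)`, as the chain rule estimate requires. -/
theorem abs_iteratedDeriv_line_le (hg : MemCP p P g) (x : Fin d → ℝ) (j : Fin d) {k : ℕ}
    (hk : 1 ≤ k) (hk' : k ≤ p) {R : ℝ} {t : ℝ} (hR : P (x + t • Pi.single j 1) ≤ R) :
    |iteratedDeriv k (fun t : ℝ => g (x + t • Pi.single j 1)) t| ≤ (R ^ (1 / (p : ℝ))) ^ k := by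
  have h := hg.dominated (List.replicate k j) (by simpa using hk) (by simpa using hk')
    (x + t • Pi.single j 1)
  rw [List.length_replicate] at h
  have hR0 : 0 ≤ R := (hg.dominating_nonneg _).trans hR
  have hk0 : (k : ℝ) ≠ 0 := by positivity
  have hp0 : (p : ℝ) ≠ 0 := by
    have : 0 < p := by omega
    positivity
  have h2 := Real.rpow_le_rpow (by positivity) (h.trans hR) (z := (k : ℝ) / p) (by positivity)
  rw [← Real.rpow_mul (abs_nonneg _), show (p : ℝ) / k * (k / p) = 1 by field_simp,
    Real.rpow_one] at h2
  rw [iteratedDeriv_line_eq_iterPartial]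
  refine h2.trans_eq ?_
  rw [← Real.rpow_natCast, ← Real.rpow_mul hR0]
  congr 1
  ring

/-- Existence of partial derivatives alone does not give continuity. Their growth bound does: change
the coordinates one at a time and apply the mean value inequality along each axis. -/
theorem lipGrowth (hp : 1 ≤ p) {A B : ℝ} (hA : 0 ≤ A) (hB : 0 ≤ B) {r : Fin d → ℝ}
    (hr : ∀ l, 0 ≤ r l) {R : ℝ} (hR : ∀ l, r l ≤ R) (hR0 : 0 ≤ R)
    (hg : MemCP p (polyDom A B r) g) : LipGrowth (d * (1 + A + B * d)) R g := by
  intro w v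
  set L := (1 + A + B * d) * (1 + ‖w‖ + ‖v‖) ^ R with hLdef
  -- The added 1 absorbs the root in the bound for first derivatives: `x ^ (1 / p) ≤ 1 + x`.
  have hpart : ∀ y : Fin d → ℝ, ‖y‖ ≤ ‖w‖ + ‖v‖ → 1 + polyDom A B r y ≤ L := by
    intro y hy
    have h1 := polyDom_le hA hB hr hR hR0 y
    have h2 : (1 + ‖y‖) ^ R ≤ (1 + ‖w‖ + ‖v‖) ^ R :=
      Real.rpow_le_rpow (by positivity) (by linarith) hR0
    have h3 : (1 : ℝ) ≤ (1 + ‖w‖ + ‖v‖) ^ R :=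
      Real.one_le_rpow (by linarith [norm_nonneg w, norm_nonneg v]) hR0
    have : (A + B * d) * (1 + ‖y‖) ^ R ≤ (A + B * d) * (1 + ‖w‖ + ‖v‖) ^ R := by gcongr
    rw [hLdef]
    linarith
  -- `S` is the set of coordinates already moved from `w` to `w + v`.
  have key : ∀ S : Finset (Fin d),
      |g (w + fun i => if i ∈ S then v i else 0) - g w| ≤ S.card * (L * ‖v‖) := by
    intro S
    induction S using Finset.induction_on with
    | empty =>
      have : (w + fun i : Fin d => if i ∈ (∅ : Finset (Fin d)) then v i else 0) = w := by
        ext i; simp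
      rw [this]
      simp
    | insert j S hj ih =>
      set y := w + fun i => if i ∈ S then v i else 0 with hy
      have hstep : (w + fun i => if i ∈ insert j S then v i else 0) =
          y + v j • Pi.single j 1 := by
        ext i
        by_cases hij : i = j
        · subst hij; simp [hy, hj]
        · simp [hy, hij]
      have hle : |g (y + v j • Pi.single j 1) - g y| ≤ L * |v j| := by
        refine abs_apply_add_smul_sub_le
          (by simpa using hg.differentiable_line y j (k := 0) (by omega)) fun s hs => ?_
        have hn : ‖y + s • (Pi.single j 1 : Fin d → ℝ)‖ ≤ ‖w‖ + ‖v‖ := by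
          rw [hy, add_assoc]
          refine (norm_add_le _ _).trans (add_le_add le_rfl ?_)
          refine (pi_norm_le_iff_of_nonneg (norm_nonneg _)).2 fun i => ?_
          by_cases hij : i = j
          · subst hij
            simp only [Pi.add_apply, hj, if_false, Pi.smul_apply, Pi.single_eq_same, smul_eq_mul,
              mul_one, zero_add]
            exact hs.trans (norm_le_pi_norm v i)
          · simp only [Pi.add_apply, Pi.smul_apply, Pi.single_eq_of_ne hij, smul_zero, add_zero]
            split_ifs
            · exact norm_le_pi_norm v i
            · simp
        have h1 := hg.abs_iteratedDeriv_line_le y j le_rfl hp (t := s) le_rfl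
        rw [iteratedDeriv_one, pow_one] at h1
        refine h1.trans (le_trans ?_ (hpart _ hn))
        have hP := hg.dominating_nonneg (y + s • (Pi.single j 1 : Fin d → ℝ))
        have hp1 : (1 : ℝ) ≤ p := by exact_mod_cast hp
        calc polyDom A B r (y + s • Pi.single j 1) ^ (1 / (p : ℝ))
            ≤ (1 + polyDom A B r (y + s • Pi.single j 1)) ^ (1 / (p : ℝ)) :=
              Real.rpow_le_rpow hP (by linarith) (by positivity)
          _ ≤ (1 + polyDom A B r (y + s • Pi.single j 1)) ^ (1 : ℝ) :=
              Real.rpow_le_rpow_of_exponent_le (by linarith)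
                (by rw [div_le_one (by linarith)]; exact hp1)
          _ = _ := Real.rpow_one _
      have hL0 : 0 ≤ L := by positivity
      have hvj : L * |v j| ≤ L * ‖v‖ := mul_le_mul_of_nonneg_left (norm_le_pi_norm v j) hL0
      rw [hstep, Finset.card_insert_of_notMem hj]
      push_cast
      have := abs_sub_le (g (y + v j • Pi.single j 1)) (g y) (g w)
      linarith
  have h := key Finset.univ
  simp only [Finset.mem_univ, if_true, Finset.card_univ, Fintype.card_fin] at h
  refine h.trans_eq ?_
  rw [hLdef]
  ring

/-- Finite differences of order `p` of `h ∘ g` along the axes. -/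
theorem abs_fwdDiff_comp_le (hp : 1 ≤ p) (hg : MemCP p P g) {h : ℝ → ℝ} (hh : MemCb p h)
    {x : Fin d → ℝ} {j : Fin d} {R s : ℝ} (hs : 0 < s)
    (hR : ∀ t, |t| ≤ (2 * p + 1) * s → P (x + t • Pi.single j 1) ≤ R) :
    |(fwdDiff (s • (Pi.single j 1 : Fin d → ℝ)))^[p] (fun w => h (g w)) x| ≤
      s ^ p * (hConst p h * R) := by
  have hR0 : 0 ≤ R := (hg.dominating_nonneg _).trans (hR 0 (by rw [abs_zero]; positivity))
  have hp0 : (p : ℝ) ≠ 0 := by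
    have : 0 < p := by omega
    positivity
  have hcont : Continuous (fun t : ℝ => g (x + t • Pi.single j 1)) := by
    have := (hg.differentiable_line x j (k := 0) (by omega)).continuous
    simpa using this
  -- With `η = s` the differences start in `[-s, (p + 1) s]`, and their mean value points lie at
  -- most `p s` further; this is the radius `(2 p + 1) s`. The choice of `c` gives `c ^ p = R`.
  have key := _root_.abs_fwdDiff_comp_le (hh.continuous hp) hcont hp
    (H := fun k => ⨆ x : ℝ, |iteratedDeriv k h x|) (fun k => MemCb.iSup_nonneg k)
    (c := R ^ (1 / (p : ℝ))) (s := s) (η := s) (by positivity) hs hs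
    (fun k hk hk' x τ hτ => hh.abs_fwdDiff_le hk hk' x hτ) (by
      intro k hk hk' t ht τ hτ hτ'
      obtain ⟨ξ, hξ, he⟩ := exists_fwdDiff_iter_eq (n := k)
        (f := fun t : ℝ => g (x + t • Pi.single j 1))
        (fun i hi => hg.differentiable_line x j (by omega)) hτ t
      rw [he, abs_mul, abs_of_pos (by positivity : 0 < τ ^ k)]
      refine mul_le_mul_of_nonneg_left (hg.abs_iteratedDeriv_line_le x j hk hk' (hR ξ ?_))
        (by positivity)
      have hkp : (k : ℝ) * τ ≤ p * s := by
        have : (k : ℝ) ≤ p := by exact_mod_cast hk'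
        gcongr
      have hps : 0 ≤ (p : ℝ) * s := by positivity
      rw [abs_le]
      constructor
      · nlinarith [hξ.1, ht.1]
      · nlinarith [hξ.2, ht.2])
  rw [← Real.rpow_natCast (R ^ (1 / (p : ℝ))) p, ← Real.rpow_mul hR0, one_div_mul_cancel hp0,
    Real.rpow_one] at key
  rw [← fwdDiff_iter_line]
  exact key

end MemCP

end

section

open scoped Topology ContDiff
open Filter Set

/-! ### Smooth functions of polynomial growth -/

variable {d : ℕ}

/-- The partial derivative in the direction of the `j`-th coordinate. -/
noncomputable def partialD (j : Fin d) (f : (Fin d → ℝ) → ℝ) (w : Fin d → ℝ) : ℝ :=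
  fderiv ℝ f w (Pi.single j 1)

theorem ContDiff.partialD {f : (Fin d → ℝ) → ℝ} (hf : ContDiff ℝ ∞ f) (j : Fin d) :
    ContDiff ℝ ∞ (partialD j f) :=
  (hf.fderiv_right (m := ∞) (by simp)).clm_apply contDiff_const

theorem ContDiff.partialD_iter {f : (Fin d → ℝ) → ℝ} (hf : ContDiff ℝ ∞ f) (j : Fin d) (k : ℕ) :
    ContDiff ℝ ∞ ((_root_.partialD j)^[k] f) := by
  induction k with
  | zero => exact hf
  | succ k ih =>
    rw [Function.iterate_succ_apply']
    exact ih.partialD j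

theorem hasDerivAt_line {f : (Fin d → ℝ) → ℝ} (hf : ContDiff ℝ ∞ f) (x : Fin d → ℝ) (j : Fin d)
    (c t : ℝ) : HasDerivAt (fun t : ℝ => f (x + (c * t) • Pi.single j 1))
      (c * partialD j f (x + (c * t) • Pi.single j 1)) t := by
  have h1 : HasDerivAt (fun t : ℝ => x + (c * t) • (Pi.single j 1 : Fin d → ℝ))
      (c • (Pi.single j 1 : Fin d → ℝ)) t := by
    have := (((hasDerivAt_id t).const_mul c).smul_const (Pi.single j 1 : Fin d → ℝ)).const_add x
    simpa using this
  have h2 := ((hf.differentiable (by simp)) (x + (c * t) • Pi.single j 1)).hasFDerivAt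
  have := h2.comp_hasDerivAt t h1
  rw [map_smul, smul_eq_mul] at this
  exact this

theorem iteratedDeriv_line {f : (Fin d → ℝ) → ℝ} (hf : ContDiff ℝ ∞ f) (x : Fin d → ℝ)
    (j : Fin d) (k : ℕ) : iteratedDeriv k (fun t : ℝ => f (x + t • Pi.single j 1)) =
      fun t => (partialD j)^[k] f (x + t • Pi.single j 1) := by
  induction k with
  | zero => simp
  | succ k ih =>
    funext t
    rw [iteratedDeriv_succ, ih, Function.iterate_succ_apply']
    have := hasDerivAt_line (hf.partialD_iter j k) x j 1 t
    simp only [one_mul] at this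
    exact this.deriv

/-- Smooth functions all of whose unmixed partial derivatives are `O((1 + ‖w‖) ^ Q)`. -/
structure SmoothGrowth (Q : ℝ) (φ : (Fin d → ℝ) → ℝ) : Prop where
  contDiff : ContDiff ℝ ∞ φ
  growth : ∀ j k, ∃ K, 0 ≤ K ∧ ∀ w, |(partialD j)^[k] φ w| ≤ K * (1 + ‖w‖) ^ Q

theorem partialD_iter_smear {κ f : (Fin d → ℝ) → ℝ} (hκ : ContDiff ℝ ∞ κ)
    (hκ' : HasCompactSupport κ) (hf : Continuous f) (j : Fin d) (k : ℕ) :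
    HasCompactSupport ((partialD j)^[k] κ) ∧
      (partialD j)^[k] (smear volume κ f) = smear volume ((partialD j)^[k] κ) f := by
  induction k with
  | zero => exact ⟨hκ', rfl⟩
  | succ k ih =>
    simp only [Function.iterate_succ_apply']
    refine ⟨?_, ?_⟩
    · exact (ih.1.fderiv ℝ).comp_left (g := fun L : (Fin d → ℝ) →L[ℝ] ℝ => L (Pi.single j 1)) rfl
    · rw [ih.2]
      funext x
      exact fderiv_smear (hκ.partialD_iter j k) ih.1 hf x _

theorem abs_smear_le {κ f : (Fin d → ℝ) → ℝ} (hκ : Continuous κ)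
    (hκ' : HasCompactSupport κ) {K Q : ℝ} (hQ : 0 ≤ Q) (hK : 0 ≤ K)
    (hfK : ∀ w, |f w| ≤ K * (1 + ‖w‖) ^ Q) :
    ∃ K', 0 ≤ K' ∧ ∀ w, |smear volume κ f w| ≤ K' * (1 + ‖w‖) ^ Q := by
  obtain ⟨ρ, hρ0, hρ⟩ := hκ'.isCompact.isBounded.exists_pos_norm_le
  refine ⟨∫ t, |κ t| * (K * (1 + ρ) ^ Q), integral_nonneg fun t => by positivity, fun w => ?_⟩
  rw [← integral_mul_const]
  refine (norm_integral_le_of_norm_le (f := fun t => κ t * f (w - t))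
    (g := fun t => |κ t| * (K * (1 + ρ) ^ Q) * (1 + ‖w‖) ^ Q) ?_
    (Eventually.of_forall fun t => ?_))
  · exact ((hκ.integrable_of_hasCompactSupport hκ').abs.mul_const _).mul_const _
  · rw [Real.norm_eq_abs, abs_mul, mul_assoc]
    by_cases ht : κ t = 0
    · simp [ht]
    refine mul_le_mul_of_nonneg_left ((hfK _).trans ?_) (abs_nonneg _)
    have h1 : ‖t‖ ≤ ρ := hρ t (subset_tsupport _ ht)
    rw [mul_assoc, ← Real.mul_rpow (by positivity) (by positivity)]
    refine mul_le_mul_of_nonneg_left (Real.rpow_le_rpow (by positivity) ?_ hQ) hK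
    have := norm_sub_le w t
    nlinarith [norm_nonneg w]

/-- All derivatives fall on the kernel, so the growth exponent does not increase with the order. The
constants depend on the kernel, but they only serve integrability and never enter the final bound.
-/
theorem smoothGrowth_smear {κ f : (Fin d → ℝ) → ℝ} (hκ : ContDiff ℝ ∞ κ)
    (hκ' : HasCompactSupport κ) (hf : Continuous f) {K Q : ℝ} (hQ : 0 ≤ Q) (hK : 0 ≤ K)
    (hfK : ∀ w, |f w| ≤ K * (1 + ‖w‖) ^ Q) : SmoothGrowth Q (smear volume κ f) where
  contDiff := contDiff_smear hκ hκ' hf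
  growth j k := by
    obtain ⟨h1, h2⟩ := partialD_iter_smear hκ hκ' hf j k
    rw [h2]
    exact abs_smear_le (hκ.partialD_iter j k).continuous h1 hQ hK hfK

/-- Either `y ≤ (1 + η) ^ (1 / r) x`, and the factor `1 + η` pays, or `y` exceeds `x` by a fixed
proportion of itself; then `y` is of order `ε`, and the additive `η` pays. Thus one `ε` serves all
`x` and `y`. -/
theorem eventually_rpow_le {r η : ℝ} (hr : 0 ≤ r) (hη : 0 < η) :
    ∀ᶠ ε in 𝓝[>] (0 : ℝ), ∀ x y : ℝ, 0 ≤ x → 0 ≤ y → y ≤ x + ε →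
      y ^ r ≤ (1 + η) * (x ^ r + η) := by
  rcases hr.eq_or_lt with rfl | hr
  · refine Eventually.of_forall fun ε x y _ _ _ => ?_
    simp only [Real.rpow_zero]
    nlinarith
  set c := (1 + η) ^ (1 / r) with hc
  have hc1 : 1 < c := Real.one_lt_rpow (by linarith) (by positivity)
  have hcr : c ^ r = 1 + η := by
    rw [hc, ← Real.rpow_mul (by linarith), one_div_mul_cancel hr.ne', Real.rpow_one]
  have hpos : 0 < η ^ (1 / r) * (c - 1) / c :=
    div_pos (mul_pos (by positivity) (by linarith)) (by linarith)
  filter_upwards [Ioo_mem_nhdsGT hpos] with ε hε x y hx hy hxy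
  have hxr : 0 ≤ x ^ r := by positivity
  rcases le_or_gt y (c * x) with h | h
  · have := Real.rpow_le_rpow hy h hr.le
    rw [Real.mul_rpow (by linarith) hx, hcr] at this
    nlinarith
  · have h1 : y ≤ η ^ (1 / r) := by
      have h2 := hε.2
      rw [lt_div_iff₀ (by linarith)] at h2
      have h3 : y * (c - 1) ≤ η ^ (1 / r) * (c - 1) := by nlinarith
      exact le_of_mul_le_mul_right h3 (by linarith)
    have := Real.rpow_le_rpow hy h1 hr.le
    rw [← Real.rpow_mul hη.le, one_div_mul_cancel hr.ne', Real.rpow_one] at this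
    nlinarith

theorem eventually_polyDom_le {A B : ℝ} (hA : 0 ≤ A) (hB : 0 ≤ B) {r : Fin d → ℝ}
    (hr : ∀ l, 0 ≤ r l) {η : ℝ} (hη : 0 < η) :
    ∀ᶠ ε in 𝓝[>] (0 : ℝ), ∀ x y : Fin d → ℝ, ‖y - x‖ ≤ ε →
      polyDom A B r y ≤ (1 + η) * polyDom (A + η) B r x := by
  -- The additive errors of the `d` coordinates, multiplied by `B`, then amount to at most `η` and
  -- are absorbed in `A`.
  set η' := η / (B * d + 1) with hη'
  have hBd : 0 ≤ B * d := by positivity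
  have hη0 : 0 < η' := by positivity
  have hle : η' ≤ η := div_le_self hη.le (by linarith)
  have hB' : B * d * η' ≤ η := by
    rw [hη', mul_div_assoc', div_le_iff₀ (by linarith)]
    nlinarith
  have h := eventually_all.2 fun l => eventually_rpow_le (hr l) hη0
  filter_upwards [h] with ε hε x y hxy
  have h1 : ∑ i, |y i| ^ r i ≤ ∑ i, (1 + η') * (|x i| ^ r i + η') := by
    refine Finset.sum_le_sum fun i _ => hε i _ _ (abs_nonneg _) (abs_nonneg _) ?_
    have h2 : |y i - x i| ≤ ε := (norm_le_pi_norm (y - x) i).trans hxy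
    have := abs_sub_abs_le_abs_sub (y i) (x i)
    linarith
  rw [← Finset.mul_sum, Finset.sum_add_distrib, Finset.sum_const, Finset.card_fin,
    nsmul_eq_mul] at h1
  have hS : 0 ≤ ∑ i, |x i| ^ r i := Finset.sum_nonneg fun i _ => by positivity
  have h3 := mul_le_mul_of_nonneg_left h1 hB
  unfold polyDom
  set S := ∑ i, |x i| ^ r i
  have hBS : 0 ≤ B * S := mul_nonneg hB hS
  calc A + B * ∑ i, |y i| ^ r i ≤ A + B * ((1 + η') * (S + d * η')) := by linarith
    _ ≤ (1 + η') * (A + B * d * η' + B * S) := by nlinarith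
    _ ≤ (1 + η') * (A + η + B * S) := by gcongr
    _ ≤ (1 + η) * (A + η + B * S) := by gcongr

/-- The mollification of `h ∘ g` has the same bound on its derivatives as `h ∘ g` formally has. -/
theorem eventually_abs_partialD_smear_le {p : ℕ} (hp : 1 ≤ p) {A B : ℝ} (hA : 0 ≤ A) (hB : 0 ≤ B)
    {r : Fin d → ℝ} (hr : ∀ l, 0 ≤ r l) {g : (Fin d → ℝ) → ℝ} {h : ℝ → ℝ}
    (hg : MemCP p (polyDom A B r) g) (hh : MemCb p h) (hc : Continuous fun w => h (g w))
    {η : ℝ} (hη : 0 < η) :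
    ∀ᶠ ε in 𝓝[>] (0 : ℝ), ∀ κ, IsMollifier volume ε κ → ∀ j x,
      |(partialD j)^[p] (smear volume κ fun w => h (g w)) x| ≤
        hConst p h * ((1 + η) * polyDom (A + η) B r x) := by
  have h1 := eventually_polyDom_le hA hB hr hη
  obtain ⟨δ, hδ0, hδ⟩ := mem_nhdsGT_iff_exists_Ioo_subset.1 h1
  have hδ0' : (0 : ℝ) < δ := hδ0
  filter_upwards [Ioo_mem_nhdsGT (show (0 : ℝ) < δ / 2 by linarith)] with ε hε κ hκ j x
  have hP0 : 0 ≤ (1 + η) * polyDom (A + η) B r x := by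
    unfold polyDom
    have hS : 0 ≤ ∑ i, |x i| ^ r i := Finset.sum_nonneg fun i _ => by positivity
    positivity
  -- The radius of the kernel uses less than `δ / 2` and the choice of `s₀` keeps the displacement
  -- along the axis below `δ / 4`, so all points stay within `3 δ / 4` of `x`.
  have key := hκ.abs_iteratedDeriv_smear_le hc x (Pi.single j 1) p
    (R := hConst p h * ((1 + η) * polyDom (A + η) B r x)) (s₀ := δ / 4 / (2 * p + 1))
    (mul_nonneg (MemCb.hConst_nonneg p h) hP0) (by positivity) (fun y hy s hs hs' => by
      refine hg.abs_fwdDiff_comp_le hp hh hs fun t ht => ?_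
      refine (hδ (show 3 * δ / 4 ∈ Ioo 0 δ from ⟨by positivity, by linarith⟩)) x _ ?_
      rw [lt_div_iff₀ (by positivity)] at hs'
      have h2 : ‖t • (Pi.single j 1 : Fin d → ℝ)‖ ≤ δ / 4 := by
        rw [norm_smul, Real.norm_eq_abs, Pi.norm_single, norm_one, mul_one]
        linarith
      have h3 : ‖y - x‖ < δ / 2 := (mem_ball_iff_norm.1 hy).trans hε.2
      calc ‖y + t • (Pi.single j 1 : Fin d → ℝ) - x‖
          = ‖(y - x) + t • (Pi.single j 1 : Fin d → ℝ)‖ := by congr 1; abel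
        _ ≤ ‖y - x‖ + ‖t • (Pi.single j 1 : Fin d → ℝ)‖ := norm_add_le _ _
        _ ≤ 3 * δ / 4 := by linarith)
  rw [iteratedDeriv_line (hκ.smear_contDiff hc)] at key
  simpa using key

theorem LipGrowth.abs_smear_sub_le {K R ε : ℝ} {φ κ : (Fin d → ℝ) → ℝ} (hφ : LipGrowth K R φ)
    (hK : 0 ≤ K) (hR : 0 ≤ R) (hε : 0 < ε) (hε1 : ε ≤ 1) (hκ : IsMollifier volume ε κ)
    (w : Fin d → ℝ) : |smear volume κ φ w - φ w| ≤ ε * (K * 2 ^ R * (1 + ‖w‖) ^ R) := by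
  refine hκ.abs_smear_sub_le hφ.continuous (by positivity) fun y hy => ?_
  have h1 : ‖y - w‖ < ε := mem_ball_iff_norm.1 hy
  have h2 := hφ w (y - w)
  rw [add_sub_cancel] at h2
  rw [mul_assoc K, ← Real.mul_rpow (by norm_num) (by positivity), mul_comm ε]
  refine h2.trans ?_
  gcongr
  linarith [norm_nonneg w]

end

section

open scoped Topology
open Filter Set

/-! ### Growth and integrability -/

theorem one_add_rpow_le {x s : ℝ} (hx : 0 ≤ x) (hs : 0 ≤ s) :
    (1 + x) ^ s ≤ 2 ^ s * (1 + x ^ s) := by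
  have h1 : (1 + x) ^ s ≤ (2 * max 1 x) ^ s :=
    Real.rpow_le_rpow (by linarith) (by linarith [le_max_left 1 x, le_max_right 1 x]) hs
  rw [Real.mul_rpow (by norm_num) (by positivity)] at h1
  refine h1.trans (mul_le_mul_of_nonneg_left ?_ (by positivity))
  have hx' : 0 ≤ x ^ s := by positivity
  rcases max_cases 1 x with h | h <;> rw [h.1]
  · simpa using hx'
  · linarith

theorem rpow_le_one_add_rpow {x s t : ℝ} (hx : 0 ≤ x) (hs : 0 ≤ s) (hst : s ≤ t) :
    x ^ s ≤ 1 + x ^ t := by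
  have hxt : 0 ≤ x ^ t := by positivity
  rcases le_total x 1 with h | h
  · linarith [Real.rpow_le_one hx h hs]
  · linarith [Real.rpow_le_rpow_of_exponent_le h hst]

theorem MeasureTheory.Integrable.abs_rpow_mono {Ω : Type*} [MeasurableSpace Ω] {μ : Measure Ω}
    [IsFiniteMeasure μ] {f : Ω → ℝ} (hf : Measurable f) {s t : ℝ} (hs : 0 ≤ s) (hst : s ≤ t)
    (h : Integrable (fun ω => |f ω| ^ t) μ) : Integrable (fun ω => |f ω| ^ s) μ := by
  refine ((integrable_const (1 : ℝ)).add h).mono' (by fun_prop)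
    (Eventually.of_forall fun ω => ?_)
  rw [Real.norm_of_nonneg (by positivity)]
  exact rpow_le_one_add_rpow (abs_nonneg _) hs hst

theorem integrable_one_add_norm_rpow {Ω : Type*} [MeasurableSpace Ω] {μ : Measure Ω}
    [IsFiniteMeasure μ] {d : ℕ} {Y : Ω → Fin d → ℝ} (hY : Measurable Y) {s : ℝ} (hs : 0 ≤ s)
    (h : ∀ i, Integrable (fun ω => |Y ω i| ^ s) μ) :
    Integrable (fun ω => (1 + ‖Y ω‖) ^ s) μ := by
  refine (((integrable_const (1 : ℝ)).add
    (integrable_finsetSum Finset.univ fun i _ => h i)).const_mul (2 ^ s)).mono'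
    (by fun_prop) (Eventually.of_forall fun ω => ?_)
  rw [Real.norm_of_nonneg (by positivity)]
  simp only [Pi.add_apply]
  have hsum : 0 ≤ ∑ i, |Y ω i| ^ s := Finset.sum_nonneg fun i _ => by positivity
  rcases isEmpty_or_nonempty (Fin d) with he | he
  · have h0 : ‖Y ω‖ = 0 := by rw [show Y ω = 0 from Subsingleton.elim _ _, norm_zero]
    rw [h0, add_zero, Real.one_rpow]
    nlinarith [Real.one_le_rpow (x := 2) (by norm_num) hs]
  · refine (one_add_rpow_le (norm_nonneg _) hs).trans
      (mul_le_mul_of_nonneg_left ?_ (by positivity))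
    obtain ⟨i, hi⟩ := Finite.exists_max fun i => |Y ω i|
    have h1 := Finset.single_le_sum (f := fun i => |Y ω i| ^ s) (fun i _ => by positivity)
      (Finset.mem_univ i)
    have h2 : ‖Y ω‖ ≤ |Y ω i| := (pi_norm_le_iff_of_nonneg (abs_nonneg _)).2 hi
    have h3 := Real.rpow_le_rpow (norm_nonneg _) h2 hs
    linarith

/-! ### The standard normal law -/

section Gaussian

theorem integrable_abs_rpow_gaussianReal {s : ℝ} (hs : 0 ≤ s) :
    Integrable (fun z => |z| ^ s) (gaussianReal 0 1) := by
  exact (memLp_id_gaussianReal (μ := 0) (v := 1) ⟨s, hs⟩).integrable_norm_rpow'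

theorem integrable_one_add_abs_rpow_gaussianReal {s : ℝ} (hs : 0 ≤ s) :
    Integrable (fun z => (1 + |z|) ^ s) (gaussianReal 0 1) := by
  refine (((integrable_const (1 : ℝ)).add (integrable_abs_rpow_gaussianReal hs)).const_mul
    (2 ^ s)).mono' (by fun_prop) (Eventually.of_forall fun z => ?_)
  rw [Real.norm_of_nonneg (by positivity)]
  exact one_add_rpow_le (abs_nonneg _) hs

theorem integrable_gaussianReal_iff {f : ℝ → ℝ} :
    Integrable f (gaussianReal 0 1) ↔ Integrable (fun z => gaussianPDFReal 0 1 z * f z) := by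
  rw [gaussianReal_of_var_ne_zero _ one_ne_zero, integrable_withDensity_iff_integrable_smul'
    (measurable_gaussianPDF _ _) (ae_of_all _ fun _ => gaussianPDF_lt_top)]
  simp [toReal_gaussianPDF]

theorem hasDerivAt_gaussianPDFReal (z : ℝ) :
    HasDerivAt (gaussianPDFReal 0 1) (-(z * gaussianPDFReal 0 1 z)) z := by
  rw [gaussianPDFReal_def]
  have h1 : HasDerivAt (fun x : ℝ => -(x - 0) ^ 2 / (2 * ((1 : NNReal) : ℝ))) (-z) z := by
    have := (((hasDerivAt_id z).sub_const 0).pow 2).neg.div_const (2 * ((1 : NNReal) : ℝ))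
    convert! this using 1
    simp
    ring
  convert! (h1.exp.const_mul (√(2 * Real.pi * ((1 : NNReal) : ℝ)))⁻¹) using 1
  ring

/-- Gaussian integration by parts on the line. -/
theorem integral_mul_gaussianReal_eq {f f' : ℝ → ℝ} (hf : ∀ z, HasDerivAt f (f' z) z)
    (hi : Integrable f (gaussianReal 0 1)) (hi1 : Integrable (fun z => z * f z) (gaussianReal 0 1))
    (hi' : Integrable f' (gaussianReal 0 1)) :
    ∫ z, z * f z ∂(gaussianReal 0 1) = ∫ z, f' z ∂(gaussianReal 0 1) := by
  have h := integral_mul_deriv_eq_deriv_mul_of_integrable (u := f) (u' := f')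
    (v := gaussianPDFReal 0 1) (v' := fun z => -(z * gaussianPDFReal 0 1 z))
    (fun z _ => hf z) (fun z _ => hasDerivAt_gaussianPDFReal z)
    ((integrable_gaussianReal_iff.1 hi1).neg.congr (Eventually.of_forall fun z => by
      simp only [Pi.neg_apply, Pi.mul_apply]; ring))
    ((integrable_gaussianReal_iff.1 hi').congr (Eventually.of_forall fun z => by
      simp only [Pi.mul_apply]; ring))
    ((integrable_gaussianReal_iff.1 hi).congr (Eventually.of_forall fun z => by
      simp only [Pi.mul_apply]; ring))
  rw [integral_gaussianReal_eq_integral_smul one_ne_zero,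
    integral_gaussianReal_eq_integral_smul one_ne_zero]
  have h2 : ∫ z, gaussianPDFReal 0 1 z • (z * f z) =
      -∫ z, f z * -(z * gaussianPDFReal 0 1 z) := by
    rw [← integral_neg]
    refine integral_congr_ae (Eventually.of_forall fun z => ?_)
    simp only [smul_eq_mul]; ring
  rw [h2, h, neg_neg]
  refine integral_congr_ae (Eventually.of_forall fun z => ?_)
  simp only [smul_eq_mul]; ring

theorem integrable_pow_gaussianReal (k : ℕ) : Integrable (fun z => z ^ k) (gaussianReal 0 1) := by
  refine (integrable_abs_rpow_gaussianReal (s := k) (by positivity)).mono' (by fun_prop)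
    (Eventually.of_forall fun z => ?_)
  simp

theorem integral_pow_gaussianReal (k : ℕ) :
    ∫ z, z ^ (k + 1) ∂(gaussianReal 0 1) = k * ∫ z, z ^ (k - 1) ∂(gaussianReal 0 1) := by
  rw [← integral_const_mul]
  simp only [pow_succ']
  exact integral_mul_gaussianReal_eq (fun z => hasDerivAt_pow k z) (integrable_pow_gaussianReal k)
    (by simpa [pow_succ'] using integrable_pow_gaussianReal (k + 1))
    ((integrable_pow_gaussianReal _).const_mul _)

theorem integral_comp_neg_gaussianReal (f : ℝ → ℝ) :
    ∫ z, f (-z) ∂(gaussianReal 0 1) = ∫ z, f z ∂(gaussianReal 0 1) := by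
  have h : (gaussianReal 0 1).map (fun x => -x) = gaussianReal 0 1 := by
    rw [gaussianReal_map_neg, neg_zero]
  conv_rhs => rw [← h]
  exact ((MeasurableEquiv.neg ℝ).measurableEmbedding.integral_map f).symm

theorem absMomentZ_eq {s : ℝ} (hs : 0 ≤ s) : absMomentZ s =
    (√(2 * Real.pi))⁻¹ * (2 * ((1 / 2) ^ (-(s + 1) / 2) * (1 / 2) * Real.Gamma ((s + 1) / 2))) := by
  rw [absMomentZ, integral_gaussianReal_eq_integral_smul one_ne_zero,
    ← integral_rpow_mul_exp_neg_mul_rpow (p := 2) (q := s) (b := 1 / 2) (by norm_num)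
      (by linarith) (by norm_num), ← integral_comp_abs
      (f := fun x : ℝ => x ^ s * Real.exp (-(1 / 2) * x ^ (2 : ℝ))), ← integral_const_mul]
  refine integral_congr_ae (Eventually.of_forall fun z => ?_)
  simp only [gaussianPDFReal, smul_eq_mul, Real.rpow_two, sq_abs]
  simp
  ring_nf

theorem absMomentZ_one : absMomentZ 1 = (√(2 * Real.pi))⁻¹ * 2 := by
  rw [absMomentZ_eq (by norm_num)]
  norm_num [Real.rpow_neg_one]

/-- Under the weight `|Z|` the mean of `Z²` is 2. This is why the majorant in
`abs_rpow_le_of_le_one` is tangent at 2. -/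
theorem absMomentZ_three : absMomentZ 3 = 2 * absMomentZ 1 := by
  rw [absMomentZ_one, absMomentZ_eq (by norm_num)]
  norm_num [Real.rpow_neg]
  ring

theorem absMomentZ_nonneg (s : ℝ) : 0 ≤ absMomentZ s :=
  integral_nonneg fun z => by positivity

theorem absMomentZ_one_pos : 0 < absMomentZ 1 := by
  rw [absMomentZ_one]; positivity

theorem one_half_le_absMomentZ_one_sq : 1 / 2 ≤ absMomentZ 1 ^ 2 := by
  rw [absMomentZ_one, mul_pow, inv_pow, Real.sq_sqrt (by positivity)]
  have := Real.pi_le_four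
  have := Real.pi_pos
  rw [inv_mul_eq_div, div_le_div_iff₀ (by norm_num) (by positivity)]
  linarith

theorem absMomentZ_one_le_one : absMomentZ 1 ≤ 1 := by
  have h : absMomentZ 1 ^ 2 ≤ 1 := by
    rw [absMomentZ_one, mul_pow, inv_pow, Real.sq_sqrt (by positivity)]
    have := Real.pi_gt_three
    rw [inv_mul_eq_div, div_le_one (by positivity)]
    linarith
  nlinarith [absMomentZ_nonneg 1]

/-- Fits the case `r < 1` into the constant of the theorem. With `m = E|Z|`, Bernoulli's inequality
(the tangent at `m`) gives `m ^ (r + 1) ≤ E|Z| ^ (r + 1)`, and `2 m² = 4 / π ≥ 1` does the rest. -/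
theorem rpow_half_mul_absMomentZ_one_le {r : ℝ} (hr : 0 ≤ r) :
    2 ^ (r / 2) * absMomentZ 1 ≤ 2 ^ r * absMomentZ (r + 1) := by
  set m := absMomentZ 1 with hm
  have hm0 : 0 < m := absMomentZ_one_pos
  have h1 : m ^ (r + 1) ≤ absMomentZ (r + 1) := by
    have hp : ∀ z : ℝ, m ^ (r + 1) * (1 + (r + 1) * (|z| ^ (1 : ℝ) / m - 1)) ≤ |z| ^ (r + 1) := by
      intro z
      have := one_add_mul_self_le_rpow_one_add (s := |z| / m - 1) (p := r + 1)
        (by have : 0 ≤ |z| / m := by positivity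
            linarith) (by linarith)
      rw [add_sub_cancel, Real.div_rpow (abs_nonneg _) hm0.le, le_div_iff₀ (by positivity)] at this
      rw [Real.rpow_one]
      linarith
    have hi := integrable_abs_rpow_gaussianReal (s := 1) (by norm_num)
    have hi2 : Integrable (fun z : ℝ => (r + 1) * (|z| ^ (1 : ℝ) / m - 1)) (gaussianReal 0 1) :=
      ((hi.div_const m).sub (integrable_const 1)).const_mul _
    have := integral_mono (μ := gaussianReal 0 1)
      (((integrable_const (1 : ℝ)).add hi2).const_mul (m ^ (r + 1)))
      (integrable_abs_rpow_gaussianReal (s := r + 1) (by linarith)) hp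
    refine le_trans (le_of_eq ?_) this
    simp only [Pi.add_apply]
    rw [integral_const_mul, integral_add (integrable_const 1) hi2, integral_const_mul,
      integral_sub (hi.div_const m) (integrable_const 1), integral_div]
    have : ∫ z, |z| ^ (1 : ℝ) ∂(gaussianReal 0 1) = m := rfl
    rw [this, div_self hm0.ne']
    simp
  have h2 : 1 ≤ 2 ^ (r / 2) * m ^ r := by
    have : m ^ r = (m ^ 2) ^ (r / 2) := by
      rw [← Real.rpow_natCast, ← Real.rpow_mul hm0.le]
      congr 1
      push_cast; ring
    rw [this, ← Real.mul_rpow (by norm_num) (by positivity)]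
    exact Real.one_le_rpow (by linarith [one_half_le_absMomentZ_one_sq]) (by linarith)
  calc 2 ^ (r / 2) * m ≤ 2 ^ (r / 2) * m * (2 ^ (r / 2) * m ^ r) :=
        le_mul_of_one_le_right (by positivity) h2
    _ = 2 ^ r * m ^ (r + 1) := by
        rw [Real.rpow_add hm0, Real.rpow_one]
        have : (2 : ℝ) ^ r = 2 ^ (r / 2) * 2 ^ (r / 2) := by
          rw [← Real.rpow_add (by norm_num)]; congr 1; ring
        rw [this]; ring
    _ ≤ _ := by gcongr

variable {d : ℕ}

instance : IsProbabilityMeasure (stdNormal d) := by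
  unfold stdNormal; infer_instance

theorem measurePreserving_eval_stdNormal (k : Fin d) :
    MeasurePreserving (fun z : Fin d → ℝ => z k) (stdNormal d) (gaussianReal 0 1) :=
  measurePreserving_eval _ k

theorem integrable_eval_stdNormal {f : ℝ → ℝ} (hf : Integrable f (gaussianReal 0 1)) (k : Fin d) :
    Integrable (fun z : Fin d → ℝ => f (z k)) (stdNormal d) :=
  (measurePreserving_eval_stdNormal k).integrable_comp_of_integrable hf

theorem integral_eval_stdNormal {f : ℝ → ℝ} (hf : Measurable f) (k : Fin d) :
    ∫ z, f (z k) ∂(stdNormal d) = ∫ t, f t ∂(gaussianReal 0 1) := by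
  rw [← (measurePreserving_eval_stdNormal k).map_eq,
    integral_map (measurable_pi_apply k).aemeasurable hf.aestronglyMeasurable]

theorem integrable_one_add_norm_rpow_stdNormal {s : ℝ} (hs : 0 ≤ s) :
    Integrable (fun z => (1 + ‖z‖) ^ s) (stdNormal d) :=
  integrable_one_add_norm_rpow (Y := fun z => z) measurable_id hs fun i =>
    integrable_eval_stdNormal (integrable_abs_rpow_gaussianReal hs) i

/-- Resampling one coordinate does not change the law; this reduces integration by parts and
symmetry arguments to the line. -/
theorem measurePreserving_update_stdNormal (j : Fin d) :
    MeasurePreserving (fun q : (Fin d → ℝ) × ℝ => Function.update q.1 j q.2)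
      ((stdNormal d).prod (gaussianReal 0 1)) (stdNormal d) := by
  have hm : Measurable (fun q : (Fin d → ℝ) × ℝ => Function.update q.1 j q.2) := by
    refine measurable_pi_iff.2 fun i => ?_
    by_cases hij : i = j
    · subst hij; simpa using measurable_snd
    · simp only [Function.update_of_ne hij]; fun_prop
  refine ⟨hm, ?_⟩
  symm
  refine Measure.pi_eq fun s hs => ?_
  rw [Measure.map_apply hm (MeasurableSet.univ_pi hs)]
  have : (fun q : (Fin d → ℝ) × ℝ => Function.update q.1 j q.2) ⁻¹' (Set.pi Set.univ s) =
      (Set.pi Set.univ (Function.update s j Set.univ)) ×ˢ s j := by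
    ext ⟨z, t⟩
    simp only [mem_preimage, Set.mem_pi, mem_univ, true_imp_iff, mem_prod]
    constructor
    · intro h
      refine ⟨fun i => ?_, by simpa using h j⟩
      by_cases hij : i = j
      · subst hij; simp
      · simpa [hij] using h i
    · rintro ⟨h, ht⟩ i
      by_cases hij : i = j
      · subst hij; simpa using ht
      · simpa [hij] using h i
  rw [this, Measure.prod_prod, stdNormal, Measure.pi_pi,
    ← Finset.mul_prod_erase _ _ (Finset.mem_univ j), ← Finset.mul_prod_erase (a := j) _ _
      (Finset.mem_univ j)]
  simp only [Function.update_self, measure_univ, one_mul]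
  rw [mul_comm]
  congr 1
  refine Finset.prod_congr rfl fun i hi => ?_
  rw [Function.update_of_ne (Finset.ne_of_mem_erase hi)]

theorem integral_update_stdNormal {f : (Fin d → ℝ) → ℝ} (hf : Integrable f (stdNormal d))
    (j : Fin d) : ∫ z, f z ∂(stdNormal d) =
      ∫ z, ∫ t, f (Function.update z j t) ∂(gaussianReal 0 1) ∂(stdNormal d) := by
  have hp := measurePreserving_update_stdNormal (d := d) j
  conv_lhs => rw [← hp.map_eq]
  rw [integral_map hp.measurable.aemeasurable (by rw [hp.map_eq]; exact hf.aestronglyMeasurable)]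
  exact integral_prod _ (hp.integrable_comp_of_integrable hf)

/-- Weighted arithmetic-geometric mean with weights `1 / (r + 1)` and `r / (r + 1)`. The cases `j =
k` and `j ≠ k` need no distinction. -/
theorem integral_abs_mul_abs_rpow_le {r : ℝ} (hr : 0 ≤ r) (j k : Fin d) :
    Integrable (fun z => |z j| * |z k| ^ r) (stdNormal d) ∧
      ∫ z, |z j| * |z k| ^ r ∂(stdNormal d) ≤ absMomentZ (r + 1) := by
  have hi := integrable_abs_rpow_gaussianReal (s := r + 1) (by linarith)
  have hint : Integrable (fun z : Fin d → ℝ => 1 / (r + 1) * |z j| ^ (r + 1) +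
      r / (r + 1) * |z k| ^ (r + 1)) (stdNormal d) :=
    ((integrable_eval_stdNormal hi j).const_mul _).add
      ((integrable_eval_stdNormal hi k).const_mul _)
  have hle : ∀ z : Fin d → ℝ, |z j| * |z k| ^ r ≤ 1 / (r + 1) * |z j| ^ (r + 1) +
      r / (r + 1) * |z k| ^ (r + 1) := by
    intro z
    have := Real.geom_mean_le_arith_mean2_weighted (w₁ := 1 / (r + 1)) (w₂ := r / (r + 1))
      (p₁ := |z j| ^ (r + 1)) (p₂ := |z k| ^ (r + 1)) (by positivity) (by positivity)
      (by positivity) (by positivity) (by field_simp; ring)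
    rw [← Real.rpow_mul (abs_nonneg _), ← Real.rpow_mul (abs_nonneg _),
      mul_one_div_cancel (by linarith), Real.rpow_one, mul_div_cancel₀ _ (by linarith)] at this
    exact this
  have hI : Integrable (fun z : Fin d → ℝ => |z j| * |z k| ^ r) (stdNormal d) :=
    hint.mono' (by fun_prop) (Eventually.of_forall fun z => by
      rw [Real.norm_of_nonneg (by positivity)]; exact hle z)
  refine ⟨hI, (integral_mono hI hint hle).trans_eq ?_⟩
  rw [integral_add ((integrable_eval_stdNormal hi j).const_mul _)
      ((integrable_eval_stdNormal hi k).const_mul _), integral_const_mul, integral_const_mul,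
    integral_eval_stdNormal (f := fun t => |t| ^ (r + 1)) (by fun_prop),
    integral_eval_stdNormal (f := fun t => |t| ^ (r + 1)) (by fun_prop), absMomentZ]
  field_simp
  ring

theorem integral_abs_eval_stdNormal (j : Fin d) :
    Integrable (fun z => |z j|) (stdNormal d) ∧ ∫ z, |z j| ∂(stdNormal d) = absMomentZ 1 := by
  have hi := integrable_abs_rpow_gaussianReal (s := 1) (by norm_num)
  simp only [Real.rpow_one] at hi
  refine ⟨integrable_eval_stdNormal hi j, ?_⟩
  rw [integral_eval_stdNormal (f := fun t => |t|) (by fun_prop), absMomentZ]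
  simp

/-- The integrand is odd under reflection of the `k`-th coordinate, also when `j = k`. -/
theorem integral_abs_mul_eval_stdNormal (j k : Fin d) :
    Integrable (fun z => |z j| * z k) (stdNormal d) ∧
      ∫ z, |z j| * z k ∂(stdNormal d) = 0 := by
  have hI : Integrable (fun z => |z j| * z k) (stdNormal d) := by
    refine (integral_abs_mul_abs_rpow_le (r := 1) (by norm_num) j k).1.mono' (by fun_prop)
      (Eventually.of_forall fun z => ?_)
    simp
  refine ⟨hI, ?_⟩
  rw [integral_update_stdNormal hI k]
  refine integral_eq_zero_of_ae (Eventually.of_forall fun z => ?_)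
  simp only [Function.update_self, Pi.zero_apply]
  have h := integral_comp_neg_gaussianReal (fun t => |Function.update z k t j| * t)
  have h2 : ∀ t : ℝ, |Function.update z k (-t) j| * -t = -(|Function.update z k t j| * t) := by
    intro t
    by_cases hjk : j = k
    · subst hjk; simp
    · simp [hjk]
  simp only [h2] at h
  rw [integral_neg] at h
  linarith

end Gaussian

end

section

open scoped Topology ContDiff
open Filter Set

/-! ### Gaussian averages -/

section Average

variable {d : ℕ}

/-- The average of `f (y + s Z)` over a standard normal vector `Z`. -/
noncomputable def gAvg (s : ℝ) (f : (Fin d → ℝ) → ℝ) (y : Fin d → ℝ) : ℝ :=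
  ∫ z, f (y + s • z) ∂(stdNormal d)

theorem one_add_norm_add_smul_le (y z : Fin d → ℝ) (s : ℝ) :
    1 + ‖y + s • z‖ ≤ (1 + ‖y‖) * (1 + |s|) * (1 + ‖z‖) := by
  have h := norm_add_le y (s • z)
  rw [norm_smul, Real.norm_eq_abs] at h
  have h1 := norm_nonneg y
  have h2 := norm_nonneg z
  have h3 := abs_nonneg s
  nlinarith [mul_nonneg h1 h2, mul_nonneg h1 h3, mul_nonneg h2 h3,
    mul_nonneg (mul_nonneg h1 h2) h3]

theorem growth_add_smul_le {f : (Fin d → ℝ) → ℝ} {K Q : ℝ} (hQ : 0 ≤ Q) (hK : 0 ≤ K)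
    (hf : ∀ w, |f w| ≤ K * (1 + ‖w‖) ^ Q) {y : Fin d → ℝ} {ρ : ℝ} (hy : ‖y‖ ≤ ρ) (s : ℝ)
    (z : Fin d → ℝ) :
    |f (y + s • z)| ≤ K * ((1 + ρ) * (1 + |s|)) ^ Q * (1 + ‖z‖) ^ Q := by
  have hρ : 0 ≤ ρ := (norm_nonneg y).trans hy
  refine (hf _).trans ?_
  rw [mul_assoc, ← Real.mul_rpow (by positivity) (by positivity)]
  refine mul_le_mul_of_nonneg_left (Real.rpow_le_rpow (by positivity) ?_ hQ) hK
  refine (one_add_norm_add_smul_le y z s).trans ?_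
  gcongr

theorem integrable_add_smul {f : (Fin d → ℝ) → ℝ} (hc : Continuous f) {K Q : ℝ} (hQ : 0 ≤ Q)
    (hK : 0 ≤ K) (hf : ∀ w, |f w| ≤ K * (1 + ‖w‖) ^ Q) (y : Fin d → ℝ) (s : ℝ) :
    Integrable (fun z => f (y + s • z)) (stdNormal d) :=
  ((integrable_one_add_norm_rpow_stdNormal hQ).const_mul _).mono'
    (by fun_prop : Continuous fun z => f (y + s • z)).aestronglyMeasurable
    (Eventually.of_forall fun z => growth_add_smul_le hQ hK hf le_rfl s z)

theorem integrable_eval_mul_add_smul {f : (Fin d → ℝ) → ℝ} (hc : Continuous f) {K Q : ℝ}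
    (hQ : 0 ≤ Q) (hK : 0 ≤ K) (hf : ∀ w, |f w| ≤ K * (1 + ‖w‖) ^ Q) (y : Fin d → ℝ) (s : ℝ)
    (j : Fin d) : Integrable (fun z => z j * f (y + s • z)) (stdNormal d) := by
  refine ((integrable_one_add_norm_rpow_stdNormal (s := Q + 1) (by linarith)).const_mul
    (K * ((1 + ‖y‖) * (1 + |s|)) ^ Q)).mono'
    (by fun_prop : Continuous fun z : Fin d → ℝ => z j * f (y + s • z)).aestronglyMeasurable
    (Eventually.of_forall fun z => ?_)
  have h1 := growth_add_smul_le hQ hK hf (le_refl ‖y‖) s z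
  have h2 : |z j| ≤ 1 + ‖z‖ := (norm_le_pi_norm z j).trans (by linarith)
  rw [Real.norm_eq_abs, abs_mul, Real.rpow_add (by positivity), Real.rpow_one, ← mul_assoc,
    mul_comm]
  gcongr

theorem hasDerivAt_gAvg {f : (Fin d → ℝ) → ℝ} (hf : ContDiff ℝ ∞ f) {K K' Q : ℝ} (hQ : 0 ≤ Q)
    (hK : 0 ≤ K) (hK' : 0 ≤ K') (hfK : ∀ w, |f w| ≤ K * (1 + ‖w‖) ^ Q) {j : Fin d}
    (hfK' : ∀ w, |partialD j f w| ≤ K' * (1 + ‖w‖) ^ Q) (y : Fin d → ℝ) (c s x : ℝ) :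
    HasDerivAt (fun x => gAvg s f (y + (c * x) • Pi.single j 1))
      (c * gAvg s (partialD j f) (y + (c * x) • Pi.single j 1)) x := by
  set ρ := ‖y‖ + |c| * (|x| + 1)
  have hy : ∀ x' ∈ Metric.ball x 1, ‖y + (c * x') • (Pi.single j 1 : Fin d → ℝ)‖ ≤ ρ := by
    intro x' hx'
    refine (norm_add_le _ _).trans (add_le_add le_rfl ?_)
    rw [norm_smul, Pi.norm_single, norm_one, mul_one, Real.norm_eq_abs, abs_mul]
    have h1 : |x' - x| < 1 := hx'
    have := abs_sub_abs_le_abs_sub x' x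
    gcongr
    linarith
  have hcf := hf.continuous
  have hcf' := (hf.partialD j).continuous
  let F : ℝ → (Fin d → ℝ) → ℝ := fun x z => f (y + (c * x) • Pi.single j 1 + s • z)
  let F' : ℝ → (Fin d → ℝ) → ℝ := fun x z =>
    c * partialD j f (y + (c * x) • Pi.single j 1 + s • z)
  have hF : ∀ x, AEStronglyMeasurable (F x) (stdNormal d) := fun x =>
    (by fun_prop : Continuous fun z =>
      f (y + (c * x) • Pi.single j 1 + s • z)).aestronglyMeasurable
  have hF' : AEStronglyMeasurable (F' x) (stdNormal d) :=
    (by fun_prop : Continuous fun z =>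
      c * partialD j f (y + (c * x) • Pi.single j 1 + s • z)).aestronglyMeasurable
  have hFi : Integrable (F x) (stdNormal d) := integrable_add_smul hcf hQ hK hfK _ _
  have hbd : ∀ z, ∀ x' ∈ Metric.ball x 1, ‖F' x' z‖ ≤
      |c| * (K' * ((1 + ρ) * (1 + |s|)) ^ Q * (1 + ‖z‖) ^ Q) := by
    intro z x' hx'
    rw [Real.norm_eq_abs, abs_mul]
    exact mul_le_mul_of_nonneg_left (growth_add_smul_le hQ hK' hfK' (hy x' hx') s z)
      (abs_nonneg _)
  have hbi : Integrable (fun z => |c| * (K' * ((1 + ρ) * (1 + |s|)) ^ Q * (1 + ‖z‖) ^ Q))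
      (stdNormal d) := ((integrable_one_add_norm_rpow_stdNormal hQ).const_mul _).const_mul _
  have hdiff : ∀ z, ∀ x' ∈ Metric.ball x 1, HasDerivAt (F · z) (F' x' z) x' := by
    intro z x' _
    have := hasDerivAt_line hf (y + s • z) j c x'
    simp only [add_right_comm y (s • z)] at this
    exact this
  have h2 := (hasDerivAt_integral_of_dominated_loc_of_deriv_le (Metric.ball_mem_nhds x one_pos)
    (Eventually.of_forall hF) hFi hF' (Eventually.of_forall hbd) hbi
    (Eventually.of_forall hdiff)).2
  have e : ∫ z, F' x z ∂(stdNormal d) =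
      c * gAvg s (partialD j f) (y + (c * x) • Pi.single j 1) := integral_const_mul _ _
  rw [e] at h2
  exact h2

/-- Gaussian integration by parts. -/
theorem integral_eval_mul_eq_gAvg {f : (Fin d → ℝ) → ℝ} (hf : ContDiff ℝ ∞ f) {K K' Q : ℝ}
    (hQ : 0 ≤ Q) (hK : 0 ≤ K) (hK' : 0 ≤ K') (hfK : ∀ w, |f w| ≤ K * (1 + ‖w‖) ^ Q) {j : Fin d}
    (hfK' : ∀ w, |partialD j f w| ≤ K' * (1 + ‖w‖) ^ Q) (y : Fin d → ℝ) (s : ℝ) :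
    ∫ z, z j * f (y + s • z) ∂(stdNormal d) = s * gAvg s (partialD j f) y := by
  have hcf := hf.continuous
  have hcf' := (hf.partialD j).continuous
  have hg : Integrable (fun t => (1 + |t|) ^ Q) (gaussianReal 0 1) :=
    integrable_one_add_abs_rpow_gaussianReal hQ
  have hg1 : Integrable (fun t => (1 + |t|) ^ (Q + 1)) (gaussianReal 0 1) :=
    integrable_one_add_abs_rpow_gaussianReal (by linarith)
  rw [integral_update_stdNormal (integrable_eval_mul_add_smul hcf hQ hK hfK y s j) j, gAvg,
    ← integral_const_mul, integral_update_stdNormal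
      ((integrable_add_smul hcf' hQ hK' hfK' y s).const_mul s) j]
  refine integral_congr_ae (Eventually.of_forall fun z => ?_)
  simp only [Function.update_self]
  -- The coordinates other than `j` are frozen, which leaves the one-dimensional formula for a
  -- function of `t` whose derivative carries the factor `s`.
  set y' := y + s • Function.update z j 0 with hy'
  have hup : ∀ t : ℝ, y + s • Function.update z j t = y' + (s * t) • Pi.single j 1 := by
    intro t
    ext i
    by_cases hij : i = j
    · subst hij; simp [hy']
    · simp [hy', hij]
  simp only [hup]
  have hbd : ∀ t : ℝ, (1 + ‖y' + (s * t) • (Pi.single j 1 : Fin d → ℝ)‖) ^ Q ≤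
      ((1 + ‖y'‖) * (1 + |s|)) ^ Q * (1 + |t|) ^ Q := by
    intro t
    rw [← Real.mul_rpow (by positivity) (by positivity), mul_smul]
    refine Real.rpow_le_rpow (by positivity) ?_ hQ
    have := one_add_norm_add_smul_le y' (t • (Pi.single j 1 : Fin d → ℝ)) s
    rwa [norm_smul t, Pi.norm_single, norm_one, mul_one, Real.norm_eq_abs] at this
  refine integral_mul_gaussianReal_eq (fun t => hasDerivAt_line hf y' j s t) ?_ ?_ ?_
  · refine (hg.const_mul (K * ((1 + ‖y'‖) * (1 + |s|)) ^ Q)).mono'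
      (by fun_prop : Continuous fun t : ℝ =>
        f (y' + (s * t) • Pi.single j 1)).aestronglyMeasurable
      (Eventually.of_forall fun t => (hfK _).trans ?_)
    rw [mul_assoc]
    exact mul_le_mul_of_nonneg_left (hbd t) hK
  · refine (hg1.const_mul (K * ((1 + ‖y'‖) * (1 + |s|)) ^ Q)).mono'
      (by fun_prop : Continuous fun t : ℝ =>
        t * f (y' + (s * t) • Pi.single j 1)).aestronglyMeasurable
      (Eventually.of_forall fun t => ?_)
    rw [Real.norm_eq_abs, abs_mul, Real.rpow_add (by positivity), Real.rpow_one, ← mul_assoc,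
      mul_comm]
    refine mul_le_mul ((hfK _).trans ?_) (by linarith) (abs_nonneg _) (by positivity)
    rw [mul_assoc]
    exact mul_le_mul_of_nonneg_left (hbd t) hK
  · refine (hg.const_mul (|s| * (K' * ((1 + ‖y'‖) * (1 + |s|)) ^ Q))).mono'
      (by fun_prop : Continuous fun t : ℝ =>
        s * partialD j f (y' + (s * t) • Pi.single j 1)).aestronglyMeasurable
      (Eventually.of_forall fun t => ?_)
    rw [Real.norm_eq_abs, abs_mul, mul_assoc |s|, mul_assoc]
    exact mul_le_mul_of_nonneg_left ((hfK' _).trans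
      (mul_le_mul_of_nonneg_left (hbd t) hK')) (abs_nonneg _)

theorem SmoothGrowth.iteratedDeriv_gAvg {φ : (Fin d → ℝ) → ℝ} {Q : ℝ} (hQ : 0 ≤ Q)
    (hφ : SmoothGrowth Q φ) (j : Fin d) (m : ℕ) (y : Fin d → ℝ) (c s : ℝ) (k : ℕ) :
    iteratedDeriv k (fun x => gAvg s ((partialD j)^[m] φ) (y + (c * x) • Pi.single j 1)) =
      fun x => c ^ k * gAvg s ((partialD j)^[m + k] φ) (y + (c * x) • Pi.single j 1) := by
  induction k with
  | zero => simp
  | succ k ih =>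
    funext x
    rw [iteratedDeriv_succ, ih]
    obtain ⟨K, hK, hfK⟩ := hφ.growth j (m + k)
    obtain ⟨K', hK', hfK'⟩ := hφ.growth j (m + (k + 1))
    rw [← add_assoc, Function.iterate_succ_apply'] at hfK'
    have := (hasDerivAt_gAvg (hφ.contDiff.partialD_iter j (m + k)) hQ hK hK' hfK hfK' y c s
      x).const_mul (c ^ k)
    rw [this.deriv, ← add_assoc m, Function.iterate_succ_apply', pow_succ]
    ring

theorem SmoothGrowth.contDiff_gAvg {φ : (Fin d → ℝ) → ℝ} {Q : ℝ} (hQ : 0 ≤ Q)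
    (hφ : SmoothGrowth Q φ) (j : Fin d) (m : ℕ) (y : Fin d → ℝ) (c s : ℝ) :
    ContDiff ℝ ∞ (fun x => gAvg s ((partialD j)^[m] φ) (y + (c * x) • Pi.single j 1)) := by
  refine contDiff_of_differentiable_iteratedDeriv fun k _ => ?_
  rw [hφ.iteratedDeriv_gAvg hQ]
  intro x
  obtain ⟨K, hK, hfK⟩ := hφ.growth j (m + k)
  obtain ⟨K', hK', hfK'⟩ := hφ.growth j (m + k + 1)
  rw [Function.iterate_succ_apply'] at hfK'
  exact ((hasDerivAt_gAvg (hφ.contDiff.partialD_iter j (m + k)) hQ hK hK' hfK hfK' y c s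
    x).const_mul (c ^ k)).differentiableAt

end Average

/-! ### Moment matching -/

theorem abs_sub_taylor_le {f : ℝ → ℝ} (hf : ContDiff ℝ ∞ f) (n : ℕ) {x K : ℝ}
    (hK : ∀ y, |y| ≤ |x| → |iteratedDeriv n f y| ≤ K) :
    |f x - ∑ k ∈ Finset.range n, iteratedDeriv k f 0 * x ^ k / k.factorial| ≤
      K * |x| ^ n / n.factorial := by
  cases n with
  | zero => simpa using hK x le_rfl
  | succ n =>
    have hK0 : 0 ≤ K := (abs_nonneg _).trans (hK 0 (by simp))
    rcases eq_or_ne x 0 with rfl | hx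
    · rw [Finset.sum_range_succ']
      simp
    obtain ⟨x', hx', h⟩ := taylor_mean_remainder_lagrange_iteratedDeriv (f := f) (n := n)
      hx.symm (hf.of_le (by exact_mod_cast le_top)).contDiffOn
    have hu := uniqueDiffOn_uIcc hx.symm
    have hT : taylorWithinEval f n (uIcc 0 x) 0 x =
        ∑ k ∈ Finset.range (n + 1), iteratedDeriv k f 0 * x ^ k / k.factorial := by
      rw [taylor_within_apply]
      refine Finset.sum_congr rfl fun k _ => ?_
      rw [iteratedDerivWithin_eq_iteratedDeriv hu
        (hf.of_le (by exact_mod_cast le_top)).contDiffAt left_mem_uIcc, smul_eq_mul, sub_zero]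
      field_simp
    rw [← hT, h, sub_zero, abs_div, abs_mul, abs_pow, Nat.abs_cast]
    gcongr
    refine hK x' ?_
    rcases le_total 0 x with h0 | h0
    · rw [uIoo_of_le h0] at hx'
      rw [abs_of_nonneg h0, abs_of_pos hx'.1]; exact hx'.2.le
    · rw [uIoo_of_ge h0] at hx'
      rw [abs_of_nonpos h0, abs_of_neg hx'.2]; linarith [hx'.1]

/-- If the first `p` moments of `ν` are those of the standard normal law, then `ν` nearly
satisfies the Stein identity for functions with a controlled derivative of order `p`. -/
theorem abs_integral_stein_le {ν : Measure ℝ} [IsProbabilityMeasure ν] {p : ℕ} (hp : 1 ≤ p)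
    (hint : ∀ k ≤ p, Integrable (fun x => x ^ k) ν)
    (hmom : ∀ k : ℕ, 1 ≤ k → k ≤ p → ∫ x, x ^ k ∂ν = ∫ z, z ^ k ∂(gaussianReal 0 1))
    {F : ℝ → ℝ} (hF : ContDiff ℝ ∞ F) {b : ℝ} (hb : 0 ≤ b) {κ : ℝ → ℝ}
    (hκ : ∀ x y, |y| ≤ b * |x| → |iteratedDeriv p F y| ≤ κ x)
    (hi1 : Integrable (fun x => |x| ^ (p + 1) * κ x) ν)
    (hi2 : Integrable (fun x => |x| ^ (p - 1) * κ x) ν) :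
    |∫ x, (x * F (b * x) - b * deriv F (b * x)) ∂ν| ≤
      b ^ p * (1 / p.factorial * ∫ x, |x| ^ (p + 1) * κ x ∂ν +
        1 / (p - 1).factorial * ∫ x, |x| ^ (p - 1) * κ x ∂ν) := by
  set a : ℕ → ℝ := fun k => iteratedDeriv k F 0 * b ^ k / k.factorial with ha
  -- The Stein operator applied to the Taylor polynomial of `x ↦ F (b x)` of degree `p - 1`. It only
  -- involves powers up to `p`, so its mean is the Gaussian one, namely 0.
  set q : ℝ → ℝ := fun x => ∑ k ∈ Finset.range p, a k * (x ^ (k + 1) - k * x ^ (k - 1)) with hq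
  have hqi : ∀ k < p, Integrable (fun x => a k * (x ^ (k + 1) - k * x ^ (k - 1))) ν :=
    fun k hk => ((hint (k + 1) hk).sub ((hint (k - 1) (by omega)).const_mul _)).const_mul _
  have hq_int : Integrable q ν :=
    integrable_finsetSum _ fun k hk => hqi k (Finset.mem_range.1 hk)
  have hq0 : ∫ x, q x ∂ν = 0 := by
    rw [integral_finsetSum _ fun k hk => hqi k (Finset.mem_range.1 hk)]
    refine Finset.sum_eq_zero fun k hk => ?_
    have hk' := Finset.mem_range.1 hk
    rw [integral_const_mul, integral_sub (hint (k + 1) hk')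
      ((hint (k - 1) (by omega)).const_mul _), integral_const_mul, hmom (k + 1) (by omega) hk',
      integral_pow_gaussianReal]
    -- The moment of order `k - 1` is among the matched ones only from `k = 2` on. For `k = 0` its
    -- coefficient is 0, and for `k = 1` it is the total mass.
    rcases Nat.lt_or_ge k 2 with h | h
    · interval_cases k <;> simp
    · rw [hmom (k - 1) (by omega) (by omega)]; simp
  -- The remainder of order `p` for `F` and that of order `p - 1` for its derivative are both
  -- governed by the `p`-th derivative of `F`.
  have hpw : ∀ x, |x * F (b * x) - b * deriv F (b * x) - q x| ≤
      b ^ p * (1 / p.factorial * (|x| ^ (p + 1) * κ x) +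
        1 / (p - 1).factorial * (|x| ^ (p - 1) * κ x)) := by
    intro x
    have h1 := abs_sub_taylor_le hF p (x := b * x) (K := κ x) (fun y hy => hκ x y (by
      rwa [abs_mul, abs_of_nonneg hb] at hy))
    have h2 := abs_sub_taylor_le (contDiff_infty_iff_deriv.1 hF).2 (p - 1) (x := b * x)
      (K := κ x) (fun y hy => by
        rw [← iteratedDeriv_succ', Nat.sub_add_cancel hp]
        exact hκ x y (by rwa [abs_mul, abs_of_nonneg hb] at hy))
    have e : q x = x * (∑ k ∈ Finset.range p, iteratedDeriv k F 0 * (b * x) ^ k / k.factorial) -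
        b * ∑ k ∈ Finset.range (p - 1),
          iteratedDeriv k (deriv F) 0 * (b * x) ^ k / k.factorial := by
      have e1 : ∑ k ∈ Finset.range p, a k * (k * x ^ (k - 1)) =
          b * ∑ k ∈ Finset.range (p - 1),
            iteratedDeriv k (deriv F) 0 * (b * x) ^ k / k.factorial := by
        obtain ⟨p, rfl⟩ : ∃ p', p = p' + 1 := ⟨p - 1, by omega⟩
        rw [Finset.sum_range_succ', Finset.mul_sum]
        simp only [Nat.add_sub_cancel, Nat.cast_zero, zero_mul, mul_zero, add_zero]
        refine Finset.sum_congr rfl fun k _ => ?_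
        rw [ha]
        simp only [iteratedDeriv_succ', Nat.factorial_succ]
        push_cast
        field_simp
        ring
      rw [hq, ← e1, Finset.mul_sum, ← Finset.sum_sub_distrib]
      refine Finset.sum_congr rfl fun k _ => ?_
      rw [ha]
      simp only [mul_pow]
      ring
    rw [e]
    set T1 := ∑ k ∈ Finset.range p, iteratedDeriv k F 0 * (b * x) ^ k / k.factorial
    set T2 := ∑ k ∈ Finset.range (p - 1), iteratedDeriv k (deriv F) 0 * (b * x) ^ k / k.factorial
    have e3 : x * F (b * x) - b * deriv F (b * x) - (x * T1 - b * T2) =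
        x * (F (b * x) - T1) - b * (deriv F (b * x) - T2) := by ring
    rw [e3]
    refine (abs_sub _ _).trans ?_
    rw [abs_mul, abs_mul, abs_of_nonneg hb]
    rw [abs_mul, abs_of_nonneg hb, mul_pow] at h1 h2
    have h3 := mul_le_mul_of_nonneg_left h1 (abs_nonneg x)
    have h4 := mul_le_mul_of_nonneg_left h2 hb
    refine (add_le_add h3 h4).trans_eq ?_
    have hbp : b ^ p = b * b ^ (p - 1) := by
      rw [← pow_succ', Nat.sub_add_cancel hp]
    rw [pow_succ', mul_add]
    conv_rhs => rw [show b ^ p * (1 / ((p - 1).factorial : ℝ) * (|x| ^ (p - 1) * κ x)) =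
      b * b ^ (p - 1) * (1 / ((p - 1).factorial : ℝ) * (|x| ^ (p - 1) * κ x)) by rw [← hbp]]
    ring
  have hdF : Continuous (deriv F) := (contDiff_infty_iff_deriv.1 hF).2.continuous
  have hcF := hF.continuous
  have hbound := ((hi1.const_mul (1 / (p.factorial : ℝ))).add
    (hi2.const_mul (1 / ((p - 1).factorial : ℝ)))).const_mul (b ^ p)
  have hqc : Continuous q := by
    rw [hq]; fun_prop
  have hrem : Integrable (fun x => x * F (b * x) - b * deriv F (b * x) - q x) ν :=
    hbound.mono' (by fun_prop : Continuous fun x =>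
      x * F (b * x) - b * deriv F (b * x) - q x).aestronglyMeasurable (Eventually.of_forall hpw)
  have e : ∫ x, (x * F (b * x) - b * deriv F (b * x)) ∂ν =
      ∫ x, (x * F (b * x) - b * deriv F (b * x) - q x) ∂ν := by
    have := integral_add hrem hq_int
    rw [hq0, add_zero] at this
    rw [← this]
    simp
  rw [e]
  refine (norm_integral_le_of_norm_le (f := fun x => x * F (b * x) - b * deriv F (b * x) - q x)
    hbound (Eventually.of_forall fun x => by simpa using hpw x)).trans_eq ?_
  rw [integral_const_mul]
  simp only [Pi.add_apply]
  rw [integral_add (hi1.const_mul _) (hi2.const_mul _), integral_const_mul, integral_const_mul]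

end

section

open scoped Topology
open Filter Set

/-! ### The contribution of a single variable -/

/-- A bound for `E |Z_j| |c u + s Z_k| ^ r`, in the form that is integrated against the law
of `u`. -/
noncomputable def weightV (r c s u : ℝ) : ℝ :=
  if 1 ≤ r then 2 ^ r * (2 ^ r * |u| ^ r + absMomentZ (r + 1))
  else 2 ^ (r / 2) * absMomentZ 1 * (1 + r / 2 * ((c ^ 2 * u ^ 2 + 2 * s ^ 2) / 2 - 1))

theorem weightV_nonneg {r : ℝ} (hr : 0 ≤ r) (c s u : ℝ) : 0 ≤ weightV r c s u := by
  have h1 := absMomentZ_nonneg (r + 1)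
  have h2 := absMomentZ_nonneg 1
  unfold weightV
  split_ifs with h
  · positivity
  · refine mul_nonneg (by positivity) ?_
    nlinarith [mul_nonneg hr (by positivity : 0 ≤ (c ^ 2 * u ^ 2 + 2 * s ^ 2) / 2)]

theorem add_rpow_le {x y r : ℝ} (hx : 0 ≤ x) (hy : 0 ≤ y) (hr : 0 ≤ r) :
    (x + y) ^ r ≤ 2 ^ r * (x ^ r + y ^ r) := by
  have h1 : (x + y) ^ r ≤ (2 * max x y) ^ r :=
    Real.rpow_le_rpow (by positivity) (by linarith [le_max_left x y, le_max_right x y]) hr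
  rw [Real.mul_rpow (by norm_num) (by positivity)] at h1
  refine h1.trans (mul_le_mul_of_nonneg_left ?_ (by positivity))
  have hx' : 0 ≤ x ^ r := by positivity
  have hy' : 0 ≤ y ^ r := by positivity
  rcases max_cases x y with h | h <;> rw [h.1] <;> linarith

/-- The concave function `t ↦ t ^ (r / 2)` lies below its tangent at `t = 2`, taken at `t = y²`. A
quadratic majorant can be averaged using second moments alone. -/
theorem abs_rpow_le_of_le_one {r : ℝ} (hr : 0 ≤ r) (hr1 : r ≤ 1) (y : ℝ) :
    |y| ^ r ≤ 2 ^ (r / 2) * (1 + r / 2 * (y ^ 2 / 2 - 1)) := by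
  have h := rpow_one_add_le_one_add_mul_self (s := y ^ 2 / 2 - 1) (p := r / 2)
    (by nlinarith [sq_nonneg y]) (by linarith) (by linarith)
  rw [add_sub_cancel, Real.div_rpow (by positivity) (by norm_num), div_le_iff₀ (by positivity)] at h
  have e : |y| ^ r = (y ^ 2) ^ (r / 2) := by
    rw [← sq_abs, ← Real.rpow_natCast, ← Real.rpow_mul (abs_nonneg _)]
    congr 1
    push_cast; ring
  rw [e]
  linarith

/-- The weight `|z j|` comes from integration by parts, and `δ` is the displacement due to the
single variable. For `r ≥ 1` the summands are separated at the cost of powers of 2; for `r < 1`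
subadditivity detaches `δ` and the tangent bound handles the rest. -/
theorem integral_abs_mul_rpow_le {d : ℕ} {r c s u δ β : ℝ} (hr : 0 ≤ r) (hc : 0 ≤ c) (hc1 : c ≤ 1)
    (hs : 0 ≤ s) (hs1 : s ≤ 1) (hδ : |δ| ≤ β) (j k : Fin d) :
    Integrable (fun z => |z j| * |c * (u + δ) + s * z k| ^ r) (stdNormal d) ∧
      ∫ z, |z j| * |c * (u + δ) + s * z k| ^ r ∂(stdNormal d) ≤
        2 ^ r * 2 ^ r * β ^ r + weightV r c s u := by
  have hβ : 0 ≤ β := (abs_nonneg δ).trans hδ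
  have hm1 := absMomentZ_one_le_one
  have hm0 := absMomentZ_nonneg 1
  obtain ⟨hi1, he1⟩ := integral_abs_eval_stdNormal j
  obtain ⟨hir, her⟩ := integral_abs_mul_abs_rpow_le hr j k
  have hcδ : |c * δ| ≤ β := by
    rw [abs_mul, abs_of_nonneg hc]
    nlinarith [abs_nonneg δ]
  have hβr : 0 ≤ β ^ r := by positivity
  have h2r : 1 ≤ (2 : ℝ) ^ r := Real.one_le_rpow (by norm_num) hr
  have hmeas : Measurable (fun z : Fin d → ℝ => |z j| * |c * (u + δ) + s * z k| ^ r) := by fun_prop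
  -- it suffices to find an integrable majorant
  suffices H : ∃ G : (Fin d → ℝ) → ℝ, Integrable G (stdNormal d) ∧
      (∀ z, |z j| * |c * (u + δ) + s * z k| ^ r ≤ G z) ∧
      ∫ z, G z ∂(stdNormal d) ≤ 2 ^ r * 2 ^ r * β ^ r + weightV r c s u by
    obtain ⟨G, hG, hle, hG'⟩ := H
    have hI : Integrable (fun z : Fin d → ℝ => |z j| * |c * (u + δ) + s * z k| ^ r)
        (stdNormal d) := hG.mono' hmeas.aestronglyMeasurable (Eventually.of_forall fun z => by
      rw [Real.norm_of_nonneg (by positivity)]; exact hle z)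
    exact ⟨hI, (integral_mono hI hG hle).trans hG'⟩
  unfold weightV
  split_ifs with h1r
  · refine ⟨fun z => 2 ^ r * (2 ^ r * (|u| ^ r + β ^ r)) * |z j| + 2 ^ r * (|z j| * |z k| ^ r),
      (hi1.const_mul _).add (hir.const_mul _), fun z => ?_, ?_⟩
    · have h3 : |c * (u + δ) + s * z k| ≤ (|u| + β) + |z k| := by
        have h4 : |c * u| ≤ |u| := by
          rw [abs_mul, abs_of_nonneg hc]; nlinarith [abs_nonneg u]
        have h5 : |s * z k| ≤ |z k| := by
          rw [abs_mul, abs_of_nonneg hs]; nlinarith [abs_nonneg (z k)]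
        have h6 := abs_add_three (c * u) (c * δ) (s * z k)
        rw [mul_add]
        linarith
      have h4 := Real.rpow_le_rpow (abs_nonneg _) h3 hr
      have h5 := add_rpow_le (add_nonneg (abs_nonneg u) hβ) (abs_nonneg (z k)) hr
      have h6 := add_rpow_le (abs_nonneg u) hβ hr
      have h7 : |c * (u + δ) + s * z k| ^ r ≤
          2 ^ r * (2 ^ r * (|u| ^ r + β ^ r)) + 2 ^ r * |z k| ^ r := by
        have := mul_le_mul_of_nonneg_left h6 (by positivity : (0 : ℝ) ≤ 2 ^ r)
        linarith
      have := mul_le_mul_of_nonneg_left h7 (abs_nonneg (z j))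
      linarith
    · rw [integral_add (hi1.const_mul _) (hir.const_mul _), integral_const_mul,
        integral_const_mul, he1]
      have hX : 0 ≤ 2 ^ r * (2 ^ r * (|u| ^ r + β ^ r)) := by positivity
      have := mul_le_mul_of_nonneg_left her (by positivity : (0 : ℝ) ≤ 2 ^ r)
      nlinarith [mul_le_mul_of_nonneg_left hm1 hX]
  · have hr1 : r ≤ 1 := (not_le.1 h1r).le
    obtain ⟨hik, hek⟩ := integral_abs_mul_eval_stdNormal j k
    -- When the square is expanded the cross term integrates to 0, and `E |Z_j| Z_k² ≤ 2 E|Z|`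
    -- accounts for the `2 s²` in `weightV`.
    obtain ⟨hi2, he2⟩ := integral_abs_mul_abs_rpow_le (r := 2) (by norm_num) j k
    rw [show (2 : ℝ) + 1 = 3 by norm_num, absMomentZ_three] at he2
    have hA := hi1.const_mul (β ^ r + 2 ^ (r / 2) * (1 + r / 2 * (c ^ 2 * u ^ 2 / 2 - 1)))
    have hB := hik.const_mul (2 ^ (r / 2) * (r / 2) * (c * u * s))
    have hC := hi2.const_mul (2 ^ (r / 2) * (r / 2) * (s ^ 2 / 2))
    refine ⟨fun z => (β ^ r + 2 ^ (r / 2) * (1 + r / 2 * (c ^ 2 * u ^ 2 / 2 - 1))) * |z j| +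
      2 ^ (r / 2) * (r / 2) * (c * u * s) * (|z j| * z k) +
      2 ^ (r / 2) * (r / 2) * (s ^ 2 / 2) * (|z j| * |z k| ^ (2 : ℝ)), (hA.add hB).add hC,
      fun z => ?_, ?_⟩
    · have h3 : |c * (u + δ) + s * z k| ≤ |c * u + s * z k| + β := by
        have := abs_add_le (c * u + s * z k) (c * δ)
        rw [show c * (u + δ) + s * z k = c * u + s * z k + c * δ by ring]
        linarith
      have h4 := (Real.rpow_le_rpow (abs_nonneg _) h3 hr).trans
        (Real.rpow_add_le_add_rpow (abs_nonneg _) hβ hr hr1)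
      have h5 := abs_rpow_le_of_le_one hr hr1 (c * u + s * z k)
      have h6 := mul_le_mul_of_nonneg_left (h4.trans (add_le_add_left h5 (β ^ r)))
        (abs_nonneg (z j))
      refine h6.trans_eq ?_
      simp only [Real.rpow_two, sq_abs]
      ring
    · have hAB : Integrable (fun z : Fin d → ℝ =>
          (β ^ r + 2 ^ (r / 2) * (1 + r / 2 * (c ^ 2 * u ^ 2 / 2 - 1))) * |z j| +
          2 ^ (r / 2) * (r / 2) * (c * u * s) * (|z j| * z k)) (stdNormal d) := hA.add hB
      beta_reduce
      rw [integral_add hAB hC, integral_add hA hB, integral_const_mul, integral_const_mul,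
        integral_const_mul, he1, hek, mul_zero, add_zero]
      have h3 : 0 ≤ 2 ^ (r / 2) * (r / 2) * (s ^ 2 / 2) := by positivity
      have h4 := mul_le_mul_of_nonneg_left he2 h3
      have h5 : β ^ r * absMomentZ 1 ≤ 2 ^ r * 2 ^ r * β ^ r := by
        nlinarith [mul_le_mul_of_nonneg_left hm1 hβr, mul_le_mul_of_nonneg_right
          (by nlinarith : (1 : ℝ) ≤ 2 ^ r * 2 ^ r) hβr]
      refine (add_le_add le_rfl h4).trans ?_
      rw [add_mul]
      nlinarith [h5]

/-- Averaging `weightV`. -/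
theorem integral_weightV_le {Ω : Type*} [MeasurableSpace Ω] {μ : Measure Ω}
    [IsProbabilityMeasure μ] {U : Ω → ℝ} {r c s w : ℝ} (hr : 0 ≤ r) (hcs : c ^ 2 + s ^ 2 = 1)
    (hw : 0 ≤ w) (hU2 : Integrable (fun o => U o ^ 2) μ) (hU2' : ∫ o, U o ^ 2 ∂μ ≤ 1)
    (hUr : Integrable (fun o => |U o| ^ r) μ) (hUr' : 1 ≤ r → ∫ o, |U o| ^ r ∂μ ≤ w) :
    Integrable (fun o => weightV r c s (U o)) μ ∧
      ∫ o, weightV r c s (U o) ∂μ ≤ 2 ^ r * (2 ^ r * w + absMomentZ (r + 1)) := by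
  unfold weightV
  split_ifs with h
  · have hi := ((hUr.const_mul (2 ^ r)).add (integrable_const (absMomentZ (r + 1)))).const_mul
      ((2 : ℝ) ^ r)
    refine ⟨hi, ?_⟩
    rw [integral_const_mul, integral_add (hUr.const_mul (2 ^ r)) (integrable_const _),
      integral_const_mul]
    simp only [integral_const, probReal_univ, one_smul]
    have := hUr' h
    gcongr
  · have hi0 : Integrable (fun o => r / 2 * ((c ^ 2 * U o ^ 2 + 2 * s ^ 2) / 2 - 1)) μ :=
      (((hU2.const_mul (c ^ 2)).add (integrable_const (2 * s ^ 2))).div_const 2 |>.sub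
        (integrable_const 1)).const_mul _
    have hi := ((integrable_const (1 : ℝ)).add hi0).const_mul (2 ^ (r / 2) * absMomentZ 1)
    refine ⟨hi, ?_⟩
    have hi2 : Integrable (fun o => (c ^ 2 * U o ^ 2 + 2 * s ^ 2) / 2) μ :=
      ((hU2.const_mul (c ^ 2)).add (integrable_const (2 * s ^ 2))).div_const 2
    rw [integral_const_mul, integral_add (integrable_const _) hi0, integral_const_mul,
      integral_sub hi2
        (integrable_const 1), integral_div, integral_add (hU2.const_mul (c ^ 2))
        (integrable_const (2 * s ^ 2)), integral_const_mul]
    simp only [integral_const, probReal_univ, one_smul]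
    -- The tangent term has non-positive mean because `c² E U² + 2 s² ≤ 2 (c² + s²) = 2`.
    have h1 : 1 + r / 2 * ((c ^ 2 * ∫ o, U o ^ 2 ∂μ) + 2 * s ^ 2) / 2 - r / 2 ≤ 1 := by
      have : c ^ 2 * ∫ o, U o ^ 2 ∂μ ≤ c ^ 2 := mul_le_of_le_one_right (sq_nonneg c) hU2'
      nlinarith [sq_nonneg s, mul_nonneg hr (by nlinarith [sq_nonneg c] :
        0 ≤ 2 - ((c ^ 2 * ∫ o, U o ^ 2 ∂μ) + 2 * s ^ 2))]
    have h2 := rpow_half_mul_absMomentZ_one_le hr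
    have h3 : 0 ≤ 2 ^ (r / 2) * absMomentZ 1 := mul_nonneg (by positivity) (absMomentZ_nonneg 1)
    have h4 : (0 : ℝ) ≤ 2 ^ r * (2 ^ r * w) := by positivity
    nlinarith [mul_le_mul_of_nonneg_left h1 h3]

/-- `|x| ^ t` and `x²` both increase with `|x|`, hence are non-negatively correlated, and `x²` has
mean 1. This lets the lower moments from the second Taylor remainder be merged with the higher ones.
-/
theorem integral_abs_rpow_le_add_two {ν : Measure ℝ} [IsProbabilityMeasure ν] {t : ℝ} (ht : 0 ≤ t)
    (hi : Integrable (fun x => |x| ^ (t + 2)) ν) (h2 : ∫ x, x ^ 2 ∂ν = 1) :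
    ∫ x, |x| ^ t ∂ν ≤ ∫ x, |x| ^ (t + 2) ∂ν := by
  have hit : Integrable (fun x => |x| ^ t) ν := hi.abs_rpow_mono measurable_id ht (by linarith)
  have hi2 : Integrable (fun x : ℝ => x ^ 2) ν := by
    by_contra h
    rw [integral_undef h] at h2
    exact zero_ne_one h2
  have hpw : ∀ x : ℝ, 0 ≤ |x| ^ (t + 2) - |x| ^ t - (x ^ 2 - 1) := by
    intro x
    have h1 : |x| ^ (t + 2) = |x| ^ t * x ^ 2 := by
      rw [Real.rpow_add_of_nonneg (abs_nonneg _) ht (by norm_num), Real.rpow_two, sq_abs]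
    have h3 : 0 ≤ (|x| ^ t - 1) * (x ^ 2 - 1) := by
      rcases le_total 1 |x| with h | h
      · have := Real.one_le_rpow h ht
        have h4 : 1 ≤ x ^ 2 := by rw [← sq_abs]; nlinarith
        exact mul_nonneg (by linarith) (by linarith)
      · have := Real.rpow_le_one (abs_nonneg x) h ht
        have h4 : x ^ 2 ≤ 1 := by rw [← sq_abs]; nlinarith [abs_nonneg x]
        exact mul_nonneg_of_nonpos_of_nonpos (by linarith) (by linarith)
    rw [h1]; linarith
  have h : 0 ≤ ∫ x, (|x| ^ (t + 2) - |x| ^ t - (x ^ 2 - 1)) ∂ν := integral_nonneg hpw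
  have hi3 : Integrable (fun x => |x| ^ (t + 2) - |x| ^ t) ν := hi.sub hit
  have hi4 : Integrable (fun x : ℝ => x ^ 2 - 1) ν := hi2.sub (integrable_const 1)
  rw [integral_sub hi3 hi4, integral_sub hi hit,
    integral_sub hi2 (integrable_const 1), h2] at h
  simp at h
  linarith

end

section

open scoped Topology
open Filter Set

/-! ### Derivatives of Gaussian averages and the Stein estimate for one variable -/

theorem integral_abs_mul_polyDom_le {d : ℕ} {A B : ℝ} (hA : 0 ≤ A) (hB : 0 ≤ B) {r : Fin d → ℝ}
    (hr : ∀ l, 0 ≤ r l) {c s β : ℝ} (hc : 0 ≤ c) (hc1 : c ≤ 1) (hs : 0 ≤ s) (hs1 : s ≤ 1)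
    (u v : Fin d → ℝ) (hv : ‖v‖ ≤ β) (j : Fin d) :
    Integrable (fun z => |z j| * polyDom A B r (c • (u + v) + s • z)) (stdNormal d) ∧
      ∫ z, |z j| * polyDom A B r (c • (u + v) + s • z) ∂(stdNormal d) ≤
        A + B * ∑ k, (2 ^ r k * 2 ^ r k * β ^ r k + weightV (r k) c s (u k)) := by
  obtain ⟨hi1, he1⟩ := integral_abs_eval_stdNormal j
  have hk := fun k => integral_abs_mul_rpow_le (u := u k) (hr k) hc hc1 hs hs1
    ((norm_le_pi_norm v k).trans hv) j k
  have e : (fun z : Fin d → ℝ => |z j| * polyDom A B r (c • (u + v) + s • z)) =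
      fun z => A * |z j| + B * ∑ k, |z j| * |c * (u k + v k) + s * z k| ^ r k := by
    funext z
    simp only [polyDom, Pi.add_apply, Pi.smul_apply, smul_eq_mul, ← Finset.mul_sum]
    ring
  have hS : Integrable (fun z : Fin d → ℝ => B * ∑ k, |z j| * |c * (u k + v k) + s * z k| ^ r k)
      (stdNormal d) := (integrable_finsetSum _ fun k _ => (hk k).1).const_mul B
  rw [e]
  refine ⟨(hi1.const_mul A).add hS, ?_⟩
  rw [integral_add (hi1.const_mul A) hS, integral_const_mul, integral_const_mul,
    integral_finsetSum _ fun k _ => (hk k).1, he1]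
  exact add_le_add (mul_le_of_le_one_right hA absMomentZ_one_le_one)
    (mul_le_mul_of_nonneg_left (Finset.sum_le_sum fun k _ => (hk k).2) hB)

section Term

variable {d p : ℕ} {A B H Q b c s : ℝ} {r : Fin d → ℝ} {φ : (Fin d → ℝ) → ℝ} {j : Fin d}

/-- The left side involves `p + 1` derivatives of `φ`. Integration by parts read backwards replaces
one of them by the factor `z j / s`, so that the bound on the `p`-th derivative suffices. -/
theorem SmoothGrowth.abs_iteratedDeriv_gAvg_le (hA : 0 ≤ A) (hB : 0 ≤ B)
    (hr : ∀ l, 0 ≤ r l) (hQ : 0 ≤ Q) (hφ : SmoothGrowth Q φ) (hH : 0 ≤ H)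
    (hφP : ∀ w, |(partialD j)^[p] φ w| ≤ H * polyDom A B r w) (hc : 0 ≤ c) (hc1 : c ≤ 1)
    (hs : 0 < s) (hs1 : s ≤ 1) (u : Fin d → ℝ) {y β : ℝ} (hy : |y| ≤ β) :
    |iteratedDeriv p (fun x => gAvg s (partialD j φ) (c • u + (c * x) • Pi.single j 1)) y| ≤
      c ^ p / s * (H *
        (A + B * ∑ k, (2 ^ r k * 2 ^ r k * β ^ r k + weightV (r k) c s (u k)))) := by
  have h1 := congr_fun (hφ.iteratedDeriv_gAvg hQ j 1 (c • u) c s p) y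
  simp only [Function.iterate_one] at h1
  obtain ⟨K, hK, hfK⟩ := hφ.growth j p
  obtain ⟨K', hK', hfK'⟩ := hφ.growth j (p + 1)
  rw [Function.iterate_succ_apply'] at hfK'
  have h2 := integral_eval_mul_eq_gAvg (hφ.contDiff.partialD_iter j p) hQ hK hK' hfK hfK'
    (c • u + (c * y) • Pi.single j 1) s
  have h3 : gAvg s ((partialD j)^[1 + p] φ) (c • u + (c * y) • Pi.single j 1) = s⁻¹ *
      ∫ z, z j * (partialD j)^[p] φ (c • u + (c * y) • Pi.single j 1 + s • z) ∂(stdNormal d) := by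
    rw [h2, add_comm 1 p, Function.iterate_succ_apply', inv_mul_cancel_left₀ hs.ne']
  have hv : ‖y • (Pi.single j 1 : Fin d → ℝ)‖ ≤ β := by
    rw [norm_smul, Pi.norm_single, norm_one, mul_one]; exact hy
  obtain ⟨hi, hle⟩ := integral_abs_mul_polyDom_le hA hB hr hc hc1 hs.le hs1 u _ hv j
  have ey : c • u + (c * y) • (Pi.single j 1 : Fin d → ℝ) = c • (u + y • Pi.single j 1) := by
    rw [smul_add, mul_smul]
  have h4 : |∫ z, z j * (partialD j)^[p] φ (c • u + (c * y) • Pi.single j 1 + s • z)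
      ∂(stdNormal d)| ≤ H *
        (A + B * ∑ k, (2 ^ r k * 2 ^ r k * β ^ r k + weightV (r k) c s (u k))) := by
    have h5 := norm_integral_le_of_norm_le (hi.const_mul H)
      (f := fun z => z j * (partialD j)^[p] φ (c • u + (c * y) • Pi.single j 1 + s • z))
      (Eventually.of_forall fun z => by
        rw [Real.norm_eq_abs, abs_mul, ey]
        have := mul_le_mul_of_nonneg_left (hφP (c • (u + y • Pi.single j 1) + s • z))
          (abs_nonneg (z j))
        linarith)
    rw [integral_const_mul] at h5
    exact h5.trans (mul_le_mul_of_nonneg_left hle hH)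
  rw [h1, h3, abs_mul, abs_mul, abs_of_nonneg (by positivity : 0 ≤ c ^ p),
    abs_of_pos (inv_pos.2 hs), ← mul_assoc, ← div_eq_mul_inv]
  exact mul_le_mul_of_nonneg_left h4 (by positivity)

theorem integrable_pow_of_rpow {ν : Measure ℝ} [IsProbabilityMeasure ν] {t : ℝ}
    (h : Integrable (fun x => |x| ^ t) ν) {k : ℕ} (hk : (k : ℝ) ≤ t) :
    Integrable (fun x => |x| ^ k) ν ∧ Integrable (fun x => x ^ k) ν := by
  have h1 := h.abs_rpow_mono measurable_id (s := k) (by positivity) hk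
  simp only [id, Real.rpow_natCast] at h1
  refine ⟨h1, h1.mono' (by fun_prop) (Eventually.of_forall fun x => by simp)⟩

/-- The contribution of one variable to the derivative of the interpolation between `W`
and `Z`. -/
theorem SmoothGrowth.abs_integral_term_le (hp : 1 ≤ p) (hA : 0 ≤ A) (hB : 0 ≤ B)
    (hr : ∀ l, 0 ≤ r l) (hQ : 0 ≤ Q) (hφ : SmoothGrowth Q φ) (hH : 0 ≤ H)
    (hφP : ∀ w, |(partialD j)^[p] φ w| ≤ H * polyDom A B r w)
    {ν : Measure ℝ} [IsProbabilityMeasure ν]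
    (hint : ∀ k, Integrable (fun x => |x| ^ (r k + p + 1)) ν)
    (hmom : ∀ k : ℕ, 1 ≤ k → k ≤ p → ∫ x, x ^ k ∂ν = ∫ z, z ^ k ∂(gaussianReal 0 1))
    (h2 : ∫ x, x ^ 2 ∂ν = 1) (hb : 0 ≤ b) (hc : 0 ≤ c) (hc1 : c ≤ 1)
    (hs : 0 < s) (hs1 : s ≤ 1) (u : Fin d → ℝ) :
    |∫ x, ∫ z, partialD j φ (c • (u + (b * x) • Pi.single j 1) + s • z) *
        (-(s * b * x) + c * b ^ 2 * z j) ∂(stdNormal d) ∂ν| ≤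
      b ^ (p + 1) * c ^ p * (H * (((p : ℝ) + 1) / p.factorial)) *
        ((∫ x, |x| ^ (p + 1) ∂ν) * (A + B * ∑ k, weightV (r k) c s (u k)) +
          B * ∑ k, 2 ^ r k * 2 ^ r k * b ^ r k * ∫ x, |x| ^ (r k + p + 1) ∂ν) := by
  set F : ℝ → ℝ := fun x => gAvg s (partialD j φ) (c • u + (c * x) • Pi.single j 1) with hFdef
  have hF : ContDiff ℝ (⊤ : ℕ∞) F := by
    have := hφ.contDiff_gAvg hQ j 1 (c • u) c s
    simpa using this
  obtain ⟨K1, hK1, hf1⟩ := hφ.growth j 1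
  obtain ⟨K2, hK2, hf2⟩ := hφ.growth j 2
  simp only [Function.iterate_one] at hf1
  have hf2' : ∀ w, |partialD j (partialD j φ) w| ≤ K2 * (1 + ‖w‖) ^ Q := hf2
  have hD := hφ.contDiff.partialD j
  -- The part with `z j` becomes the derivative of `F` after integration by parts; the common factor
  -- `s` will cancel the `1 / s` in `κ`.
  have hinner : ∀ x, ∫ z, partialD j φ (c • (u + (b * x) • Pi.single j 1) + s • z) *
      (-(s * b * x) + c * b ^ 2 * z j) ∂(stdNormal d) =
      -(s * b) * (x * F (b * x) - b * deriv F (b * x)) := by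
    intro x
    have ey : c • (u + (b * x) • (Pi.single j 1 : Fin d → ℝ)) =
        c • u + (c * (b * x)) • Pi.single j 1 := by
      rw [smul_add, mul_smul c (b * x)]
    rw [ey]
    set y := c • u + (c * (b * x)) • (Pi.single j 1 : Fin d → ℝ) with hy
    have hi1 := integrable_add_smul hD.continuous hQ hK1 hf1 y s
    have hi2 := integrable_eval_mul_add_smul hD.continuous hQ hK1 hf1 y s j
    have e1 : ∀ z : Fin d → ℝ, partialD j φ (y + s • z) * (-(s * b * x) + c * b ^ 2 * z j) =
        -(s * b * x) * partialD j φ (y + s • z) +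
          c * b ^ 2 * (z j * partialD j φ (y + s • z)) := fun z => by ring
    simp only [e1]
    rw [integral_add (hi1.const_mul _) (hi2.const_mul _), integral_const_mul, integral_const_mul,
      integral_eval_mul_eq_gAvg hD hQ hK1 hK2 hf1 hf2']
    have e2 : deriv F (b * x) = c * gAvg s (partialD j (partialD j φ)) y :=
      (hasDerivAt_gAvg hD hQ hK1 hK2 hf1 hf2' (c • u) c s (b * x)).deriv
    rw [e2]
    have e3 : F (b * x) = gAvg s (partialD j φ) y := rfl
    rw [e3]
    simp only [gAvg]
    ring
  simp only [hinner]
  rw [integral_const_mul]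
  set V := A + B * ∑ k, weightV (r k) c s (u k) with hV
  have hV0 : 0 ≤ V := by
    have : 0 ≤ ∑ k, weightV (r k) c s (u k) :=
      Finset.sum_nonneg fun k _ => weightV_nonneg (hr k) c s (u k)
    positivity
  set κ : ℝ → ℝ := fun x => c ^ p / s * (H *
    (V + B * ∑ k, 2 ^ r k * 2 ^ r k * b ^ r k * |x| ^ r k)) with hκdef
  have hκ : ∀ x y, |y| ≤ b * |x| → |iteratedDeriv p F y| ≤ κ x := by
    intro x y hy
    refine (hφ.abs_iteratedDeriv_gAvg_le hA hB hr hQ hH hφP hc hc1 hs hs1 u hy).trans_eq ?_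
    rw [hκdef, hV]
    simp only [Finset.sum_add_distrib]
    simp only [Real.mul_rpow hb (abs_nonneg x), mul_assoc]
    ring
  have hpow : ∀ m : ℕ, m ≤ p + 1 → Integrable (fun x => |x| ^ m) ν := fun m hm =>
    (integrable_pow_of_rpow (hint j) (by
      have : (m : ℝ) ≤ p + 1 := by exact_mod_cast hm
      linarith [hr j])).1
  have hrpow : ∀ (m : ℕ) (k : Fin d), m ≤ p + 1 →
      Integrable (fun x => |x| ^ (r k + m)) ν := fun m k hm =>
    (hint k).abs_rpow_mono measurable_id (add_nonneg (hr k) (by positivity)) (by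
      have : (m : ℝ) ≤ p + 1 := by exact_mod_cast hm
      linarith)
  have hexp : ∀ (m : ℕ) (x : ℝ), |x| ^ m * κ x = c ^ p / s * (H *
      (V * |x| ^ m + B * ∑ k, 2 ^ r k * 2 ^ r k * b ^ r k * |x| ^ (r k + m))) := by
    intro m x
    have : ∀ k, |x| ^ (r k + m) = |x| ^ r k * |x| ^ m := fun k => by
      rw [Real.rpow_add_of_nonneg (abs_nonneg _) (hr k) (by positivity), Real.rpow_natCast]
    simp only [this, hκdef, ← mul_assoc, ← Finset.sum_mul]
    ring
  have hmint : ∀ m : ℕ, m ≤ p + 1 → Integrable (fun x => |x| ^ m * κ x) ν ∧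
      ∫ x, |x| ^ m * κ x ∂ν = c ^ p / s * (H * (V * ∫ x, |x| ^ m ∂ν +
        B * ∑ k, 2 ^ r k * 2 ^ r k * b ^ r k * ∫ x, |x| ^ (r k + m) ∂ν)) := by
    intro m hm
    have hS : ∀ k ∈ Finset.univ, Integrable
        (fun x => 2 ^ r k * 2 ^ r k * b ^ r k * |x| ^ (r k + m)) ν :=
      fun k _ => (hrpow m k hm).const_mul _
    have hS' : Integrable
        (fun x => B * ∑ k, 2 ^ r k * 2 ^ r k * b ^ r k * |x| ^ (r k + m)) ν :=
      (integrable_finsetSum _ hS).const_mul B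
    simp only [hexp]
    refine ⟨((((hpow m hm).const_mul V).add hS').const_mul H).const_mul _, ?_⟩
    rw [integral_const_mul, integral_const_mul, integral_add ((hpow m hm).const_mul V) hS',
      integral_const_mul, integral_const_mul, integral_finsetSum _ hS]
    simp only [integral_const_mul]
  obtain ⟨hi1, he1⟩ := hmint (p + 1) le_rfl
  obtain ⟨hi2, he2⟩ := hmint (p - 1) (by omega)
  have key := abs_integral_stein_le hp (fun k hk => (integrable_pow_of_rpow (hint j) (by
      have : (k : ℝ) ≤ p := by exact_mod_cast hk
      linarith [hr j])).2) hmom hF hb hκ hi1 hi2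
  set T := V * ∫ x, |x| ^ (p + 1) ∂ν +
    B * ∑ k, 2 ^ r k * 2 ^ r k * b ^ r k * ∫ x, |x| ^ (r k + p + 1) ∂ν with hT
  have hpcast : ((p - 1 : ℕ) : ℝ) = p - 1 := by push_cast [Nat.cast_sub hp]; ring
  have hp1 : (1 : ℝ) ≤ p := by exact_mod_cast hp
  have hm1 : ∫ x, |x| ^ (p - 1) ∂ν ≤ ∫ x, |x| ^ (p + 1) ∂ν := by
    have e : (((p - 1 : ℕ) : ℝ) + 2) = ((p + 1 : ℕ) : ℝ) := by rw [hpcast]; push_cast; ring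
    have := integral_abs_rpow_le_add_two (ν := ν) (t := ((p - 1 : ℕ) : ℝ)) (by positivity) (by
      rw [e]; simpa only [Real.rpow_natCast] using hpow (p + 1) le_rfl) h2
    rw [e] at this
    simpa only [Real.rpow_natCast] using this
  have hm2 : ∀ k, ∫ x, |x| ^ (r k + (p - 1 : ℕ)) ∂ν ≤ ∫ x, |x| ^ (r k + p + 1) ∂ν := by
    intro k
    have e : r k + ((p - 1 : ℕ) : ℝ) + 2 = r k + p + 1 := by rw [hpcast]; ring
    have := integral_abs_rpow_le_add_two (ν := ν) (t := r k + ((p - 1 : ℕ) : ℝ))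
      (add_nonneg (hr k) (by positivity)) (by rw [e]; exact hint k) h2
    rwa [e] at this
  have hT1 : ∫ x, |x| ^ (p + 1) * κ x ∂ν = c ^ p / s * (H * T) := by
    rw [he1, hT]
    simp only [Nat.cast_add, Nat.cast_one, add_assoc]
  have hcs : 0 ≤ c ^ p / s := by positivity
  have hT2 : ∫ x, |x| ^ (p - 1) * κ x ∂ν ≤ c ^ p / s * (H * T) := by
    rw [he2, hT]
    refine mul_le_mul_of_nonneg_left (mul_le_mul_of_nonneg_left (add_le_add
      (mul_le_mul_of_nonneg_left hm1 hV0) (mul_le_mul_of_nonneg_left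
        (Finset.sum_le_sum fun k _ => mul_le_mul_of_nonneg_left (hm2 k) (by positivity)) hB))
        hH) hcs
  -- The two Taylor remainders together give the constant of the theorem.
  have hfac : 1 / (p.factorial : ℝ) + 1 / ((p - 1).factorial : ℝ) =
      ((p : ℝ) + 1) / p.factorial := by
    have : (p.factorial : ℝ) = p * ((p - 1).factorial : ℝ) := by
      exact_mod_cast (Nat.mul_factorial_pred (by omega)).symm
    rw [this]
    have h0 : ((p - 1).factorial : ℝ) ≠ 0 := by positivity
    field_simp
    ring
  rw [abs_mul, abs_neg, abs_of_nonneg (by positivity : 0 ≤ s * b)]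
  calc s * b * |∫ x, (x * F (b * x) - b * deriv F (b * x)) ∂ν|
      ≤ s * b * (b ^ p * (1 / p.factorial * (c ^ p / s * (H * T)) +
          1 / (p - 1).factorial * (c ^ p / s * (H * T)))) := by
        refine mul_le_mul_of_nonneg_left (key.trans ?_) (by positivity)
        rw [hT1]
        gcongr
    _ = b ^ (p + 1) * c ^ p * (H * (1 / (p.factorial : ℝ) + 1 / ((p - 1).factorial : ℝ))) * T := by
        field_simp
        ring
    _ = _ := by rw [hfac, hT, mul_comm V]

end Term

end

section

open scoped Topology
open Filter Set

/-! ### Independent arrays -/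

section Indep

variable {Ω : Type*} [MeasurableSpace Ω] {μ : Measure Ω} [IsProbabilityMeasure μ]

theorem ProbabilityTheory.IndepFun.integral_eq_integral_integral {E : Type*} [MeasurableSpace E]
    {U : Ω → E} {Y : Ω → ℝ} (h : IndepFun U Y μ) (hU : Measurable U) (hY : Measurable Y)
    {f : E → ℝ → ℝ} (hf : Measurable (Function.uncurry f))
    (hi : Integrable (fun o => f (U o) (Y o)) μ) :
    Integrable (fun o => ∫ x, f (U o) x ∂(μ.map Y)) μ ∧
      ∫ o, f (U o) (Y o) ∂μ = ∫ o, ∫ x, f (U o) x ∂(μ.map Y) ∂μ := by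
  have hprod := (indepFun_iff_map_prod_eq_prod_map_map hU.aemeasurable hY.aemeasurable).1 h
  have : IsProbabilityMeasure (μ.map U) := Measure.isProbabilityMeasure_map hU.aemeasurable
  have : IsProbabilityMeasure (μ.map Y) := Measure.isProbabilityMeasure_map hY.aemeasurable
  have hi' : Integrable (Function.uncurry f) ((μ.map U).prod (μ.map Y)) := by
    rw [← hprod]
    exact (integrable_map_measure hf.aestronglyMeasurable (hU.prodMk hY).aemeasurable).2 hi
  have hI := hi'.integral_prod_left
  refine ⟨(integrable_map_measure hI.aestronglyMeasurable hU.aemeasurable).1 hI, ?_⟩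
  have h1 : ∫ o, f (U o) (Y o) ∂μ = ∫ q, Function.uncurry f q ∂(μ.map fun o => (U o, Y o)) :=
    (integral_map (hU.prodMk hY).aemeasurable hf.aestronglyMeasurable).symm
  rw [h1, hprod, integral_prod _ hi', integral_map hU.aemeasurable hI.aestronglyMeasurable]
  rfl

/-- Adding an independent centred variable increases absolute moments of order at least one. -/
theorem integral_abs_rpow_le_of_indep {U Y : Ω → ℝ} (h : IndepFun U Y μ) (hU : Measurable U)
    (hY : Measurable Y) (hYi : Integrable Y μ) (hY0 : ∫ o, Y o ∂μ = 0) {r : ℝ} (hr : 1 ≤ r)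
    (hUr : Integrable (fun o => |U o| ^ r) μ) (hYr : Integrable (fun o => |Y o| ^ r) μ)
    (hi : Integrable (fun o => |U o + Y o| ^ r) μ) :
    ∫ o, |U o| ^ r ∂μ ≤ ∫ o, |U o + Y o| ^ r ∂μ := by
  have hr0 : 0 ≤ r := by linarith
  have : IsProbabilityMeasure (μ.map Y) := Measure.isProbabilityMeasure_map hY.aemeasurable
  obtain ⟨hI, he⟩ := h.integral_eq_integral_integral hU hY (f := fun u y => |u + y| ^ r)
    (by unfold Function.uncurry; fun_prop) hi
  rw [he]
  have hνi : Integrable (fun y => y) (μ.map Y) :=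
    (integrable_map_measure aestronglyMeasurable_id hY.aemeasurable).2 hYi
  have hν0 : ∫ y, y ∂(μ.map Y) = 0 :=
    (integral_map hY.aemeasurable aestronglyMeasurable_id).trans hY0
  have hνr : Integrable (fun y => |y| ^ r) (μ.map Y) :=
    (integrable_map_measure (by fun_prop) hY.aemeasurable).2 hYr
  refine integral_mono hUr hI fun o => ?_
  set u := U o
  have hua : Integrable (fun y => |u + y|) (μ.map Y) := ((integrable_const u).add hνi).abs
  have hur : Integrable (fun y => |u + y| ^ r) (μ.map Y) := by
    refine (((integrable_const (|u| ^ r)).add hνr).const_mul (2 ^ r)).mono' (by fun_prop)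
      (Eventually.of_forall fun y => ?_)
    rw [Real.norm_of_nonneg (by positivity)]
    exact (Real.rpow_le_rpow (abs_nonneg _) (abs_add_le u y) hr0).trans
      (add_rpow_le (abs_nonneg _) (abs_nonneg _) hr0)
  have h1 : |u| ≤ ∫ y, |u + y| ∂(μ.map Y) := by
    have e : u = ∫ y, (u + y) ∂(μ.map Y) := by
      rw [integral_add (integrable_const u) hνi, hν0]; simp
    conv_lhs => rw [e]
    exact abs_integral_le_integral_abs
  have h2 := (convexOn_rpow hr).map_integral_le (μ := μ.map Y) (f := fun y => |u + y|)
    (Real.continuous_rpow_const hr0).continuousOn isClosed_Ici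
    (Eventually.of_forall fun y => mem_Ici.2 (abs_nonneg _)) hua hur
  exact (Real.rpow_le_rpow (abs_nonneg _) h1 hr0).trans h2

end Indep

namespace IsMatchedArray

set_option linter.unusedSectionVars false

variable {Ω : Type*} [MeasurableSpace Ω] {μ : Measure Ω} [IsProbabilityMeasure μ]
  {d p : ℕ} {n : Fin d → ℕ} {X : (j : Fin d) → Fin (n j) → Ω → ℝ}

theorem measurable_normSum (hX : IsMatchedArray μ p X) : Measurable (normSum X) := by
  refine measurable_pi_iff.2 fun k => ?_
  unfold normSum
  exact (Finset.measurable_sum _ fun i _ => hX.measurable k i).div_const _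

/-- The normalised sums without the variable `X j i`. -/
noncomputable def restSum (X : (j : Fin d) → Fin (n j) → Ω → ℝ) (j : Fin d) (i : Fin (n j))
    (o : Ω) (k : Fin d) : ℝ :=
  (∑ i', if (⟨k, i'⟩ : Σ j : Fin d, Fin (n j)) = ⟨j, i⟩ then 0 else X k i' o) / √(n k : ℝ)

theorem measurable_restSum (hX : IsMatchedArray μ p X) (j : Fin d) (i : Fin (n j)) :
    Measurable (restSum X j i) := by
  refine measurable_pi_iff.2 fun k => ?_
  unfold restSum
  refine (Finset.measurable_sum _ fun i' _ => ?_).div_const _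
  split_ifs
  · exact measurable_const
  · exact hX.measurable k i'

theorem normSum_eq (X : (j : Fin d) → Fin (n j) → Ω → ℝ) (j : Fin d) (i : Fin (n j)) (o : Ω) :
    normSum X o = restSum X j i o + (1 / √(n j : ℝ) * X j i o) • Pi.single j 1 := by
  funext k
  simp only [normSum, restSum, Pi.add_apply, Pi.smul_apply, smul_eq_mul]
  by_cases hk : k = j
  · subst hk
    rw [Pi.single_eq_same, mul_one, one_div_mul_eq_div, ← add_div]
    congr 1
    rw [← Finset.add_sum_erase _ _ (Finset.mem_univ i),
      ← Finset.add_sum_erase _ (fun i' => if (⟨k, i'⟩ : Σ j : Fin d, Fin (n j)) = ⟨k, i⟩ then 0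
        else X k i' o) (Finset.mem_univ i)]
    rw [if_pos rfl, zero_add, add_comm]
    congr 1
    refine Finset.sum_congr rfl fun i' hi' => ?_
    rw [if_neg]
    intro h
    exact Finset.ne_of_mem_erase hi' (by simpa using h)
  · rw [Pi.single_eq_of_ne hk, mul_zero, add_zero]
    congr 1
    refine Finset.sum_congr rfl fun i' _ => ?_
    rw [if_neg]
    intro h
    exact hk (congrArg Sigma.fst h)

theorem indepFun_restSum (hX : IsMatchedArray μ p X) (j : Fin d) (i : Fin (n j)) :
    IndepFun (restSum X j i) (X j i) μ := by
  classical
  set q : Σ j : Fin d, Fin (n j) := ⟨j, i⟩ with hq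
  set S : Finset (Σ j : Fin d, Fin (n j)) := Finset.univ.erase q with hS
  set T : Finset (Σ j : Fin d, Fin (n j)) := {q} with hT
  have hmem : ∀ q', q' ≠ q → q' ∈ S := fun q' h => by simpa [hS] using h
  have hqT : q ∈ T := by simp [hT]
  have h := hX.indep.indepFun_finset S T (by simp [hS, hT]) (fun q => hX.measurable q.1 q.2)
  let ψ : (S → ℝ) → Fin d → ℝ := fun y k =>
    (∑ i', if hk : (⟨k, i'⟩ : Σ j : Fin d, Fin (n j)) = q then 0
      else y ⟨⟨k, i'⟩, hmem _ hk⟩) / √(n k : ℝ)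
  have hψ : Measurable ψ := by
    refine measurable_pi_iff.2 fun k => (Finset.measurable_sum _ fun i' _ => ?_).div_const _
    by_cases hk : (⟨k, i'⟩ : Σ j : Fin d, Fin (n j)) = q
    · simp only [hk, dif_pos]; exact measurable_const
    · simp only [hk, dif_neg, not_false_iff]; exact measurable_pi_apply _
  let φ : (T → ℝ) → ℝ := fun y => y ⟨q, hqT⟩
  have hφ : Measurable φ := measurable_pi_apply _
  exact h.comp hψ hφ

theorem memLp (hX : IsMatchedArray μ p X) {t : ℝ} (ht : 0 < t) {j : Fin d} {i : Fin (n j)}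
    (h : Integrable (fun o => |X j i o| ^ t) μ) : MemLp (X j i) (ENNReal.ofReal t) μ := by
  rw [← integrable_norm_rpow_iff (hX.measurable j i).aestronglyMeasurable
    (by simpa using ht) ENNReal.ofReal_ne_top, ENNReal.toReal_ofReal ht.le]
  exact h

theorem _root_.MeasureTheory.MemLp.integrable_abs_rpow {f : Ω → ℝ} (hf : Measurable f) {t s : ℝ}
    (ht : 0 < t) (h : MemLp f (ENNReal.ofReal t) μ) (hs : 0 ≤ s) (hst : s ≤ t) :
    Integrable (fun o => |f o| ^ s) μ := by
  have h1 := h.integrable_norm_rpow (by simpa using ht) ENNReal.ofReal_ne_top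
  rw [ENNReal.toReal_ofReal ht.le] at h1
  exact Integrable.abs_rpow_mono hf hs hst h1

theorem memLp_normSum (hX : IsMatchedArray μ p X) {t : ℝ} (ht : 0 < t)
    (h : ∀ j i, Integrable (fun o => |X j i o| ^ t) μ) (k : Fin d) :
    MemLp (fun o => normSum X o k) (ENNReal.ofReal t) μ := by
  simp only [normSum, div_eq_mul_inv]
  exact (memLp_finsetSum _ fun i _ => hX.memLp ht (h k i)).mul_const _

theorem memLp_restSum (hX : IsMatchedArray μ p X) {t : ℝ} (ht : 0 < t)
    (h : ∀ j i, Integrable (fun o => |X j i o| ^ t) μ) (j : Fin d) (i : Fin (n j)) (k : Fin d) :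
    MemLp (fun o => restSum X j i o k) (ENNReal.ofReal t) μ := by
  have h1 : ∀ i', MemLp (fun o => if (⟨k, i'⟩ : Σ j : Fin d, Fin (n j)) = ⟨j, i⟩ then 0
      else X k i' o) (ENNReal.ofReal t) μ := fun i' => by
    split_ifs
    · exact MemLp.zero'
    · exact hX.memLp ht (h k i')
  simp only [restSum, div_eq_mul_inv]
  exact (memLp_finsetSum Finset.univ fun i' _ => h1 i').mul_const _

theorem integral_eq_zero (hX : IsMatchedArray μ p X) (hp : 1 ≤ p) (j : Fin d) (i : Fin (n j)) :
    ∫ o, X j i o ∂μ = 0 := by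
  have := hX.moments j i 1 le_rfl hp
  simp only [pow_one] at this
  rw [this]
  exact integral_id_gaussianReal

theorem integral_normSum_sq (hX : IsMatchedArray μ p X) (hp : 1 ≤ p) (hn : ∀ j, 1 ≤ n j)
    (k : Fin d) : ∫ o, normSum X o k ^ 2 ∂μ = 1 := by
  have hm : ∀ i, MemLp (X k i) 2 μ := fun i => by
    refine (memLp_two_iff_integrable_sq (hX.measurable k i).aestronglyMeasurable).2 ?_
    by_contra h
    have := hX.variance k i
    rw [integral_undef h] at this
    exact zero_ne_one this
  have hnk : (0 : ℝ) < n k := by exact_mod_cast hn k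
  have hvar : ∀ i, ProbabilityTheory.variance (X k i) μ = 1 := fun i => by
    rw [variance_of_integral_eq_zero (hX.measurable k i).aemeasurable
      (hX.integral_eq_zero hp k i)]
    exact hX.variance k i
  have hinj : Function.Injective (fun i : Fin (n k) => (⟨k, i⟩ : Σ j : Fin d, Fin (n j))) :=
    fun a b hab => by simpa using hab
  have hind := hX.indep.precomp hinj
  have h1 : ProbabilityTheory.variance (∑ i, X k i) μ = n k := by
    rw [IndepFun.variance_sum (fun i _ => hm i) fun i _ j _ hij => hind.indepFun hij]
    simp [hvar]
  have h0 : ∫ o, (∑ i, X k i) o ∂μ = 0 := by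
    simp only [Finset.sum_apply]
    rw [integral_finsetSum _ fun i _ => (hm i).integrable one_le_two]
    exact Finset.sum_eq_zero fun i _ => hX.integral_eq_zero hp k i
  have hsm : Measurable (∑ i, X k i) := by
    have : (∑ i, X k i) = fun o => ∑ i, X k i o := by funext o; simp
    rw [this]
    exact Finset.measurable_sum _ fun i _ => hX.measurable k i
  rw [variance_of_integral_eq_zero hsm.aemeasurable h0] at h1
  simp only [normSum, div_pow, Real.sq_sqrt hnk.le]
  rw [integral_div]
  simp only [Finset.sum_apply] at h1
  rw [h1, div_self hnk.ne']

/-- `W_k` is the reduced sum plus an independent centred term (zero when `k ≠ j`), so convexity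
applies. It needs `s ≥ 1`, whence the separate treatment of small exponents. -/
theorem integral_restSum_rpow_le (hX : IsMatchedArray μ p X) (hp : 1 ≤ p) {t : ℝ}
    (h : ∀ j i, Integrable (fun o => |X j i o| ^ t) μ) (j : Fin d) (i : Fin (n j)) (k : Fin d)
    {s : ℝ} (hs : 1 ≤ s) (hst : s ≤ t) :
    ∫ o, |restSum X j i o k| ^ s ∂μ ≤ ∫ o, |normSum X o k| ^ s ∂μ := by
  have ht : 0 < t := by linarith
  set a : ℝ := 1 / √(n j : ℝ) * (Pi.single j 1 : Fin d → ℝ) k with ha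
  have e : ∀ o, normSum X o k = restSum X j i o k + a * X j i o := fun o => by
    rw [normSum_eq X j i o]
    simp only [Pi.add_apply, Pi.smul_apply, smul_eq_mul, ha]
    ring
  have hYL : MemLp (fun o => a * X j i o) (ENNReal.ofReal t) μ := (hX.memLp ht (h j i)).const_mul a
  have hYm : Measurable fun o => a * X j i o := (hX.measurable j i).const_mul a
  have hUm : Measurable fun o => restSum X j i o k :=
    (measurable_pi_apply k).comp (hX.measurable_restSum j i)
  have hWm : Measurable fun o => normSum X o k :=
    (measurable_pi_apply k).comp hX.measurable_normSum
  have hW := (hX.memLp_normSum ht h k).integrable_abs_rpow hWm ht (by linarith : 0 ≤ s) hst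
  simp only [e] at hW ⊢
  refine integral_abs_rpow_le_of_indep ?_ hUm hYm ?_ ?_ hs
    ((hX.memLp_restSum ht h j i k).integrable_abs_rpow hUm ht (by linarith) hst)
    (hYL.integrable_abs_rpow hYm ht (by linarith) hst) hW
  · exact (hX.indepFun_restSum j i).comp (φ := fun v : Fin d → ℝ => v k) (ψ := fun x => a * x)
      (measurable_pi_apply k) (by fun_prop)
  · exact hYL.integrable (by
      rw [← ENNReal.ofReal_one]; exact ENNReal.ofReal_le_ofReal (by linarith))
  · rw [integral_const_mul, hX.integral_eq_zero hp, mul_zero]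

end IsMatchedArray

end

section

open scoped Topology
open Filter Set

/-! ### Interpolation -/

section Path

variable {d : ℕ} {Q : ℝ} {φ : (Fin d → ℝ) → ℝ}

theorem fderiv_apply_eq_sum_partialD (φ : (Fin d → ℝ) → ℝ) (y v : Fin d → ℝ) :
    fderiv ℝ φ y v = ∑ j, partialD j φ y * v j := by
  have h : v = ∑ j, v j • (Pi.single j 1 : Fin d → ℝ) := by
    conv_lhs => rw [← Finset.univ_sum_single v]
    refine Finset.sum_congr rfl fun j _ => ?_
    rw [← Pi.single_smul, smul_eq_mul, mul_one]
  conv_lhs => rw [h]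
  rw [map_sum]
  refine Finset.sum_congr rfl fun j _ => ?_
  rw [map_smul, smul_eq_mul, mul_comm, partialD]

/-- The derivative of `φ (cos a • w + sin a • z)` with respect to `a`. -/
noncomputable def pathDeriv (φ : (Fin d → ℝ) → ℝ) (a : ℝ) (w z : Fin d → ℝ) : ℝ :=
  ∑ j, partialD j φ (Real.cos a • w + Real.sin a • z) * (-Real.sin a * w j + Real.cos a * z j)

theorem hasDerivAt_path (hφ : SmoothGrowth Q φ) (w z : Fin d → ℝ) (a : ℝ) :
    HasDerivAt (fun a => φ (Real.cos a • w + Real.sin a • z)) (pathDeriv φ a w z) a := by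
  have h1 : HasDerivAt (fun a => Real.cos a • w + Real.sin a • z)
      (-Real.sin a • w + Real.cos a • z) a :=
    ((Real.hasDerivAt_cos a).smul_const w).add ((Real.hasDerivAt_sin a).smul_const z)
  have h2 := ((hφ.contDiff.differentiable (by simp))
    (Real.cos a • w + Real.sin a • z)).hasFDerivAt.comp_hasDerivAt a h1
  rw [fderiv_apply_eq_sum_partialD] at h2
  exact h2

theorem continuous_pathDeriv (hφ : SmoothGrowth Q φ) :
    Continuous fun q : ℝ × (Fin d → ℝ) × (Fin d → ℝ) => pathDeriv φ q.1 q.2.1 q.2.2 := by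
  have := fun j => (hφ.contDiff.partialD j).continuous
  unfold pathDeriv
  fun_prop

theorem sub_eq_integral_pathDeriv (hφ : SmoothGrowth Q φ) (w z : Fin d → ℝ) :
    φ z - φ w = ∫ a in (0 : ℝ)..(Real.pi / 2), pathDeriv φ a w z := by
  have hc : Continuous fun a => pathDeriv φ a w z := by
    have := fun j => (hφ.contDiff.partialD j).continuous
    unfold pathDeriv
    fun_prop
  rw [intervalIntegral.integral_eq_sub_of_hasDerivAt (fun a _ => hasDerivAt_path hφ w z a)
    (hc.intervalIntegrable _ _)]
  simp

theorem abs_partialD_le (hφ : SmoothGrowth Q φ) (hQ : 0 ≤ Q) (j : Fin d) :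
    ∃ K, 0 ≤ K ∧ ∀ c s : ℝ, |c| ≤ 1 → |s| ≤ 1 → ∀ w z,
      |partialD j φ (c • w + s • z)| ≤ K * ((1 + ‖w‖) ^ Q * (1 + ‖z‖) ^ Q) := by
  obtain ⟨K, hK, hf⟩ := hφ.growth j 1
  refine ⟨K, hK, fun c s hc hs w z => (hf _).trans (mul_le_mul_of_nonneg_left ?_ hK)⟩
  rw [← Real.mul_rpow (by positivity) (by positivity)]
  refine Real.rpow_le_rpow (by positivity) ?_ hQ
  have h := norm_add_le (c • w) (s • z)
  rw [norm_smul, norm_smul, Real.norm_eq_abs, Real.norm_eq_abs] at h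
  nlinarith [norm_nonneg w, norm_nonneg z, mul_nonneg (norm_nonneg w) (norm_nonneg z),
    mul_le_mul_of_nonneg_right hc (norm_nonneg w), mul_le_mul_of_nonneg_right hs (norm_nonneg z)]

theorem abs_pathDeriv_le (hφ : SmoothGrowth Q φ) (hQ : 0 ≤ Q) :
    ∃ K, 0 ≤ K ∧ ∀ a w z,
      |pathDeriv φ a w z| ≤ K * ((1 + ‖w‖) ^ (Q + 1) * (1 + ‖z‖) ^ (Q + 1)) := by
  choose K hK hf using fun j => abs_partialD_le hφ hQ j
  refine ⟨∑ j, K j, Finset.sum_nonneg fun j _ => hK j, fun a w z => ?_⟩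
  rw [Finset.sum_mul]
  refine (Finset.abs_sum_le_sum_abs _ _).trans (Finset.sum_le_sum fun j _ => ?_)
  have h1 := hf j _ _ (Real.abs_cos_le_one a) (Real.abs_sin_le_one a) w z
  have h2 : |-Real.sin a * w j + Real.cos a * z j| ≤ (1 + ‖w‖) * (1 + ‖z‖) := by
    have h3 := abs_add_le (-Real.sin a * w j) (Real.cos a * z j)
    rw [abs_mul, abs_mul, abs_neg] at h3
    have h4 : |w j| ≤ ‖w‖ := norm_le_pi_norm w j
    have h5 : |z j| ≤ ‖z‖ := norm_le_pi_norm z j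
    have h6 := mul_le_of_le_one_left (abs_nonneg (w j)) (Real.abs_sin_le_one a)
    have h7 := mul_le_of_le_one_left (abs_nonneg (z j)) (Real.abs_cos_le_one a)
    nlinarith [mul_nonneg (norm_nonneg w) (norm_nonneg z)]
  rw [abs_mul]
  refine (mul_le_mul h1 h2 (abs_nonneg _)
    (mul_nonneg (hK j) (by positivity))).trans_eq ?_
  rw [Real.rpow_add (by positivity), Real.rpow_add (by positivity), Real.rpow_one, Real.rpow_one]
  ring

end Path

section Smooth

variable {Ω : Type*} [MeasurableSpace Ω] {μ : Measure Ω} [IsProbabilityMeasure μ]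
  {d p : ℕ} {n : Fin d → ℕ} {X : (j : Fin d) → Fin (n j) → Ω → ℝ} {A B H Q : ℝ} {r : Fin d → ℝ}
  {φ : (Fin d → ℝ) → ℝ}

theorem IsMatchedArray.integrable_one_add_norm_normSum (hX : IsMatchedArray μ p X) {t s : ℝ}
    (ht : 0 < t) (h : ∀ j i, Integrable (fun o => |X j i o| ^ t) μ) (hs : 0 ≤ s) (hst : s ≤ t) :
    Integrable (fun o => (1 + ‖normSum X o‖) ^ s) μ :=
  integrable_one_add_norm_rpow hX.measurable_normSum hs fun k =>
    (hX.memLp_normSum ht h k).integrable_abs_rpow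
      ((measurable_pi_apply k).comp hX.measurable_normSum) ht hs hst

/-- `X_ij` and `W` are dependent, so their product is dominated by separate moments of the same
total order. -/
theorem mul_rpow_le_add_rpow {x y Q : ℝ} (hx : 0 < x) (hy : 0 < y) (hQ : 0 ≤ Q) :
    x * y ^ Q ≤ x ^ (Q + 1) + y ^ (Q + 1) := by
  rw [Real.rpow_add hx, Real.rpow_add hy, Real.rpow_one, Real.rpow_one]
  rcases le_total x y with h | h
  · have : x * y ^ Q ≤ y * y ^ Q := by gcongr
    have h2 : 0 ≤ x ^ Q * x := by positivity
    linarith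
  · have : x * y ^ Q ≤ x * x ^ Q := by gcongr
    have h2 : 0 ≤ y ^ Q * y := by positivity
    linarith

theorem IsMatchedArray.integrable_term (hX : IsMatchedArray μ p X) (hQ : 0 ≤ Q)
    (hφ : SmoothGrowth Q φ) {t : ℝ} (hQt : Q + 1 ≤ t)
    (h : ∀ j i, Integrable (fun o => |X j i o| ^ t) μ) (j : Fin d) (i : Fin (n j)) {c s : ℝ}
    (hc : |c| ≤ 1) (hs : |s| ≤ 1) (b₁ b₂ : ℝ) :
    Integrable (fun q : Ω × (Fin d → ℝ) => partialD j φ (c • normSum X q.1 + s • q.2) *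
      (b₁ * X j i q.1 + b₂ * q.2 j)) (μ.prod (stdNormal d)) := by
  have ht : 0 < t := by linarith
  obtain ⟨K, hK, hf⟩ := abs_partialD_le hφ hQ j
  have hD := (hφ.contDiff.partialD j).continuous.measurable
  have hW := hX.measurable_normSum
  have hXm := hX.measurable j i
  have h1 := hX.integrable_one_add_norm_normSum ht h (by linarith : 0 ≤ Q + 1) hQt
  have h2 : Integrable (fun o => (1 + |X j i o|) ^ (Q + 1)) μ := by
    refine (((integrable_const (1 : ℝ)).add
      (Integrable.abs_rpow_mono hXm (by linarith) hQt (h j i))).const_mul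
      (2 ^ (Q + 1))).mono' (by fun_prop : Measurable fun o => (1 + |X j i o|) ^ (Q + 1)
      ).aestronglyMeasurable (Eventually.of_forall fun o => ?_)
    rw [Real.norm_of_nonneg (by positivity)]
    exact one_add_rpow_le (abs_nonneg _) (by linarith)
  have h3 := ((h2.add h1).mul_prod (integrable_one_add_norm_rpow_stdNormal (d := d)
    (s := Q + 1) (by linarith))).const_mul (K * (|b₁| + |b₂|))
  refine h3.mono' ?_ (Eventually.of_forall fun q => ?_)
  · refine Measurable.aestronglyMeasurable ?_
    have hW' : Measurable fun q : Ω × (Fin d → ℝ) => normSum X q.1 := hW.comp measurable_fst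
    have hX' : Measurable fun q : Ω × (Fin d → ℝ) => X j i q.1 := hXm.comp measurable_fst
    have hz : Measurable fun q : Ω × (Fin d → ℝ) => q.2 j :=
      (measurable_pi_apply j).comp measurable_snd
    exact (hD.comp ((hW'.const_smul c).add (measurable_snd.const_smul s))).mul
      ((hX'.const_mul b₁).add (hz.const_mul b₂))
  · have h4 := hf c s hc hs (normSum X q.1) q.2
    have h5 : |b₁ * X j i q.1 + b₂ * q.2 j| ≤
        (|b₁| + |b₂|) * ((1 + |X j i q.1|) * (1 + ‖q.2‖)) := by
      have h6 := abs_add_le (b₁ * X j i q.1) (b₂ * q.2 j)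
      rw [abs_mul, abs_mul] at h6
      have h7 : |X j i q.1| ≤ (1 + |X j i q.1|) * (1 + ‖q.2‖) := by
        nlinarith [abs_nonneg (X j i q.1), norm_nonneg q.2]
      have h8 : |q.2 j| ≤ (1 + |X j i q.1|) * (1 + ‖q.2‖) := by
        have : |q.2 j| ≤ ‖q.2‖ := norm_le_pi_norm q.2 j
        nlinarith [abs_nonneg (X j i q.1), norm_nonneg q.2]
      have h9 := mul_le_mul_of_nonneg_left h7 (abs_nonneg b₁)
      have h10 := mul_le_mul_of_nonneg_left h8 (abs_nonneg b₂)
      linarith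
    have h11 := mul_rpow_le_add_rpow (x := 1 + |X j i q.1|) (y := 1 + ‖normSum X q.1‖)
      (by positivity) (by positivity) hQ
    rw [Real.norm_eq_abs, abs_mul]
    refine (mul_le_mul h4 h5 (abs_nonneg _) (mul_nonneg hK (by positivity))).trans ?_
    simp only [Pi.add_apply]
    have e : (1 + ‖q.2‖) ^ (Q + 1) = (1 + ‖q.2‖) ^ Q * (1 + ‖q.2‖) := by
      rw [Real.rpow_add (by positivity), Real.rpow_one]
    rw [e]
    calc K * ((1 + ‖normSum X q.1‖) ^ Q * (1 + ‖q.2‖) ^ Q) *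
          ((|b₁| + |b₂|) * ((1 + |X j i q.1|) * (1 + ‖q.2‖)))
        = K * (|b₁| + |b₂|) * (((1 + |X j i q.1|) * (1 + ‖normSum X q.1‖) ^ Q) *
            ((1 + ‖q.2‖) ^ Q * (1 + ‖q.2‖))) := by ring
      _ ≤ _ := by gcongr

theorem one_div_sqrt_pow {m : ℝ} (hm : 0 < m) (k : ℕ) :
    (1 / √m) ^ k = 1 / m ^ ((k : ℝ) / 2) := by
  rw [div_pow, one_pow, Real.sqrt_eq_rpow, ← Real.rpow_natCast, ← Real.rpow_mul hm.le]
  congr 2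
  ring

theorem one_div_sqrt_rpow {m : ℝ} (hm : 0 < m) (t : ℝ) :
    (1 / √m) ^ t = 1 / m ^ (t / 2) := by
  rw [Real.div_rpow zero_le_one (Real.sqrt_nonneg _), Real.one_rpow, Real.sqrt_eq_rpow,
    ← Real.rpow_mul hm.le]
  congr 2
  ring

/-- The contribution of one variable. -/
theorem IsMatchedArray.abs_integral_term_le (hX : IsMatchedArray μ p X) (hp : 1 ≤ p)
    (hn : ∀ j, 1 ≤ n j) (hA : 0 ≤ A) (hB : 0 ≤ B) (hr : ∀ l, 0 ≤ r l) (hQ : 0 ≤ Q)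
    (hφ : SmoothGrowth Q φ) (hH : 0 ≤ H)
    (hφP : ∀ j w, |(partialD j)^[p] φ w| ≤ H * polyDom A B r w)
    (h : ∀ l j i, Integrable (fun o => |X j i o| ^ (r l + p + 1)) μ) {l₀ : Fin d}
    (hQt : Q + 1 ≤ r l₀ + p + 1) (j : Fin d) (i : Fin (n j)) {c s : ℝ} (hc : 0 ≤ c) (hs : 0 < s)
    (hcs : c ^ 2 + s ^ 2 = 1) :
    |∫ o, ∫ z, partialD j φ (c • normSum X o + s • z) *
        (-(s * (1 / √(n j : ℝ))) * X j i o + c * (1 / √(n j : ℝ)) ^ 2 * z j)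
        ∂(stdNormal d) ∂μ| ≤
      c ^ p * (H * (((p : ℝ) + 1) / p.factorial) * (1 / (n j : ℝ) ^ (((p : ℝ) + 1) / 2) *
        (A * ∫ o, |X j i o| ^ (p + 1) ∂μ +
          B * ∑ k : Fin d, (2 : ℝ) ^ r k *
            ((2 : ℝ) ^ r k * (∫ o, |X j i o| ^ (p + 1) ∂μ) * (∫ o, |normSum X o k| ^ r k ∂μ) +
              (2 : ℝ) ^ r k / (n j : ℝ) ^ (r k / 2) * (∫ o, |X j i o| ^ (r k + p + 1) ∂μ) +
              absMomentZ (r k + 1) * ∫ o, |X j i o| ^ (p + 1) ∂μ)))) := by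
  have hc1 : c ≤ 1 := by nlinarith
  have hs1 : s ≤ 1 := by nlinarith
  have hp1 : (1 : ℝ) ≤ p := by exact_mod_cast hp
  have hnj : (0 : ℝ) < n j := by exact_mod_cast hn j
  set b : ℝ := 1 / √(n j : ℝ) with hb
  have hb0 : 0 ≤ b := by positivity
  have hXm := hX.measurable j i
  set ν := μ.map (X j i) with hν
  have : IsProbabilityMeasure ν := Measure.isProbabilityMeasure_map hXm.aemeasurable
  have hDc := (hφ.contDiff.partialD j).continuous
  -- `Z` is integrated out for a frozen value `u` of the reduced sums and `x` of the variable;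
  -- independence then allows `x` to be integrated first.
  let g : (Fin d → ℝ) → ℝ → ℝ := fun u x =>
    ∫ z, partialD j φ (c • (u + (b * x) • Pi.single j 1) + s • z) *
        (-(s * b * x) + c * b ^ 2 * z j) ∂(stdNormal d)
  have hg : Measurable (Function.uncurry g) := by
    have hcont : Continuous fun q : ((Fin d → ℝ) × ℝ) × (Fin d → ℝ) =>
        partialD j φ (c • (q.1.1 + (b * q.1.2) • Pi.single j 1) + s • q.2) *
        (-(s * b * q.1.2) + c * b ^ 2 * q.2 j) := by fun_prop
    exact (hcont.stronglyMeasurable.integral_prod_right' (ν := stdNormal d)).measurable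
  have hgo : ∀ o, g (IsMatchedArray.restSum X j i o) (X j i o) =
      ∫ z, partialD j φ (c • normSum X o + s • z) *
        (-(s * b) * X j i o + c * b ^ 2 * z j) ∂(stdNormal d) := by
    intro o
    simp only [g, normSum_eq X j i o, hb, neg_mul]
  have hint := hX.integrable_term hQ hφ hQt (h l₀) j i (c := c) (s := s)
    (by rw [abs_of_nonneg hc]; exact hc1) (by rw [abs_of_pos hs]; exact hs1)
    (-(s * b)) (c * b ^ 2)
  have hgi : Integrable (fun o => g (IsMatchedArray.restSum X j i o) (X j i o)) μ := by
    simp only [hgo]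
    exact hint.integral_prod_left
  obtain ⟨hI, he⟩ := (hX.indepFun_restSum j i).integral_eq_integral_integral
    (hX.measurable_restSum j i) hXm hg hgi
  have hmap : ∀ f : ℝ → ℝ, Measurable f → ∫ x, f x ∂ν = ∫ o, f (X j i o) ∂μ := fun f hf =>
    integral_map hXm.aemeasurable hf.aestronglyMeasurable
  have key : ∀ o, |∫ x, g (IsMatchedArray.restSum X j i o) x ∂ν| ≤
      b ^ (p + 1) * c ^ p * (H * (((p : ℝ) + 1) / p.factorial)) *
        ((∫ x, |x| ^ (p + 1) ∂ν) *
          (A + B * ∑ k, weightV (r k) c s (IsMatchedArray.restSum X j i o k)) +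
          B * ∑ k, 2 ^ r k * 2 ^ r k * b ^ r k * ∫ x, |x| ^ (r k + p + 1) ∂ν) := fun o =>
    hφ.abs_integral_term_le hp hA hB hr hQ hH (hφP j)
      (fun k => (integrable_map_measure (by fun_prop : Measurable
        fun x : ℝ => |x| ^ (r k + p + 1)).aestronglyMeasurable hXm.aemeasurable).2 (h k j i))
      (fun k hk hk' => by rw [hmap _ (by fun_prop)]; exact hX.moments j i k hk hk')
      (by rw [hmap _ (by fun_prop)]; exact hX.variance j i) hb0 hc hc1 hs hs1 _
  have hV : ∀ k, Integrable (fun o => weightV (r k) c s (IsMatchedArray.restSum X j i o k)) μ ∧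
      ∫ o, weightV (r k) c s (IsMatchedArray.restSum X j i o k) ∂μ ≤
        2 ^ r k * (2 ^ r k * ∫ o, |normSum X o k| ^ r k ∂μ + absMomentZ (r k + 1)) := by
    intro k
    have htk : 0 < r k + p + 1 := by linarith [hr k]
    have hUm : Measurable fun o => IsMatchedArray.restSum X j i o k :=
      (measurable_pi_apply k).comp (hX.measurable_restSum j i)
    have hL := hX.memLp_restSum htk (h k) j i k
    have h2 : (2 : ℝ) ≤ r k + p + 1 := by linarith [hr k]
    refine integral_weightV_le (hr k) hcs (integral_nonneg fun o => by positivity) ?_ ?_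
      (hL.integrable_abs_rpow hUm htk (hr k) (by linarith))
      (fun h1 => hX.integral_restSum_rpow_le hp (h k) j i k h1 (by linarith))
    · have := hL.integrable_abs_rpow hUm htk (s := 2) (by norm_num) h2
      simpa only [Real.rpow_two, sq_abs] using this
    · have := hX.integral_restSum_rpow_le hp (h k) j i k (s := 2) (by norm_num) h2
      simp only [Real.rpow_two, sq_abs] at this
      rwa [hX.integral_normSum_sq hp hn k] at this
  set M := ∫ x, |x| ^ (p + 1) ∂ν with hM
  have hM0 : 0 ≤ M := integral_nonneg fun x => by positivity
  set C := b ^ (p + 1) * c ^ p * (H * (((p : ℝ) + 1) / p.factorial)) with hC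
  have hC0 : 0 ≤ C := by positivity
  have hVi : Integrable (fun o => M * (A + B * ∑ k,
      weightV (r k) c s (IsMatchedArray.restSum X j i o k))) μ :=
    ((integrable_const A).add
      ((integrable_finsetSum _ fun k _ => (hV k).1).const_mul B)).const_mul M
  have hbi : Integrable (fun o => C * (M * (A + B * ∑ k,
      weightV (r k) c s (IsMatchedArray.restSum X j i o k)) +
      B * ∑ k, 2 ^ r k * 2 ^ r k * b ^ r k * ∫ x, |x| ^ (r k + p + 1) ∂ν)) μ :=
    (hVi.add (integrable_const _)).const_mul C
  simp only [← hgo]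
  rw [he]
  refine (norm_integral_le_of_norm_le
    (f := fun o => ∫ x, g (IsMatchedArray.restSum X j i o) x ∂ν) hbi (Eventually.of_forall key)).trans ?_
  rw [integral_const_mul, integral_add hVi (integrable_const _), integral_const_mul,
    integral_add (integrable_const A) ((integrable_finsetSum _ fun k _ => (hV k).1).const_mul B),
    integral_const_mul, integral_finsetSum _ fun k _ => (hV k).1]
  simp only [integral_const, probReal_univ, one_smul]
  have hsum := Finset.sum_le_sum fun k (_ : k ∈ Finset.univ) => (hV k).2
  have h1 : C * (M * (A + B * ∑ k, ∫ o, weightV (r k) c s (IsMatchedArray.restSum X j i o k) ∂μ) +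
      B * ∑ k, 2 ^ r k * 2 ^ r k * b ^ r k * ∫ x, |x| ^ (r k + p + 1) ∂ν) ≤
      C * (M * (A + B * ∑ k, 2 ^ r k * (2 ^ r k * ∫ o, |normSum X o k| ^ r k ∂μ +
        absMomentZ (r k + 1))) +
      B * ∑ k, 2 ^ r k * 2 ^ r k * b ^ r k * ∫ x, |x| ^ (r k + p + 1) ∂ν) := by
    gcongr
  refine h1.trans_eq ?_
  have hMe : M = ∫ o, |X j i o| ^ (p + 1) ∂μ := hmap (fun x => |x| ^ (p + 1)) (by fun_prop)
  have hMk : ∀ k, ∫ x, |x| ^ (r k + p + 1) ∂ν = ∫ o, |X j i o| ^ (r k + p + 1) ∂μ := fun k =>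
    hmap (fun x => |x| ^ (r k + p + 1)) (by fun_prop)
  have hbp : b ^ (p + 1) = 1 / (n j : ℝ) ^ (((p : ℝ) + 1) / 2) := by
    rw [hb, one_div_sqrt_pow hnj]; push_cast; rfl
  have hbr : ∀ k, b ^ r k = 1 / (n j : ℝ) ^ (r k / 2) := fun k => one_div_sqrt_rpow hnj _
  simp only [hMk, hbr]
  rw [hC, hbp, hMe]
  have e2 : ∀ k, (2 : ℝ) ^ r k *
            ((2 : ℝ) ^ r k * (∫ o, |X j i o| ^ (p + 1) ∂μ) * (∫ o, |normSum X o k| ^ r k ∂μ) +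
              (2 : ℝ) ^ r k / (n j : ℝ) ^ (r k / 2) * (∫ o, |X j i o| ^ (r k + p + 1) ∂μ) +
              absMomentZ (r k + 1) * ∫ o, |X j i o| ^ (p + 1) ∂μ) =
      (∫ o, |X j i o| ^ (p + 1) ∂μ) * (2 ^ r k * (2 ^ r k * ∫ o, |normSum X o k| ^ r k ∂μ +
        absMomentZ (r k + 1))) +
      2 ^ r k * 2 ^ r k * (1 / (n j : ℝ) ^ (r k / 2)) *
        ∫ o, |X j i o| ^ (r k + p + 1) ∂μ := fun k => by ring
  simp only [e2, Finset.sum_add_distrib, ← Finset.mul_sum]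
  ring

end Smooth

end

section

open scoped Topology
open Filter Set

/-! ### The bound for smooth test functions -/

/-- `cos a • z j` is cut into `n j` equal parts, one for each variable, so that every summand is a
Stein expression with step `1 / √n_j`. -/
theorem pathDeriv_normSum_eq {Ω : Type*} {d : ℕ} {n : Fin d → ℕ} (φ : (Fin d → ℝ) → ℝ)
    (hn : ∀ j, 1 ≤ n j)
    (X : (j : Fin d) → Fin (n j) → Ω → ℝ) (a : ℝ) (o : Ω) (z : Fin d → ℝ) :
    pathDeriv φ a (normSum X o) z = ∑ j, ∑ i,
      partialD j φ (Real.cos a • normSum X o + Real.sin a • z) *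
        (-(Real.sin a * (1 / √(n j : ℝ))) * X j i o +
          Real.cos a * (1 / √(n j : ℝ)) ^ 2 * z j) := by
  unfold pathDeriv
  refine Finset.sum_congr rfl fun j _ => ?_
  have hnj : (0 : ℝ) < n j := by exact_mod_cast hn j
  rw [← Finset.mul_sum, Finset.sum_add_distrib, ← Finset.mul_sum]
  congr 1
  simp only [Finset.sum_const, Finset.card_univ, Fintype.card_fin, nsmul_eq_mul, normSum]
  rw [div_pow, Real.sq_sqrt hnj.le]
  field_simp

section SmoothBound

set_option linter.unusedSectionVars false

variable {Ω : Type*} [MeasurableSpace Ω] {μ : Measure Ω} [IsProbabilityMeasure μ]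
  {d p : ℕ} {n : Fin d → ℕ} {X : (j : Fin d) → Fin (n j) → Ω → ℝ} {A B H Q : ℝ} {r : Fin d → ℝ}
  {φ : (Fin d → ℝ) → ℝ}

theorem IsMatchedArray.integrable_comp_normSum (hX : IsMatchedArray μ p X) {t s K : ℝ}
    (hφ : Continuous φ) (hs : 0 ≤ s) (hφK : ∀ w, |φ w| ≤ K * (1 + ‖w‖) ^ s) (ht : 0 < t)
    (hst : s ≤ t) (h : ∀ j i, Integrable (fun o => |X j i o| ^ t) μ) :
    Integrable (fun o => φ (normSum X o)) μ :=
  ((hX.integrable_one_add_norm_normSum ht h hs hst).const_mul K).mono'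
    (hφ.measurable.comp hX.measurable_normSum).aestronglyMeasurable
    (Eventually.of_forall fun _ => hφK _)

theorem integrable_stdNormal_of_le {s K : ℝ} (hφ : Continuous φ) (hs : 0 ≤ s)
    (hφK : ∀ w, |φ w| ≤ K * (1 + ‖w‖) ^ s) : Integrable φ (stdNormal d) :=
  ((integrable_one_add_norm_rpow_stdNormal hs).const_mul K).mono'
    hφ.measurable.aestronglyMeasurable (Eventually.of_forall fun _ => hφK _)

theorem IsMatchedArray.abs_integral_pathDeriv_le (hX : IsMatchedArray μ p X) (hp : 1 ≤ p)
    (hn : ∀ j, 1 ≤ n j) (hA : 0 ≤ A) (hB : 0 ≤ B) (hr : ∀ l, 0 ≤ r l) (hQ : 0 ≤ Q)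
    (hφ : SmoothGrowth Q φ) (hH : 0 ≤ H)
    (hφP : ∀ j w, |(partialD j)^[p] φ w| ≤ H * polyDom A B r w)
    (h : ∀ l j i, Integrable (fun o => |X j i o| ^ (r l + p + 1)) μ) {l₀ : Fin d}
    (hQt : Q + 1 ≤ r l₀ + p + 1) {a : ℝ} (hc : 0 ≤ Real.cos a) (hs : 0 < Real.sin a) :
    |∫ q, pathDeriv φ a (normSum X q.1) q.2 ∂(μ.prod (stdNormal d))| ≤
      Real.cos a * (((p : ℝ) + 1) / p.factorial * H * boundSum μ p X A B r) := by
  simp only [pathDeriv_normSum_eq φ hn X]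
  have hint := fun j (i : Fin (n j)) => hX.integrable_term hQ hφ hQt (h l₀) j i
    (Real.abs_cos_le_one a) (Real.abs_sin_le_one a)
    (-(Real.sin a * (1 / √(n j : ℝ)))) (Real.cos a * (1 / √(n j : ℝ)) ^ 2)
  rw [integral_finsetSum _ fun j _ => integrable_finsetSum _ fun i _ => hint j i]
  unfold boundSum
  rw [Finset.mul_sum, Finset.mul_sum]
  refine (Finset.abs_sum_le_sum_abs _ _).trans (Finset.sum_le_sum fun j _ => ?_)
  rw [integral_finsetSum _ fun i _ => hint j i, Finset.mul_sum, Finset.mul_sum]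
  refine (Finset.abs_sum_le_sum_abs _ _).trans (Finset.sum_le_sum fun i _ => ?_)
  rw [integral_prod _ (hint j i)]
  have key := hX.abs_integral_term_le hp hn hA hB hr hQ hφ hH hφP h hQt j i hc hs
    (Real.cos_sq_add_sin_sq a)
  refine key.trans ?_
  have h0 := (abs_nonneg _).trans key
  rcases hc.eq_or_lt with hc0 | hc0
  · rw [← hc0, zero_pow (by omega), zero_mul, zero_mul]
  · have hcp : Real.cos a ^ p ≤ Real.cos a :=
      pow_le_of_le_one hc (Real.cos_le_one a) (by omega)
    refine (mul_le_mul_of_nonneg_right hcp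
      (nonneg_of_mul_nonneg_right h0 (by positivity))).trans_eq ?_
    ring

/-- Matching moments: the bound for smooth test functions. -/
theorem IsMatchedArray.abs_integral_sub_le_of_smooth (hX : IsMatchedArray μ p X) (hp : 1 ≤ p)
    (hn : ∀ j, 1 ≤ n j) (hA : 0 ≤ A) (hB : 0 ≤ B) (hr : ∀ l, 0 ≤ r l) (hQ : 0 ≤ Q)
    (hφ : SmoothGrowth Q φ) (hH : 0 ≤ H)
    (hφP : ∀ j w, |(partialD j)^[p] φ w| ≤ H * polyDom A B r w)
    (h : ∀ l j i, Integrable (fun o => |X j i o| ^ (r l + p + 1)) μ) {l₀ : Fin d}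
    (hQt : Q + 1 ≤ r l₀ + p + 1) :
    |∫ o, φ (normSum X o) ∂μ - ∫ z, φ z ∂(stdNormal d)| ≤
      ((p : ℝ) + 1) / p.factorial * H * boundSum μ p X A B r := by
  have ht : 0 < r l₀ + p + 1 := by linarith
  have hφc := hφ.contDiff.continuous
  obtain ⟨K₀, -, hK₀⟩ := hφ.growth l₀ 0
  have hiW : Integrable (fun o => φ (normSum X o)) μ :=
    hX.integrable_comp_normSum hφc hQ hK₀ ht (by linarith) (h l₀)
  have hiZ : Integrable φ (stdNormal d) := integrable_stdNormal_of_le hφc hQ hK₀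
  obtain ⟨K, -, hK⟩ := abs_pathDeriv_le hφ hQ
  have hW := hX.measurable_normSum
  have hint : Integrable
      (Function.uncurry fun a (q : Ω × (Fin d → ℝ)) => pathDeriv φ a (normSum X q.1) q.2)
      ((volume.restrict (uIoc (0 : ℝ) (Real.pi / 2))).prod (μ.prod (stdNormal d))) := by
    have h1 := ((hX.integrable_one_add_norm_normSum ht (h l₀) (by linarith : 0 ≤ Q + 1)
      hQt).mul_prod (integrable_one_add_norm_rpow_stdNormal (d := d)
      (by linarith : 0 ≤ Q + 1))).const_mul K
    have : IsFiniteMeasure (volume.restrict (uIoc (0 : ℝ) (Real.pi / 2))) := by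
      unfold uIoc; infer_instance
    refine ((integrable_const (1 : ℝ) (μ := volume.restrict (uIoc (0 : ℝ) (Real.pi / 2)))).mul_prod
      h1).mono' ?_ (Eventually.of_forall fun q => ?_)
    · exact ((continuous_pathDeriv hφ).measurable.comp (measurable_fst.prodMk
        ((hW.comp (measurable_fst.comp measurable_snd)).prodMk
          (measurable_snd.comp measurable_snd)))).aestronglyMeasurable
    · rw [one_mul]
      exact hK _ _ _
  have e : ∫ z, φ z ∂(stdNormal d) - ∫ o, φ (normSum X o) ∂μ =
      ∫ a in (0 : ℝ)..(Real.pi / 2),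
        ∫ q, pathDeriv φ a (normSum X q.1) q.2 ∂(μ.prod (stdNormal d)) := by
    rw [intervalIntegral_integral_swap hint]
    simp only [← sub_eq_integral_pathDeriv hφ]
    rw [integral_sub (hiZ.comp_snd μ) (hiW.comp_fst (stdNormal d)), integral_fun_snd φ,
      integral_fun_fst fun o => φ (normSum X o)]
    simp
  have hpi := Real.pi_pos
  rw [abs_sub_comm, e, ← Real.norm_eq_abs]
  set D := ((p : ℝ) + 1) / p.factorial * H * boundSum μ p X A B r
  have hD : ∫ a in (0 : ℝ)..(Real.pi / 2), Real.cos a * D = D := by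
    rw [intervalIntegral.integral_mul_const, integral_cos]
    simp
  rw [← hD]
  refine intervalIntegral.norm_integral_le_of_norm_le (by positivity)
    (Eventually.of_forall fun a ha => ?_)
    ((Real.continuous_cos.mul continuous_const).intervalIntegrable _ _)
  exact hX.abs_integral_pathDeriv_le hp hn hA hB hr hQ hφ hH hφP h hQt
    (Real.cos_nonneg_of_neg_pi_div_two_le_of_le (by linarith [ha.1]) ha.2)
    (Real.sin_pos_of_pos_of_lt_pi ha.1 (by linarith [ha.2]))

end SmoothBound

end

section

open scoped Topology
open Filter Set

/-! ### Removing the smoothness -/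

section Limit

variable {Ω : Type*} [MeasurableSpace Ω] {μ : Measure Ω} [IsProbabilityMeasure μ]
  {d p : ℕ} {n : Fin d → ℕ} {X : (j : Fin d) → Fin (n j) → Ω → ℝ} {A B : ℝ} {r : Fin d → ℝ}
  {g : (Fin d → ℝ) → ℝ} {h : ℝ → ℝ}

/-- The bound is affine in `A`, so the `η` added to `A` by the mollification disappears in the
limit. -/
theorem boundSum_add_left (μ : Measure Ω) (p : ℕ) (X : (j : Fin d) → Fin (n j) → Ω → ℝ)
    (A B : ℝ) (r : Fin d → ℝ) (η : ℝ) :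
    boundSum μ p X (A + η) B r = boundSum μ p X A B r + η * boundSum μ p X 1 0 r := by
  unfold boundSum
  simp only [Finset.mul_sum, ← Finset.sum_add_distrib]
  refine Finset.sum_congr rfl fun j _ => Finset.sum_congr rfl fun i _ => ?_
  simp only [zero_mul, Finset.sum_const_zero]
  ring

/-- For fixed `η` the mollification radius `ε` tends to 0, the error being linear in `ε` by the
Lipschitz growth of `h ∘ g`; then `η` tends to 0. -/
theorem IsMatchedArray.abs_integral_sub_le (hX : IsMatchedArray μ p X) (hd : 0 < d) (hp : 1 ≤ p)
    (hn : ∀ j, 1 ≤ n j) (hA : 0 ≤ A) (hB : 0 ≤ B) (hr : ∀ l, 0 ≤ r l)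
    (h' : ∀ l j i, Integrable (fun o => |X j i o| ^ (r l + p + 1)) μ)
    (hg : MemCP p (polyDom A B r) g) (hh : MemCb p h) :
    Integrable (fun o => h (g (normSum X o))) μ ∧
      Integrable (fun z => h (g z)) (stdNormal d) ∧
      |∫ o, h (g (normSum X o)) ∂μ - ∫ z, h (g z) ∂(stdNormal d)| ≤
        ((p : ℝ) + 1) / (p.factorial : ℝ) * hConst p h * boundSum μ p X A B r := by
  have : Nonempty (Fin d) := ⟨⟨0, hd⟩⟩
  obtain ⟨l₀, hl₀⟩ := Finite.exists_max r
  set R := r l₀ with hR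
  have hR0 : 0 ≤ R := hr l₀
  have hp1 : (1 : ℝ) ≤ p := by exact_mod_cast hp
  have ht : 0 < R + p + 1 := by linarith
  set H : ℝ := ⨆ x, |iteratedDeriv 1 h x|
  have hH : 0 ≤ H := MemCb.iSup_nonneg 1
  set φ : (Fin d → ℝ) → ℝ := fun w => h (g w) with hφdef
  set L : ℝ := H * (d * (1 + A + B * d)) with hL
  have hL0 : 0 ≤ L := by positivity
  have hφ : LipGrowth L R φ := (MemCP.lipGrowth hp hA hB hr hl₀ hR0 hg).comp hH (hh.lipschitz hp)
  have hφK := hφ.abs_le hL0 hR0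
  have hR1 : 0 ≤ R + 1 := by linarith
  have hiW : Integrable (fun o => φ (normSum X o)) μ :=
    hX.integrable_comp_normSum hφ.continuous hR1 hφK ht (by linarith) (h' l₀)
  have hiZ : Integrable φ (stdNormal d) := integrable_stdNormal_of_le hφ.continuous hR1 hφK
  refine ⟨hiW, hiZ, ?_⟩
  have hWR := hX.integrable_one_add_norm_normSum ht (h' l₀) hR0 (by linarith)
  have hZR := integrable_one_add_norm_rpow_stdNormal (d := d) hR0
  set S := boundSum μ p X A B r
  set S₁ := boundSum μ p X 1 0 r
  set c : ℝ := ((p : ℝ) + 1) / (p.factorial : ℝ)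
  set E₁ := ∫ o, (1 + ‖normSum X o‖) ^ R ∂μ
  set E₂ := ∫ z, (1 + ‖z‖) ^ R ∂(stdNormal d)
  have hh0 := MemCb.hConst_nonneg p h
  have step : ∀ η : ℝ, 0 < η →
      |∫ o, φ (normSum X o) ∂μ - ∫ z, φ z ∂(stdNormal d)| ≤
        c * (hConst p h * (1 + η)) * (S + η * S₁) := by
    intro η hη
    have hlim : Tendsto (fun ε : ℝ => c * (hConst p h * (1 + η)) * (S + η * S₁) +
        ε * (L * 2 ^ R * (E₁ + E₂))) (𝓝[>] 0)
        (𝓝 (c * (hConst p h * (1 + η)) * (S + η * S₁) + 0 * (L * 2 ^ R * (E₁ + E₂)))) :=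
      tendsto_nhdsWithin_of_tendsto_nhds (Continuous.tendsto (by fun_prop) 0)
    rw [zero_mul, add_zero] at hlim
    refine ge_of_tendsto hlim ?_
    filter_upwards [eventually_abs_partialD_smear_le hp hA hB hr hg hh hφ.continuous hη,
      Ioo_mem_nhdsGT (show (0 : ℝ) < 1 by norm_num)] with ε hε hε1
    obtain ⟨κ, hκ⟩ := exists_isMollifier (volume : Measure (Fin d → ℝ)) hε1.1
    set f := smear volume κ φ with hf
    have hfs : SmoothGrowth (R + 1) f :=
      smoothGrowth_smear hκ.contDiff hκ.compact hφ.continuous hR1 (by positivity) hφK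
    -- The mollified function has growth exponent `R + 1`, so the interpolation needs moments of
    -- order `R + 2`; these are available because `p ≥ 1`.
    have hsm := hX.abs_integral_sub_le_of_smooth (A := A + η) (H := hConst p h * (1 + η)) hp hn
      (by positivity) hB hr hR1 hfs (by positivity)
      (fun j w => by rw [mul_assoc]; exact hε κ hκ j w) h' (l₀ := l₀) (by linarith)
    rw [boundSum_add_left] at hsm
    obtain ⟨K₀, -, hK₀⟩ := hfs.growth l₀ 0
    have hfc := hfs.contDiff.continuous
    have hfW : Integrable (fun o => f (normSum X o)) μ :=
      hX.integrable_comp_normSum hfc hR1 hK₀ ht (by linarith) (h' l₀)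
    have hfZ : Integrable f (stdNormal d) := integrable_stdNormal_of_le hfc hR1 hK₀
    have hdiff := hφ.abs_smear_sub_le hL0 hR0 hε1.1 hε1.2.le hκ
    have h1 : |∫ o, f (normSum X o) ∂μ - ∫ o, φ (normSum X o) ∂μ| ≤ ε * (L * 2 ^ R * E₁) := by
      rw [← integral_sub hfW hiW, ← integral_const_mul, ← integral_const_mul]
      exact norm_integral_le_of_norm_le (f := fun o => f (normSum X o) - φ (normSum X o)) ((hWR.const_mul _).const_mul _)
        (Eventually.of_forall fun o => hdiff _)
    have h2 : |∫ z, f z ∂(stdNormal d) - ∫ z, φ z ∂(stdNormal d)| ≤ ε * (L * 2 ^ R * E₂) := by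
      rw [← integral_sub hfZ hiZ, ← integral_const_mul, ← integral_const_mul]
      exact norm_integral_le_of_norm_le (f := fun z => f z - φ z) ((hZR.const_mul _).const_mul _)
        (Eventually.of_forall fun o => hdiff _)
    rw [abs_le] at h1 h2 hsm ⊢
    constructor <;> nlinarith [h1.1, h1.2, h2.1, h2.2, hsm.1, hsm.2]
  have hlim : Tendsto (fun η : ℝ => c * (hConst p h * (1 + η)) * (S + η * S₁)) (𝓝[>] 0)
      (𝓝 (c * (hConst p h * (1 + 0)) * (S + 0 * S₁))) :=
    tendsto_nhdsWithin_of_tendsto_nhds (Continuous.tendsto (by fun_prop) 0)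
  rw [add_zero, mul_one, zero_mul, add_zero] at hlim
  exact ge_of_tendsto hlim (eventually_nhdsWithin_of_forall step)

end Limit

end

section

open scoped Topology
open Filter Set

/-! ### The order of the bound -/

section Order

set_option linter.unusedSectionVars false

/-- Binomial expansion with the first two terms kept exactly, since the linear one will have mean 0.
Every other term is `x²` times a monomial of degree `2 m`, at most `s ^ (2 m) + x ^ (2 m)`, and the
coefficients add up to at most `4 ^ (m + 1)`. -/
theorem add_pow_even_le (m : ℕ) (s x : ℝ) :
    (s + x) ^ (2 * (m + 1)) ≤ s ^ (2 * (m + 1)) + 2 * (m + 1) * (s ^ (2 * m + 1) * x) +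
      4 ^ (m + 1) * (s ^ (2 * m) * x ^ 2 + x ^ (2 * (m + 1))) := by
  have hterm : ∀ k ∈ Finset.range (2 * m + 1),
      x ^ (k + 1 + 1) * s ^ (2 * (m + 1) - (k + 1 + 1)) * ((2 * (m + 1)).choose (k + 1 + 1) : ℝ) ≤
        (s ^ (2 * m) * x ^ 2 + x ^ (2 * (m + 1))) * ((2 * (m + 1)).choose (k + 1 + 1) : ℝ) := by
    intro k hk
    have hk' : k ≤ 2 * m := by have := Finset.mem_range.1 hk; omega
    refine mul_le_mul_of_nonneg_right ?_ (Nat.cast_nonneg _)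
    have e : 2 * (m + 1) - (k + 1 + 1) = 2 * m - k := by omega
    rw [e]
    have h1 : x ^ k * s ^ (2 * m - k) ≤ s ^ (2 * m) + x ^ (2 * m) := by
      have hev : Even (2 * m) := even_two_mul m
      refine (le_abs_self _).trans ?_
      rw [abs_mul, abs_pow, abs_pow, ← hev.pow_abs s, ← hev.pow_abs x]
      have e2 : ∀ y : ℝ, y ^ (2 * m) = y ^ k * y ^ (2 * m - k) := fun y => by
        rw [← pow_add]; congr 1; omega
      rcases le_total |x| |s| with h | h
      · have : |x| ^ k * |s| ^ (2 * m - k) ≤ |s| ^ (2 * m) := by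
          rw [e2 |s|]; gcongr
        have h3 : 0 ≤ |x| ^ (2 * m) := by positivity
        linarith
      · have : |x| ^ k * |s| ^ (2 * m - k) ≤ |x| ^ (2 * m) := by
          rw [e2 |x|]; gcongr
        have h3 : 0 ≤ |s| ^ (2 * m) := by positivity
        linarith
    calc x ^ (k + 1 + 1) * s ^ (2 * m - k) = x ^ 2 * (x ^ k * s ^ (2 * m - k)) := by ring
      _ ≤ x ^ 2 * (s ^ (2 * m) + x ^ (2 * m)) := by gcongr
      _ = _ := by ring
  have hb0 : 0 ≤ s ^ (2 * m) * x ^ 2 + x ^ (2 * (m + 1)) := by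
    rw [pow_mul, pow_mul]; positivity
  have hch : ∑ k ∈ Finset.range (2 * m + 1), ((2 * (m + 1)).choose (k + 1 + 1) : ℝ) ≤
      4 ^ (m + 1) := by
    have h1 : ∑ k ∈ Finset.range (2 * (m + 1) + 1), ((2 * (m + 1)).choose k : ℝ) =
        4 ^ (m + 1) := by
      rw [← Nat.cast_sum, Nat.sum_range_choose, pow_mul]; norm_num
    rw [← h1, show 2 * (m + 1) + 1 = 2 * m + 1 + 1 + 1 by ring, Finset.sum_range_succ' _ (_ + 1 + 1),
      Finset.sum_range_succ' _ (2 * m + 1)]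
    have h2 : ∀ k, (0 : ℝ) ≤ ((2 * (m + 1)).choose k : ℝ) := fun k => Nat.cast_nonneg _
    linarith [h2 (0 + 1), h2 0]
  have hsum := (Finset.sum_le_sum hterm).trans_eq (Finset.mul_sum _ _ _).symm
  have hsum2 := hsum.trans (mul_le_mul_of_nonneg_left hch hb0)
  rw [add_comm s x, add_pow, show 2 * (m + 1) + 1 = 2 * m + 1 + 1 + 1 by ring,
    Finset.sum_range_succ', Finset.sum_range_succ' _ (2 * m + 1)]
  have e1 : 2 * (m + 1) - (0 + 1) = 2 * m + 1 := by omega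
  rw [e1]
  simp only [zero_add, pow_one, pow_zero, Nat.choose_one_right, Nat.choose_zero_right, Nat.sub_zero]
  push_cast
  linarith

/-- A constant for the moments of order `2 * m` of sums of independent centred variables. -/
noncomputable def evenMomentConst (M : ℝ) : ℕ → ℝ
  | 0 => 1
  | m + 1 => 4 ^ (m + 1) * (evenMomentConst M m + M)

theorem evenMomentConst_nonneg {M : ℝ} (hM : 0 ≤ M) (m : ℕ) : 0 ≤ evenMomentConst M m := by
  induction m with
  | zero => exact zero_le_one
  | succ m ih => unfold evenMomentConst; positivity

variable {Ω : Type*} [MeasurableSpace Ω] {μ : Measure Ω} [IsProbabilityMeasure μ]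

/-- Induction on the order and, inside it, on the number of variables. A new variable raises the
moment of order `2 (m + 1)` only through the moment of order `2 m` of the sum, which grows like the
`m`-th power of the cardinality, and through its own moment; adding these increments raises the
power by one. -/
theorem integral_sum_pow_le {ι : Type*} {Y : ι → Ω → ℝ} (hY : ∀ i, Measurable (Y i))
    (hind : iIndepFun Y μ) (h0 : ∀ i, ∫ o, Y i o ∂μ = 0) (h1 : ∀ i, ∫ o, Y i o ^ 2 ∂μ = 1)
    {M : ℝ} (hM : 0 ≤ M) (m : ℕ) (hi : ∀ i, MemLp (Y i) (2 * m : ℕ) μ)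
    (hYM : ∀ l ≤ m, ∀ i, ∫ o, Y i o ^ (2 * l) ∂μ ≤ M) (s : Finset ι) :
    ∫ o, (∑ i ∈ s, Y i o) ^ (2 * m) ∂μ ≤ evenMomentConst M m * (s.card : ℝ) ^ m := by
  induction m generalizing s with
  | zero => simp [evenMomentConst]
  | succ m ih =>
    have hpow : ∀ {f : Ω → ℝ}, MemLp f (2 * (m + 1) : ℕ) μ → ∀ k ≤ 2 * (m + 1),
        Integrable (fun o => f o ^ k) μ := fun {f} hf k hk => by
      have h2 : MemLp f k μ := hf.mono_exponent (by exact_mod_cast hk)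
      rcases Nat.eq_zero_or_pos k with rfl | hk0
      · simp
      · have h3 := h2.integrable_norm_pow hk0.ne'
        refine h3.mono' (hf.aestronglyMeasurable.pow k) (Eventually.of_forall fun o => ?_)
        rw [norm_pow]
    have hS : ∀ s : Finset ι, MemLp (fun o => ∑ i ∈ s, Y i o) (2 * (m + 1) : ℕ) μ :=
      fun s => memLp_finsetSum _ fun i _ => hi i
    have ih' := ih (fun i => (hi i).mono_exponent (by
      exact_mod_cast (by omega : 2 * m ≤ 2 * (m + 1)))) fun l hl => hYM l (by omega)
    have hC := evenMomentConst_nonneg hM m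
    classical
    induction s using Finset.induction_on with
    | empty => simp
    | insert i s his ihs =>
      have hi1 := hind.indepFun_finsetSum_of_notMem hY his
      have hSe : (∑ j ∈ s, Y j) = fun o => ∑ j ∈ s, Y j o := by funext o; simp
      rw [hSe] at hi1
      have hSi := hS s
      set S : Ω → ℝ := fun o => ∑ j ∈ s, Y j o with hSdef
      have ha : IndepFun (fun o => S o ^ (2 * m + 1)) (Y i) μ :=
        hi1.comp (φ := fun x => x ^ (2 * m + 1)) (ψ := fun x => x) (by fun_prop) (by fun_prop)
      have hb : IndepFun (fun o => S o ^ (2 * m)) (fun o => Y i o ^ 2) μ :=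
        hi1.comp (φ := fun x => x ^ (2 * m)) (ψ := fun x => x ^ 2) (by fun_prop) (by fun_prop)
      have hS1 := hpow hSi (2 * m + 1) (by omega)
      have hS0 := hpow hSi (2 * m) (by omega)
      have hS2 := hpow hSi (2 * (m + 1)) le_rfl
      have hY1 : Integrable (Y i) μ := by simpa using hpow (hi i) 1 (by omega)
      have hY2 := hpow (hi i) 2 (by omega)
      have hY3 := hpow (hi i) (2 * (m + 1)) le_rfl
      have hai : Integrable (fun o => S o ^ (2 * m + 1) * Y i o) μ := ha.integrable_mul hS1 hY1
      have hbi : Integrable (fun o => S o ^ (2 * m) * Y i o ^ 2) μ := hb.integrable_mul hS0 hY2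
      have hae : ∫ o, S o ^ (2 * m + 1) * Y i o ∂μ = 0 := by
        rw [ha.integral_fun_mul_eq_mul_integral hS1.1 hY1.1, h0, mul_zero]
      have hbe : ∫ o, S o ^ (2 * m) * Y i o ^ 2 ∂μ = ∫ o, S o ^ (2 * m) ∂μ := by
        rw [hb.integral_fun_mul_eq_mul_integral hS0.1 hY2.1, h1, mul_one]
      have hm : ∫ o, (∑ j ∈ insert i s, Y j o) ^ (2 * (m + 1)) ∂μ ≤
          ∫ o, (S o ^ (2 * (m + 1)) + 2 * (m + 1) * (S o ^ (2 * m + 1) * Y i o) +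
            4 ^ (m + 1) * (S o ^ (2 * m) * Y i o ^ 2 + Y i o ^ (2 * (m + 1)))) ∂μ := by
        refine integral_mono (hpow (hS _) _ le_rfl) ((hS2.add (hai.const_mul _)).add
          ((hbi.add hY3).const_mul _)) fun o => ?_
        simp only [Finset.sum_insert his]
        rw [add_comm (Y i o)]
        exact add_pow_even_le m _ _
      have hexp : ∫ o, (S o ^ (2 * (m + 1)) + 2 * (m + 1) * (S o ^ (2 * m + 1) * Y i o) +
            4 ^ (m + 1) * (S o ^ (2 * m) * Y i o ^ 2 + Y i o ^ (2 * (m + 1)))) ∂μ =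
          ∫ o, S o ^ (2 * (m + 1)) ∂μ +
            4 ^ (m + 1) * (∫ o, S o ^ (2 * m) ∂μ + ∫ o, Y i o ^ (2 * (m + 1)) ∂μ) := by
        have hai' := hai.const_mul (2 * ((m : ℝ) + 1))
        have hbY : Integrable (fun o => S o ^ (2 * m) * Y i o ^ 2 + Y i o ^ (2 * (m + 1))) μ :=
          hbi.add hY3
        rw [integral_add (f := fun o => S o ^ (2 * (m + 1)) +
            2 * (m + 1) * (S o ^ (2 * m + 1) * Y i o)) (hS2.add hai')
            (hbY.const_mul (4 ^ (m + 1))),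
          integral_add hS2 hai', integral_const_mul, integral_const_mul,
          integral_add hbi hY3, hae, hbe, mul_zero, add_zero]
      rw [hexp] at hm
      refine hm.trans ?_
      have h3 := ih' s
      have h4 := hYM (m + 1) le_rfl i
      rw [Finset.card_insert_of_notMem his]
      push_cast
      set c : ℝ := (s.card : ℝ) with hc
      have hc0 : 0 ≤ c := Nat.cast_nonneg _
      have h5 : c ^ m ≤ (c + 1) ^ m := by gcongr; linarith
      have h6 : (1 : ℝ) ≤ (c + 1) ^ m := one_le_pow₀ (by linarith)
      have h7 : ∫ o, S o ^ (2 * m) ∂μ + ∫ o, Y i o ^ (2 * (m + 1)) ∂μ ≤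
          (evenMomentConst M m + M) * (c + 1) ^ m := by
        have := mul_le_mul_of_nonneg_left h5 hC
        have := mul_le_mul_of_nonneg_left h6 hM
        linarith
      have h8 := mul_le_mul_of_nonneg_left h7 (by positivity : (0 : ℝ) ≤ 4 ^ (m + 1))
      have h9 : evenMomentConst M (m + 1) * c ^ (m + 1) ≤
          evenMomentConst M (m + 1) * (c * (c + 1) ^ m) := by
        rw [pow_succ' c]
        exact mul_le_mul_of_nonneg_left (mul_le_mul_of_nonneg_left h5 hc0)
          (evenMomentConst_nonneg hM _)
      have e : evenMomentConst M (m + 1) = 4 ^ (m + 1) * (evenMomentConst M m + M) := rfl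
      rw [e] at h9 ihs ⊢
      calc _ ≤ 4 ^ (m + 1) * (evenMomentConst M m + M) * (c * (c + 1) ^ m) +
            4 ^ (m + 1) * ((evenMomentConst M m + M) * (c + 1) ^ m) :=
          add_le_add (ihs.trans h9) h8
        _ = _ := by ring

variable {d p : ℕ} {n : Fin d → ℕ} {X : (j : Fin d) → Fin (n j) → Ω → ℝ} {A B : ℝ}
  {r : Fin d → ℝ}

theorem IsMatchedArray.integral_abs_rpow_le (hX : IsMatchedArray μ p X) {t s M : ℝ}
    {j : Fin d} {i : Fin (n j)} (hs : 0 ≤ s) (hst : s ≤ t)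
    (h : Integrable (fun o => |X j i o| ^ t) μ) (hM : ∫ o, |X j i o| ^ t ∂μ ≤ M) :
    ∫ o, |X j i o| ^ s ∂μ ≤ 1 + M := by
  have h1 := integral_mono (Integrable.abs_rpow_mono (hX.measurable j i) hs hst h)
    ((integrable_const (1 : ℝ)).add h) fun o => rpow_le_one_add_rpow (abs_nonneg _) hs hst
  refine h1.trans ?_
  simp only [Pi.add_apply]
  rw [integral_add (integrable_const _) h]
  simpa using hM

/-- The exponent is rounded up to an even integer `2 m < s + 2 ≤ s + p + 1`, so the moments assumed
are sufficient, and the normalisation cancels the factor `n_k ^ m`. -/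
theorem IsMatchedArray.integral_abs_normSum_rpow_le (hX : IsMatchedArray μ p X) (hp : 1 ≤ p)
    (hn : ∀ j, 1 ≤ n j) {s M : ℝ} (hs : 0 ≤ s) (hM0 : 0 ≤ M)
    (h : ∀ j i, Integrable (fun o => |X j i o| ^ (s + p + 1)) μ)
    (hM : ∀ j i, ∫ o, |X j i o| ^ (s + p + 1) ∂μ ≤ M) (k : Fin d) :
    ∫ o, |normSum X o k| ^ s ∂μ ≤ 1 + evenMomentConst (1 + M) ⌈s / 2⌉₊ := by
  have hp1 : (1 : ℝ) ≤ p := by exact_mod_cast hp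
  set m := ⌈s / 2⌉₊ with hm
  have ht : 0 < s + p + 1 := by linarith
  have hm1 : s ≤ 2 * m := by linarith [Nat.le_ceil (s / 2)]
  have hm2 : 2 * (m : ℝ) ≤ s + p + 1 := by
    linarith [Nat.ceil_lt_add_one (by positivity : 0 ≤ s / 2)]
  have hnk : (0 : ℝ) < n k := by exact_mod_cast hn k
  have hWm : Measurable fun o => normSum X o k :=
    (measurable_pi_apply k).comp hX.measurable_normSum
  have hL := hX.memLp_normSum ht h k
  have hWs := hL.integrable_abs_rpow hWm ht hs (by linarith)
  have hW2 := hL.integrable_abs_rpow hWm ht (by positivity : (0 : ℝ) ≤ 2 * m) hm2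
  have h1 := integral_mono hWs ((integrable_const (1 : ℝ)).add hW2)
    fun o => rpow_le_one_add_rpow (abs_nonneg _) hs hm1
  refine h1.trans ?_
  simp only [Pi.add_apply]
  rw [integral_add (integrable_const _) hW2]
  simp only [integral_const, probReal_univ, one_smul]
  have hev : ∀ (l : ℕ) (x : ℝ), |x| ^ (2 * (l : ℝ)) = x ^ (2 * l) := fun l x => by
    rw [← (even_two_mul l).pow_abs x, ← Real.rpow_natCast]; push_cast; rfl
  simp only [hev]
  have hinj : Function.Injective (fun i : Fin (n k) => (⟨k, i⟩ : Σ j : Fin d, Fin (n j))) :=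
    fun a b hab => by simpa using hab
  -- The constant `1 + M` also covers `l = 0`, where the moment is 1.
  have hYM : ∀ l ≤ m, ∀ i, ∫ o, X k i o ^ (2 * l) ∂μ ≤ 1 + M := fun l hl i => by
    have hl' : (l : ℝ) ≤ m := by exact_mod_cast hl
    simp only [← hev]
    exact hX.integral_abs_rpow_le (by positivity) (by linarith) (h k i) (hM k i)
  have hmem : ∀ i, MemLp (X k i) (2 * m : ℕ) μ := fun i => by
    refine (hX.memLp ht (h k i)).mono_exponent ?_
    rw [← ENNReal.ofReal_natCast]
    exact ENNReal.ofReal_le_ofReal (by push_cast; linarith)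
  have hindk := hX.indep.precomp hinj
  have key := integral_sum_pow_le (Y := X k) (hX.measurable k) hindk
    (hX.integral_eq_zero hp k) (hX.variance k) (by linarith : 0 ≤ 1 + M) m hmem hYM Finset.univ
  rw [Finset.card_univ, Fintype.card_fin] at key
  simp only [normSum, div_pow]
  rw [integral_div, pow_mul, Real.sq_sqrt hnk.le]
  gcongr
  rwa [div_le_iff₀ (by positivity)]

/-- Every bracket is at most a constant `T` free of the array, and `n_j · n_j^{-(p+1)/2} =
n_j^{-(p-1)/2}`. As this exponent is non-positive, the smallest sample size gives the worst case. -/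
theorem exists_boundSum_le (hd : 0 < d) (hp : 1 ≤ p) (hA : 0 ≤ A) (hB : 0 ≤ B)
    (hr : ∀ l, 0 ≤ r l) (M : ℝ) : ∃ C : ℝ, ∀ (Ω : Type*) [MeasurableSpace Ω] (μ : Measure Ω)
      [IsProbabilityMeasure μ] (n : Fin d → ℕ) (X : (j : Fin d) → Fin (n j) → Ω → ℝ),
      (∀ j, 1 ≤ n j) → IsMatchedArray μ p X →
      (∀ j i l, Integrable (fun o => |X j i o| ^ (r l + p + 1)) μ ∧
        ∫ o, |X j i o| ^ (r l + p + 1) ∂μ ≤ M) →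
      boundSum μ p X A B r ≤ C * ((⨅ j, n j : ℕ) : ℝ) ^ (-((p : ℝ) - 1) / 2) := by
  set T : ℝ := A * (1 + M) + B * ∑ k : Fin d, (2 : ℝ) ^ r k *
    ((2 : ℝ) ^ r k * (1 + M) * (1 + evenMomentConst (1 + M) ⌈r k / 2⌉₊) +
      (2 : ℝ) ^ r k * M + absMomentZ (r k + 1) * (1 + M)) with hT
  refine ⟨d * T, fun Ω _ μ _ n X hn hX h => ?_⟩
  have : Nonempty (Fin d) := ⟨⟨0, hd⟩⟩
  have hp1 : (1 : ℝ) ≤ p := by exact_mod_cast hp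
  -- `T` is fixed before any array is given, and `M` may be negative; the existence of an array
  -- excludes that.
  have hM : 0 ≤ M := (integral_nonneg fun o => by positivity).trans
    (h ⟨0, hd⟩ ⟨0, hn _⟩ ⟨0, hd⟩).2
  have hT0 : 0 ≤ T := by
    have : 0 ≤ ∑ k : Fin d, (2 : ℝ) ^ r k *
      ((2 : ℝ) ^ r k * (1 + M) * (1 + evenMomentConst (1 + M) ⌈r k / 2⌉₊) +
      (2 : ℝ) ^ r k * M + absMomentZ (r k + 1) * (1 + M)) :=
      Finset.sum_nonneg fun k _ => by
        have h1 := evenMomentConst_nonneg (by linarith : 0 ≤ 1 + M) ⌈r k / 2⌉₊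
        have h2 := absMomentZ_nonneg (r k + 1)
        positivity
    positivity
  have hXp : ∀ j i, ∫ o, |X j i o| ^ (p + 1) ∂μ ≤ 1 + M := fun j i => by
    have h1 := hX.integral_abs_rpow_le (s := (p + 1 : ℕ)) (by positivity)
      (by push_cast; linarith [hr ⟨0, hd⟩]) (h j i ⟨0, hd⟩).1 (h j i ⟨0, hd⟩).2
    simpa only [Real.rpow_natCast] using h1
  have hin : ∀ j i, A * ∫ o, |X j i o| ^ (p + 1) ∂μ +
      B * ∑ k : Fin d, (2 : ℝ) ^ r k *
        ((2 : ℝ) ^ r k * (∫ o, |X j i o| ^ (p + 1) ∂μ) * (∫ o, |normSum X o k| ^ r k ∂μ) +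
          (2 : ℝ) ^ r k / (n j : ℝ) ^ (r k / 2) * (∫ o, |X j i o| ^ (r k + p + 1) ∂μ) +
          absMomentZ (r k + 1) * ∫ o, |X j i o| ^ (p + 1) ∂μ) ≤ T := by
    intro j i
    have h0 := hXp j i
    have h00 : 0 ≤ ∫ o, |X j i o| ^ (p + 1) ∂μ := integral_nonneg fun o => by positivity
    rw [hT]
    gcongr with k
    · exact hX.integral_abs_normSum_rpow_le hp hn (hr k) hM (fun j i => (h j i k).1)
        (fun j i => (h j i k).2) k
    · exact div_le_self (by positivity) (Real.one_le_rpow (by exact_mod_cast hn j)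
        (by linarith [hr k]))
    · exact (h j i k).2
    · exact absMomentZ_nonneg _
  have hj : ∀ j, ∑ i : Fin (n j), 1 / (n j : ℝ) ^ (((p : ℝ) + 1) / 2) *
      (A * ∫ o, |X j i o| ^ (p + 1) ∂μ +
      B * ∑ k : Fin d, (2 : ℝ) ^ r k *
        ((2 : ℝ) ^ r k * (∫ o, |X j i o| ^ (p + 1) ∂μ) * (∫ o, |normSum X o k| ^ r k ∂μ) +
          (2 : ℝ) ^ r k / (n j : ℝ) ^ (r k / 2) * (∫ o, |X j i o| ^ (r k + p + 1) ∂μ) +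
          absMomentZ (r k + 1) * ∫ o, |X j i o| ^ (p + 1) ∂μ)) ≤
      T * ((⨅ j, n j : ℕ) : ℝ) ^ (-((p : ℝ) - 1) / 2) := by
    intro j
    have hnj : (0 : ℝ) < n j := by exact_mod_cast hn j
    refine (Finset.sum_le_sum fun i _ => mul_le_mul_of_nonneg_left (hin j i)
      (by positivity)).trans ?_
    rw [Finset.sum_const, Finset.card_univ, Fintype.card_fin, nsmul_eq_mul]
    have e : (n j : ℝ) * (1 / (n j : ℝ) ^ (((p : ℝ) + 1) / 2) * T) =
        T * (n j : ℝ) ^ (-((p : ℝ) - 1) / 2) := by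
      rw [show -((p : ℝ) - 1) / 2 = 1 - ((p : ℝ) + 1) / 2 by ring, Real.rpow_sub hnj,
        Real.rpow_one]
      ring
    rw [e]
    refine mul_le_mul_of_nonneg_left ?_ hT0
    have h1 : 1 ≤ ⨅ j, n j := le_ciInf hn
    have h2 : ⨅ j, n j ≤ n j := ciInf_le (OrderBot.bddBelow _) j
    exact Real.rpow_le_rpow_of_nonpos (by exact_mod_cast h1) (by exact_mod_cast h2)
      (by linarith)
  unfold boundSum
  refine (Finset.sum_le_sum fun j _ => hj j).trans_eq ?_
  rw [Finset.sum_const, Finset.card_univ, Fintype.card_fin, nsmul_eq_mul, mul_assoc]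

end Order

end

/-! ### The error bound and its order -/

theorem theorem3p1 {d p : ℕ} (hd : 0 < d) (hp : 1 ≤ p) {A B : ℝ} (hA : 0 ≤ A) (hB : 0 ≤ B)
    (r : Fin d → ℝ) (hr : ∀ l, 0 ≤ r l) :
    (∀ (Ω : Type*) [MeasurableSpace Ω] (μ : Measure Ω) [IsProbabilityMeasure μ]
        (n : Fin d → ℕ) (X : (j : Fin d) → Fin (n j) → Ω → ℝ)
        (g : (Fin d → ℝ) → ℝ) (h : ℝ → ℝ),
        (∀ j, 1 ≤ n j) → IsMatchedArray μ p X →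
        (∀ j i l, Integrable (fun ω => |X j i ω| ^ (r l + p + 1)) μ) →
        MemCP p (polyDom A B r) g → MemCb p h →
        Integrable (fun ω => h (g (normSum X ω))) μ ∧
        Integrable (fun z => h (g z)) (stdNormal d) ∧
        |∫ ω, h (g (normSum X ω)) ∂μ - ∫ z, h (g z) ∂(stdNormal d)| ≤
          ((p : ℝ) + 1) / (p.factorial : ℝ) * hConst p h * boundSum μ p X A B r) ∧
    (∀ M : ℝ, ∃ C : ℝ, ∀ (Ω : Type*) [MeasurableSpace Ω] (μ : Measure Ω) [IsProbabilityMeasure μ]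
        (n : Fin d → ℕ) (X : (j : Fin d) → Fin (n j) → Ω → ℝ),
        (∀ j, 1 ≤ n j) → IsMatchedArray μ p X →
        (∀ j i l, Integrable (fun ω => |X j i ω| ^ (r l + p + 1)) μ ∧
          ∫ ω, |X j i ω| ^ (r l + p + 1) ∂μ ≤ M) →
        boundSum μ p X A B r ≤ C * ((⨅ j, n j : ℕ) : ℝ) ^ (-((p : ℝ) - 1) / 2)) := by
  refine ⟨fun Ω _ μ _ n X g h hn hX hXi hg hh => ?_,
    fun M => exists_boundSum_le hd hp hA hB hr M⟩
  exact hX.abs_integral_sub_le hd hp hn hA hB hr (fun l j i => hXi j i l) hg hh
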